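/- Let $N=2^n$ and let $V_N=\{0,\dots,N-1\}^2\subset\mathbb Z^2$. Write $|z|=\max(|z_1|,|z_2|)$. For $j\ge 0$ and $z\in\mathbb Z^2$ let $\mathcal B_j(z)$ be the set of all boxes $a+\{0,\dots,2^j-1\}^2$, $a\in\mathbb Z^2$, that contain $z$. Let $b_{j,B}$ ($j\ge0$, $B$ a box of side length $2^j$ with corners in $\mathbb Z^2$) be independent centred Gaussian variables with $\operatorname{Var} b_{j,B}=2^{-2j}$. For $K=2^k$ with an integer $k\ge1$, the $K$-coarse modified branching random walk is $$\varphi_{N,z}(K)=\sum_{j=0}^{\lfloor n/k\rfloor-1}\ \sum_{B\in\mathcal B_{jk}(z)}\sqrt k\,b_{jk,B},\qquad z\in V_N .$$ Let $q\ge1$ be an integer and $0<p\le1$, and let $\{\xi_{N,w}\}_{w\in V_N}$ be $\{0,1\}$-valued random variables such that (i) $\{\xi_{N,w}\}_{w\in V_N}$ is independent of $\{\varphi_{N,w}(K)\}_{w\in V_N}$; (ii) $\{\xi_{N,w}\}_{w\in A}$ and $\{\xi_{N,w}\}_{w\in B}$ are independent whenever $A,B\subseteq V_N$ and $|z-w|>q$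 for all $z\in A$, $w\in B$; (iii) $\mathbb P(\xi_{N,w}=1)\ge p$ for all $w\in V_N$. A path is a self-avoiding nearest-neighbour path in $V_N$, $|P|$ is its number of vertices, and it is called open if $\xi_{N,w}=1$ at each of its vertices $w$. **Theorem 1.3.** Let $0<\delta<\tfrac12$ and let $q\ge1$ be an integer. There exist $K_1=K_1(\delta,q)>0$ and $p_1=p_1(\delta,q)\in(0,1)$ such that the following holds for all $0<\kappa<\tfrac12\delta^2$ and $0<\zeta<\tfrac14\delta^4(\log 2)^2$, all $K=2^k\ge K_1$ and all $p\in[p_1,1]$. For all sufficiently large $n$ (how large depends only on $\delta,q,\kappa,\zeta,K,p$) and all $u,v\in V_N$ with $|u-v|>N^{1-\kappa}$, with probability at least $$1-128\,(1-p)^{\frac1{(2q+1)^2}}-e^{-\zeta n}$$ there exists an open path $P$ in $V_N$ from $u$ to $v$ such that $|P|\le N^{1+2\delta}$ and $\varphi_{N,w}(K)\le 7\delta\log N$ for all $w\in P$. -/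

import Mathlib

open MeasureTheory ProbabilityTheory

noncomputable section

namespace CoarseMBRW

/-- The nearest-neighbour graph of the square lattice `ℤ²`. -/
def gridGraph : SimpleGraph (ℤ × ℤ) where
  Adj z w := |z.1 - w.1| + |z.2 - w.2| = 1
  symm := ⟨fun z w h => by rw [abs_sub_comm w.1, abs_sub_comm w.2]; exact h⟩
  loopless := ⟨fun z h => by simp at h⟩

/-- The box of side length `2 ^ j` in `ℤ²` whose left bottom corner is `a`; it has `2 ^ j` lattice
points in each direction. -/
def box (j : ℕ) (a : ℤ × ℤ) : Finset (ℤ × ℤ) :=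
  Finset.Ico a.1 (a.1 + 2 ^ j) ×ˢ Finset.Ico a.2 (a.2 + 2 ^ j)

/-- `V_N` for `N = 2 ^ n`: the `N × N` box with left bottom corner at the origin. -/
def V (n : ℕ) : Finset (ℤ × ℤ) := box n (0, 0)

/-- The set `ℬ_j(z)` of the boxes of side length `2 ^ j` that contain `z`, each box being given by
its left bottom corner (see `mem_boxesAt`). -/
def boxesAt (j : ℕ) (z : ℤ × ℤ) : Finset (ℤ × ℤ) :=
  Finset.Ioc (z.1 - 2 ^ j) z.1 ×ˢ Finset.Ioc (z.2 - 2 ^ j) z.2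

theorem mem_boxesAt (j : ℕ) (z a : ℤ × ℤ) : a ∈ boxesAt j z ↔ z ∈ box j a := by
  simp only [boxesAt, box, Finset.mem_product, Finset.mem_Ioc, Finset.mem_Ico]
  constructor <;> rintro ⟨⟨h1, h2⟩, h3, h4⟩ <;> refine ⟨⟨?_, ?_⟩, ?_, ?_⟩ <;> linarith

variable {Ω : Type*} [MeasurableSpace Ω]

/-- `b j a` is the Gaussian variable `b_{j,B}` attached to the box `B = box j a`: the variables are
independent, centred, Gaussian, and `b_{j,B}` has variance `2 ^ (-2 j)`. -/
structure IsBoxFamily (μ : Measure Ω) (b : ℕ → ℤ × ℤ → Ω → ℝ) : Prop where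
  measurable : ∀ j a, Measurable (b j a)
  law : ∀ j a, μ.map (b j a) = gaussianReal 0 ((2 ^ (2 * j))⁻¹)
  indep : iIndepFun (fun i : ℕ × (ℤ × ℤ) => b i.1 i.2) μ

/-- The `K`-coarse modified branching random walk `φ_{N,z}(K)` for `K = 2 ^ k`, `N = 2 ^ n`:
`∑_{j=0}^{⌊n/k⌋-1} ∑_{B ∈ ℬ_{jk}(z)} √k b_{jk,B}`. -/
def field (k n : ℕ) (b : ℕ → ℤ × ℤ → Ω → ℝ) (z : ℤ × ℤ) (ω : Ω) : ℝ :=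
  ∑ j ∈ Finset.range (n / k), ∑ a ∈ boxesAt (j * k) z, √(k : ℝ) * b (j * k) a ω

/-- The assumptions on the Bernoulli process `{ξ_{N,w} : w ∈ V_N}`, with `N = 2 ^ n` and `true` for
the value `1`: it is independent of the field `{φ_{N,w} : w ∈ V_N}`, it is `q`-dependent, and every
site is open with probability at least `p`. Values of `ξ` and `φ` off `V_N` are irrelevant. The
distance of `ℤ × ℤ` is the `ℓ_∞`-distance. -/
structure IsSiteProcess (μ : Measure Ω) (n q : ℕ) (p : ℝ) (φ : ℤ × ℤ → Ω → ℝ)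
    (ξ : ℤ × ℤ → Ω → Bool) : Prop where
  measurable : ∀ w ∈ V n, Measurable (ξ w)
  indep_field : IndepFun (fun ω (w : V n) => ξ w ω) (fun ω (w : V n) => φ w ω) μ
  q_dependent : ∀ A ⊆ V n, ∀ B ⊆ V n, (∀ z ∈ A, ∀ w ∈ B, (q : ℝ) < dist z w) →
    IndepFun (fun ω (w : A) => ξ w ω) (fun ω (w : B) => ξ w ω) μ
  prob_open : ∀ w ∈ V n, p ≤ μ.real {ω | ξ w ω = true}

/-- The event that some open self-avoiding path in `V_N`, `N = 2 ^ n`, connects `u` and `v`, has at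
most `M` vertices, and satisfies `φ_w ≤ h` at each of its vertices `w`. -/
def goodPathEvent (n : ℕ) (φ : ℤ × ℤ → Ω → ℝ) (ξ : ℤ × ℤ → Ω → Bool) (u v : ℤ × ℤ) (M h : ℝ) :
    Set Ω :=
  {ω | ∃ P : gridGraph.Walk u v, P.IsPath ∧ (∀ w ∈ P.support, w ∈ V n) ∧
    (∀ w ∈ P.support, ξ w ω = true) ∧ (P.support.length : ℝ) ≤ M ∧ ∀ w ∈ P.support, φ w ω ≤ h}

end CoarseMBRW

end

noncomputable section

namespace CoarseMBRW

/-! Write `K = 2 ^ k = 64 M`. Let `O` be the set of open sites at which the field is at most `h`,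
and explore `O` from `u` by breadth-first search. While `v` has not been reached, the boundary of
the explored set, seen from `v`, is `ℓ_∞`-connected (`starConnected_outerBoundary`) and separates
`u` from `v`. If `D` is its diameter, it therefore lies within distance `D` of an end point `x`
(`near_of_separates`). Its sites in `O` all belong to the next layer of the search.

If `K ^ s ≤ D < K ^ (s + 1)`, the boundary contains the `M ^ s` leaves of a tree whose vertices are
well separated at every scale (`ConnectedOn.exists_tree`). On a good event at least half of the
leaves of every relevant tree are in `O` (`tree_half_good`), so the layer has at least `M ^ s / 2`
points in the ball of radius `K ^ (s + 1)` around `x`. Layers are disjoint, so this happens for at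
most of order `K ^ (2 (s + 1)) / M ^ s = K ^ 2 (64 K) ^ s` radii. Summing over the scales up to `N`
bounds the number of steps by `N ^ (1 + 6 / k)` times a polynomial in `n` (`card_layers_le`), and `6
/ k ≤ δ`.

The good event has large probability by a union bound over trees: there are at most `C ^ (M ^ s)` of
them, so a failure probability that is a small enough power `c ^ (M ^ s)` is affordable. For closed
sites this follows from `q`-dependence when `1 - p` is small. For the field, the level `j` at a leaf
is dominated by a maximum over a block around its ancestor of height `j`. These ancestors are the
leaves of a shorter tree, their blocks use disjoint families of Gaussian variables, and chaining
controls the exponential moment of one block (`lintegral_prod_blockBound_le`). For large `K` this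
makes the average of one level over the leaves at most `δ k / 2`.

The argument needs `M ^ (s - j)` large. The levels from `s - t` on, with `t` of order `log n`, are
therefore bounded uniformly near the end points by a Gaussian tail of order `exp (-δ ^ 2 n)`.
Markov's inequality then leaves at most a quarter of the leaves high. If `D < K ^ t`, the uniform
bound makes every nearby site low, and the only obstruction is a closed `ℓ_∞`-walk around an end
point, which costs a multiple of `closedRate q p`. -/

/-! ### Planar topology: boundaries and separation in a square -/

/-- `S` is connected with respect to the relation `r`: a property that is passed on along `r`
inside `S` is shared by all points of `S` as soon as it holds at one of them. -/
def ConnectedOn {α : Type*} (r : α → α → Prop) (S : Set α) : Prop :=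
  ∀ g : α → Prop, (∀ z ∈ S, ∀ w ∈ S, r z w → g z → g w) → ∀ z ∈ S, ∀ w ∈ S, g z → g w

/-- The `ℓ_∞`-distance of `z` and `w` is at most `r`. -/
def Near (r : ℤ) (z w : ℤ × ℤ) : Prop :=
  z.1 ≤ w.1 + r ∧ w.1 ≤ z.1 + r ∧ z.2 ≤ w.2 + r ∧ w.2 ≤ z.2 + r

theorem Near.symm {r : ℤ} {z w : ℤ × ℤ} (h : Near r z w) : Near r w z :=
  ⟨h.2.1, h.1, h.2.2.2, h.2.2.1⟩

theorem mem_V {n : ℕ} {z : ℤ × ℤ} :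
    z ∈ V n ↔ 0 ≤ z.1 ∧ z.1 < 2 ^ n ∧ 0 ≤ z.2 ∧ z.2 < 2 ^ n := by
  simp [V, box, and_assoc]

theorem adj_iff {z w : ℤ × ℤ} : gridGraph.Adj z w ↔
    (w.1 = z.1 ∧ (w.2 = z.2 + 1 ∨ z.2 = w.2 + 1)) ∨
      (w.2 = z.2 ∧ (w.1 = z.1 + 1 ∨ z.1 = w.1 + 1)) := by
  change |z.1 - w.1| + |z.2 - w.2| = 1 ↔ _
  rcases abs_cases (z.1 - w.1) with ⟨h1, _⟩ | ⟨h1, _⟩ <;>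
    rcases abs_cases (z.2 - w.2) with ⟨h2, _⟩ | ⟨h2, _⟩ <;> rw [h1, h2] <;> omega

/-- The discrete Poincaré lemma on a square, with coefficients in `ZMod 2`. -/
theorem exists_potential (N : ℤ) (h v : ℤ → ℤ → ZMod 2)
    (face : ∀ x y, 0 ≤ x → x + 1 < N → 0 ≤ y → y + 1 < N →
      h x y + v (x + 1) y = v x y + h x (y + 1)) :
    ∃ f : ℤ → ℤ → ZMod 2,
      (∀ x y, 0 ≤ x → x + 1 < N → 0 ≤ y → y < N → f (x + 1) y = f x y + h x y) ∧
      (∀ x y, 0 ≤ x → x < N → 0 ≤ y → y + 1 < N → f x (y + 1) = f x y + v x y) := by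
  refine ⟨fun x y => ∑ i ∈ Finset.range x.toNat, h i 0 + ∑ j ∈ Finset.range y.toNat, v x j,
    ?_, ?_⟩
  · intro x y hx hxN hy hyN
    lift x to ℕ using hx
    lift y to ℕ using hy
    have key : ∀ y : ℕ, (y : ℤ) < N → h x 0 + ∑ j ∈ Finset.range y, v (x + 1) j =
        ∑ j ∈ Finset.range y, v x j + h x y := by
      intro y
      induction y with
      | zero => intro _; simp
      | succ y ih =>
        intro hy
        push_cast at hy
        rw [Finset.sum_range_succ, Finset.sum_range_succ, ← add_assoc, ih (by omega), add_assoc,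
          face x y (by omega) hxN (by omega) hy]
        push_cast
        ring
    have h1 : ((x : ℤ) + 1).toNat = x + 1 := by omega
    simp only [h1, Int.toNat_natCast, Finset.sum_range_succ]
    rw [add_assoc, key y hyN]
    ring
  · intro x y hx hxN hy hyN
    lift y to ℕ using hy
    have h1 : ((y : ℤ) + 1).toNat = y + 1 := by omega
    simp only [h1, Int.toNat_natCast, Finset.sum_range_succ]
    ring

/-- The connected component of `v` in `V n \ C`. -/
def outer (n : ℕ) (C : Set (ℤ × ℤ)) (v : ℤ × ℤ) : Set (ℤ × ℤ) :=
  {w | Relation.ReflTransGen (fun a b => gridGraph.Adj a b ∧ b ∈ V n ∧ b ∉ C) v w}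

/-- The vertices of the component of `v` in `V n \ C` that are adjacent to `C`. -/
def outerBoundary (n : ℕ) (C : Set (ℤ × ℤ)) (v : ℤ × ℤ) : Set (ℤ × ℤ) :=
  {w | w ∈ outer n C v ∧ ∃ c ∈ C, gridGraph.Adj c w}

section outer

variable {n : ℕ} {C : Set (ℤ × ℤ)} {v : ℤ × ℤ}

theorem mem_outer_self : v ∈ outer n C v := Relation.ReflTransGen.refl

theorem outer_subset (hv : v ∈ V n) (hvC : v ∉ C) {w : ℤ × ℤ} (hw : w ∈ outer n C v) :
    w ∈ V n ∧ w ∉ C := by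
  rcases Relation.ReflTransGen.cases_tail hw with rfl | ⟨_, _, h⟩
  · exact ⟨hv, hvC⟩
  · exact h.2

theorem outer_step {z w : ℤ × ℤ} (hz : z ∈ outer n C v) (h : gridGraph.Adj z w) (hw : w ∈ V n)
    (hwC : w ∉ C) : w ∈ outer n C v :=
  Relation.ReflTransGen.tail hz ⟨h, hw, hwC⟩

theorem connectedOn_outer :
    ConnectedOn gridGraph.Adj (outer n C v) := by
  intro g hg
  have key : ∀ w ∈ outer n C v, g v ↔ g w := by
    intro w hw
    induction hw with
    | refl => rfl
    | tail hb hc ih =>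
      have hb' := hb
      have hc' := outer_step hb hc.1 hc.2.1 hc.2.2
      exact ih.trans ⟨hg _ hb _ hc' hc.1, hg _ hc' _ hb hc.1.symm⟩
  intro z hz w hw h
  exact (key w hw).1 ((key z hz).2 h)

/-- The outer boundary of a connected set, seen from `v`, is connected with respect to the
`ℓ_∞`-neighbour relation. -/
theorem starConnected_outerBoundary (hCV : ∀ z ∈ C, z ∈ V n) (hC : ConnectedOn gridGraph.Adj C)
    (hv : v ∈ V n) (hvC : v ∉ C) : ConnectedOn (Near 1) (outerBoundary n C v) := by
  classical
  intro g hg s hs s' hs' hgs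
  by_contra hgs'
  set S := outerBoundary n C v with hS
  set D := outer n C v with hD
  -- The cochain `e` marks the edges that cross from `C` to those boundary points at which `g`
  -- holds. It is closed, so it has a potential, and this potential is constant on `C` and on `D`.
  -- Hence all crossings have the same value, while the crossings at `s` and `s'` have the values
  -- `1` and `0`.
  let e : ℤ × ℤ → ℤ × ℤ → ZMod 2 := fun z w =>
    if (z ∈ C ∧ w ∈ S ∧ g w) ∨ (w ∈ C ∧ z ∈ S ∧ g z) then 1 else 0
  have e_symm : ∀ z w, e z w = e w z := fun z w => by simp only [e, or_comm]
  let d : ℤ × ℤ → ZMod 2 := fun z => if z ∈ D then 1 else 0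
  have hSD : ∀ z ∈ S, z ∈ D := fun z hz => hz.1
  have hDC : ∀ z ∈ D, z ∉ C := fun z hz => (outer_subset hv hvC hz).2
  have e_zero : ∀ z w, ¬ (z ∈ S ∧ g z) → ¬ (w ∈ S ∧ g w) → e z w = 0 := by
    intro z w hz hw
    simp only [e]
    rw [if_neg]
    tauto
  -- Where `g` holds at every boundary point involved, `e` is the coboundary of the indicator of
  -- `D`; in particular it is closed there.
  have e_d : ∀ z w, gridGraph.Adj z w → z ∈ V n → w ∈ V n → (z ∈ S → g z) → (w ∈ S → g w) →
      e z w = d z + d w := by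
    have aux : ∀ z w, gridGraph.Adj z w → z ∈ V n → w ∈ V n → (z ∈ S → g z) → (w ∈ S → g w) →
        w ∈ D → e z w = d z + d w := by
      intro z w hzw hz hw hgz hgw hwD
      by_cases hzC : z ∈ C
      · have hwS : w ∈ S := ⟨hwD, z, hzC, hzw⟩
        have hzD : z ∉ D := fun h => hDC z h hzC
        simp [e, d, hzC, hwS, hgw hwS, hwD, hzD]
      · have hzD : z ∈ D := outer_step hwD hzw.symm hz hzC
        have hwC := hDC w hwD
        simp only [e, d, hzC, hwC, hzD, hwD, false_and, or_self, if_false, if_true]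
        decide
    intro z w hzw hz hw hgz hgw
    by_cases hwD : w ∈ D
    · exact aux z w hzw hz hw hgz hgw hwD
    · by_cases hzD : z ∈ D
      · rw [e_symm, add_comm]
        exact aux w z hzw.symm hw hz hgw hgz hzD
      · have hzS : z ∉ S := fun h => hzD (hSD z h)
        have hwS : w ∉ S := fun h => hwD (hSD w h)
        simp [e, d, hzD, hwD, hzS, hwS]
  obtain ⟨f, fh, fv⟩ := exists_potential (2 ^ n) (fun x y => e (x, y) (x + 1, y))
    (fun x y => e (x, y) (x, y + 1)) (by
      intro x y hx hxN hy hyN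
      have m1 : ((x, y) : ℤ × ℤ) ∈ V n := mem_V.2 ⟨hx, by simp; omega, hy, by simp; omega⟩
      have m2 : ((x + 1, y) : ℤ × ℤ) ∈ V n :=
        mem_V.2 ⟨by simp; omega, by simp; omega, hy, by simp; omega⟩
      have m3 : ((x, y + 1) : ℤ × ℤ) ∈ V n :=
        mem_V.2 ⟨hx, by simp; omega, by simp; omega, by simp; omega⟩
      have m4 : ((x + 1, y + 1) : ℤ × ℤ) ∈ V n :=
        mem_V.2 ⟨by simp; omega, by simp; omega, by simp; omega, by simp; omega⟩
      have a12 : gridGraph.Adj (x, y) (x + 1, y) := by rw [adj_iff]; simp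
      have a13 : gridGraph.Adj (x, y) (x, y + 1) := by rw [adj_iff]; simp
      have a24 : gridGraph.Adj (x + 1, y) (x + 1, y + 1) := by rw [adj_iff]; simp
      have a34 : gridGraph.Adj (x, y + 1) (x + 1, y + 1) := by rw [adj_iff]; simp
      -- The corners of a unit face are `ℓ_∞`-neighbours, so one boundary corner with `g` forces `g`
      -- at all boundary corners. Each face thus sees either a coboundary or zero.
      by_cases hone : ∃ z ∈ S, g z ∧ (z = (x, y) ∨ z = (x + 1, y) ∨ z = (x, y + 1) ∨
          z = (x + 1, y + 1))
      · obtain ⟨z, hzS, hgz, hz⟩ := hone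
        have hall : ∀ w, (w = (x, y) ∨ w = (x + 1, y) ∨ w = (x, y + 1) ∨
            w = (x + 1, y + 1)) → w ∈ S → g w := by
          intro w hw hwS
          refine hg z hzS w hwS ?_ hgz
          rcases hz with rfl | rfl | rfl | rfl <;> rcases hw with rfl | rfl | rfl | rfl <;>
            simp only [Near] <;> omega
        have g1 := hall (x, y) (by simp)
        have g2 := hall (x + 1, y) (by simp)
        have g3 := hall (x, y + 1) (by simp)
        have g4 := hall (x + 1, y + 1) (by simp)
        rw [e_d _ _ a12 m1 m2 g1 g2, e_d _ _ a24 m2 m4 g2 g4, e_d _ _ a13 m1 m3 g1 g3,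
          e_d _ _ a34 m3 m4 g3 g4]
        have h2 : ∀ a : ZMod 2, a + a = 0 := by decide
        linear_combination h2 (d (x + 1, y)) - h2 (d (x, y + 1))
      · push Not at hone
        have g1 : ¬ ((x, y) ∈ S ∧ g (x, y)) := fun h => (hone _ h.1 h.2).1 rfl
        have g2 : ¬ ((x + 1, y) ∈ S ∧ g (x + 1, y)) := fun h => (hone _ h.1 h.2).2.1 rfl
        have g3 : ¬ ((x, y + 1) ∈ S ∧ g (x, y + 1)) := fun h => (hone _ h.1 h.2).2.2.1 rfl
        have g4 : ¬ ((x + 1, y + 1) ∈ S ∧ g (x + 1, y + 1)) :=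
          fun h => (hone _ h.1 h.2).2.2.2 rfl
        rw [e_zero _ _ g1 g2, e_zero _ _ g2 g4, e_zero _ _ g1 g3, e_zero _ _ g3 g4])
  have two : ∀ a b : ZMod 2, a + b + b = a := by decide
  have fe : ∀ z ∈ V n, ∀ w ∈ V n, gridGraph.Adj z w → f w.1 w.2 = f z.1 z.2 + e z w := by
    rintro ⟨x, y⟩ hz ⟨x', y'⟩ hw hzw
    rw [mem_V] at hz hw
    rw [adj_iff] at hzw
    simp only at hz hw hzw ⊢
    rcases hzw with ⟨rfl, rfl | rfl⟩ | ⟨rfl, rfl | rfl⟩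
    · exact fv _ _ (by omega) (by omega) (by omega) (by omega)
    · rw [fv _ _ (by omega) (by omega) (by omega) (by omega), e_symm, two]
    · exact fh _ _ (by omega) (by omega) (by omega) (by omega)
    · rw [fh _ _ (by omega) (by omega) (by omega) (by omega), e_symm, two]
  have fC : ∀ z ∈ C, ∀ w ∈ C, f w.1 w.2 = f z.1 z.2 := by
    intro z hz w hw
    refine hC (fun w => f w.1 w.2 = f z.1 z.2) ?_ z hz w hw rfl
    intro a ha b hb hab h
    have haS : a ∉ S := fun h => hDC a (hSD a h) ha
    have hbS : b ∉ S := fun h => hDC b (hSD b h) hb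
    rw [fe a (hCV a ha) b (hCV b hb) hab, h, e_zero _ _ (fun h => haS h.1) (fun h => hbS h.1),
      add_zero]
  have fD : ∀ z ∈ D, ∀ w ∈ D, f w.1 w.2 = f z.1 z.2 := by
    intro z hz w hw
    refine connectedOn_outer (fun w => f w.1 w.2 = f z.1 z.2) ?_ z hz w hw rfl
    intro a ha b hb hab h
    rw [fe a (outer_subset hv hvC ha).1 b (outer_subset hv hvC hb).1 hab, h]
    simp [e, hDC a ha, hDC b hb]
  obtain ⟨c, hc, hcs⟩ := hs.2
  obtain ⟨c', hc', hcs'⟩ := hs'.2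
  have h1 := fe c (hCV c hc) s (outer_subset hv hvC hs.1).1 hcs
  have h2 := fe c' (hCV c' hc') s' (outer_subset hv hvC hs'.1).1 hcs'
  have e1 : e c s = 1 := by simp only [e]; rw [if_pos (Or.inl ⟨hc, hs, hgs⟩)]
  have e2 : e c' s' = 0 := e_zero _ _ (fun h => hDC c' (hSD c' h.1) hc') (fun h => hgs' h.2)
  rw [fC c hc c' hc', fD s hs.1 s' hs'.1, e2, h1, e1] at h2
  have : (1 : ZMod 2) = 0 := by linear_combination h2
  exact absurd this (by decide)

theorem outer_iff_of_adj {z w : ℤ × ℤ} (hz : z ∈ V n) (hw : w ∈ V n)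
    (h : gridGraph.Adj z w)
    (hzS : z ∉ outerBoundary n C v) (hwS : w ∉ outerBoundary n C v) :
    z ∈ outer n C v ↔ w ∈ outer n C v := by
  constructor
  · intro hzD
    by_cases hwC : w ∈ C
    · exact absurd ⟨hzD, w, hwC, h.symm⟩ hzS
    · exact outer_step hzD h hw hwC
  · intro hwD
    by_cases hzC : z ∈ C
    · exact absurd ⟨hwD, z, hzC, h⟩ hwS
    · exact outer_step hwD h.symm hz hzC

end outer

theorem int_interval_induction {N : ℤ} {P : ℤ → Prop}
    (h : ∀ x, 0 ≤ x → x + 1 < N → (P x ↔ P (x + 1))) {x y : ℤ} (hx : 0 ≤ x) (hxN : x < N)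
    (hy : 0 ≤ y) (hyN : y < N) : P x ↔ P y := by
  have key : ∀ a : ℕ, (a : ℤ) < N → (P 0 ↔ P a) := by
    intro a
    induction a with
    | zero => intro _; rfl
    | succ a ih =>
      intro ha
      push_cast at ha ⊢
      exact (ih (by omega)).trans (h a (by omega) ha)
  lift x to ℕ using hx
  lift y to ℕ using hy
  exact (key x hxN).symm.trans (key y hyN)

/-- A set of diameter at most `D` that separates `u` from `v` inside the square `V n` lies within
distance `D` of one of the two points. -/
theorem near_of_separates {n : ℕ} {S : Set (ℤ × ℤ)} (hSV : ∀ z ∈ S, z ∈ V n)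
    {f : ℤ × ℤ → Prop}
    (hf : ∀ z ∈ V n, ∀ w ∈ V n, gridGraph.Adj z w → z ∉ S → w ∉ S → (f z ↔ f w))
    {u v : ℤ × ℤ} (hu : u ∈ V n) (hv : v ∈ V n) (hfu : ¬ f u) (hfv : f v) {D : ℤ}
    (hD : ∀ z ∈ S, ∀ w ∈ S, Near D z w) :
    (∀ s ∈ S, Near D u s) ∨ (∀ s ∈ S, Near D v s) := by
  have hcol : ∀ x, 0 ≤ x → x < 2 ^ n → (∀ s ∈ S, s.1 ≠ x) → ∀ y y', 0 ≤ y → y < 2 ^ n →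
      0 ≤ y' → y' < 2 ^ n → (f (x, y) ↔ f (x, y')) := by
    intro x hx hxN hxS y y' hy hyN hy' hyN'
    refine int_interval_induction (P := fun y => f (x, y)) (fun y hy hyN => ?_) hy hyN hy' hyN'
    exact hf _ (mem_V.2 ⟨hx, hxN, hy, by simp; omega⟩) _
      (mem_V.2 ⟨hx, hxN, by simp; omega, by simp; omega⟩) (by rw [adj_iff]; simp)
      (fun h => hxS _ h rfl) (fun h => hxS _ h rfl)
  have hrow : ∀ y, 0 ≤ y → y < 2 ^ n → (∀ s ∈ S, s.2 ≠ y) → ∀ x x', 0 ≤ x → x < 2 ^ n →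
      0 ≤ x' → x' < 2 ^ n → (f (x, y) ↔ f (x', y)) := by
    intro y hy hyN hyS x x' hx hxN hx' hxN'
    refine int_interval_induction (P := fun x => f (x, y)) (fun x hx hxN => ?_) hx hxN hx' hxN'
    exact hf _ (mem_V.2 ⟨hx, by simp; omega, hy, hyN⟩) _
      (mem_V.2 ⟨by simp; omega, by simp; omega, hy, hyN⟩) (by rw [adj_iff]; simp)
      (fun h => hyS _ h rfl) (fun h => hyS _ h rfl)
  have hpos : (0 : ℤ) < 2 ^ n := by positivity
  by_contra hcon
  push Not at hcon
  obtain ⟨⟨s, hs, hsu⟩, s', hs', hsv⟩ := hcon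
  rw [mem_V] at hu hv
  -- If `S` met every column, then `D ≥ 2 ^ n - 1`, and every point of the square would be within
  -- `D` of all of `S`.
  have hcols : ∃ x, 0 ≤ x ∧ x < 2 ^ n ∧ ∀ s ∈ S, s.1 ≠ x := by
    by_contra hno
    push Not at hno
    obtain ⟨a, ha, ha0⟩ := hno 0 le_rfl hpos
    obtain ⟨b, hb, hb0⟩ := hno (2 ^ n - 1) (by omega) (by omega)
    have hDab := hD a ha b hb
    have := mem_V.1 (hSV s hs)
    unfold Near at hDab hsu
    omega
  have hrows : ∃ y, 0 ≤ y ∧ y < 2 ^ n ∧ ∀ s ∈ S, s.2 ≠ y := by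
    by_contra hno
    push Not at hno
    obtain ⟨a, ha, ha0⟩ := hno 0 le_rfl hpos
    obtain ⟨b, hb, hb0⟩ := hno (2 ^ n - 1) (by omega) (by omega)
    have hDab := hD a ha b hb
    have := mem_V.1 (hSV s hs)
    unfold Near at hDab hsu
    omega
  obtain ⟨x₀, hx0, hx0N, hx₀⟩ := hcols
  obtain ⟨y₀, hy0, hy0N, hy₀⟩ := hrows
  -- If both the row and the column of `p` met `S`, all of `S` would be within `D` of `p`. So a free
  -- line leads from `p` to the free column `x₀` or the free row `y₀`, and `f` is constant along it.
  have key : ∀ p : ℤ × ℤ, (0 ≤ p.1 ∧ p.1 < 2 ^ n ∧ 0 ≤ p.2 ∧ p.2 < 2 ^ n) →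
      (∃ s ∈ S, ¬ Near D p s) → (f p ↔ f (x₀, y₀)) := by
    rintro ⟨x, y⟩ hp ⟨s, hs, hps⟩
    simp only at hp
    have hline : (∀ s ∈ S, s.1 ≠ x) ∨ (∀ s ∈ S, s.2 ≠ y) := by
      by_contra hno
      push Not at hno
      obtain ⟨⟨a, ha, hax⟩, b, hb, hby⟩ := hno
      have h1 := hD a ha s hs
      have h2 := hD b hb s hs
      unfold Near at h1 h2 hps
      simp only at hps
      omega
    rcases hline with h | h
    · exact (hcol x hp.1 hp.2.1 h y y₀ hp.2.2.1 hp.2.2.2 hy0 hy0N).trans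
        (hrow y₀ hy0 hy0N hy₀ x x₀ hp.1 hp.2.1 hx0 hx0N)
    · exact (hrow y hp.2.2.1 hp.2.2.2 h x x₀ hp.1 hp.2.1 hx0 hx0N).trans
        (hcol x₀ hx0 hx0N hx₀ y y₀ hp.2.2.1 hp.2.2.2 hy0 hy0N)
  exact hfu (((key u hu ⟨s, hs, hsu⟩).trans (key v hv ⟨s', hs', hsv⟩).symm).2 hfv)

/-! ### Counting and finding `ℓ_∞`-neighbour walks -/

/-- The graph of `ℓ_∞`-neighbours in `ℤ²`. -/
def starGraph : SimpleGraph (ℤ × ℤ) where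
  Adj z w := z ≠ w ∧ Near 1 z w
  symm := ⟨fun _ _ h => ⟨h.1.symm, h.2.symm⟩⟩
  loopless := ⟨fun _ h => h.1 rfl⟩

/-- The vertex sets of the `ℓ_∞`-neighbour walks with `l` steps that start at `z`. -/
def starWalks : ℕ → ℤ × ℤ → Finset (Finset (ℤ × ℤ))
  | 0, z => {{z}}
  | l + 1, z => (Finset.Icc (z.1 - 1) (z.1 + 1) ×ˢ Finset.Icc (z.2 - 1) (z.2 + 1)).biUnion
      fun z' => (starWalks l z').image (insert z)

theorem card_starWalks_le (l : ℕ) (z : ℤ × ℤ) : (starWalks l z).card ≤ 9 ^ l := by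
  induction l generalizing z with
  | zero => simp [starWalks]
  | succ l ih =>
    refine (Finset.card_biUnion_le_card_mul _ _ (9 ^ l)
      fun z' _ => Finset.card_image_le.trans (ih z')).trans ?_
    have h : (Finset.Icc (z.1 - 1) (z.1 + 1) ×ˢ Finset.Icc (z.2 - 1) (z.2 + 1)).card = 9 := by
      rw [Finset.card_product, Int.card_Icc, Int.card_Icc,
        show z.1 + 1 + 1 - (z.1 - 1) = 3 by ring, show z.2 + 1 + 1 - (z.2 - 1) = 3 by ring]
      rfl
    rw [h, pow_succ, mul_comm]

theorem near_of_mem_starWalks {l : ℕ} {z : ℤ × ℤ} {W : Finset (ℤ × ℤ)} (hW : W ∈ starWalks l z) :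
    W.card ≤ l + 1 ∧ ∀ w ∈ W, Near l z w := by
  induction l generalizing z W with
  | zero =>
    rw [starWalks, Finset.mem_singleton] at hW
    subst hW
    simp [Near]
  | succ l ih =>
    simp only [starWalks, Finset.mem_biUnion, Finset.mem_image, Finset.mem_product,
      Finset.mem_Icc] at hW
    obtain ⟨z', hz', W', hW', rfl⟩ := hW
    obtain ⟨h1, h2⟩ := ih hW'
    refine ⟨(Finset.card_insert_le _ _).trans (by omega), fun w hw => ?_⟩
    rcases Finset.mem_insert.1 hw with rfl | hw
    · unfold Near; omega
    · have := h2 w hw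
      unfold Near at this ⊢
      push_cast
      omega

theorem exists_starWalks_of_isPath {z y : ℤ × ℤ} (p : starGraph.Walk z y) (hp : p.IsPath) {l : ℕ}
    (hl : l ≤ p.length) : ∃ W ∈ starWalks l z, W.card = l + 1 ∧ ∀ w ∈ W, w ∈ p.support := by
  induction p generalizing l with
  | nil =>
    obtain rfl : l = 0 := by simpa using hl
    exact ⟨_, Finset.mem_singleton_self _, by simp⟩
  | @cons z z' y h p ih =>
    rw [SimpleGraph.Walk.cons_isPath_iff] at hp
    cases l with
    | zero => exact ⟨_, Finset.mem_singleton_self _, by simp⟩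
    | succ l =>
      obtain ⟨W, hW, hcard, hsub⟩ := ih hp.1 (l := l) (by simpa using hl)
      refine ⟨insert z W, ?_, ?_, ?_⟩
      · simp only [starWalks, Finset.mem_biUnion, Finset.mem_image, Finset.mem_product,
          Finset.mem_Icc]
        refine ⟨z', ?_, W, hW, rfl⟩
        have := h.2
        unfold Near at this
        omega
      · rw [Finset.card_insert_of_notMem fun h => hp.2 (hsub _ h), hcard]
      · intro w hw
        rcases Finset.mem_insert.1 hw with rfl | hw
        · simp
        · simp [hsub w hw]

theorem near_length {z y : ℤ × ℤ} (p : starGraph.Walk z y) : Near p.length z y := by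
  induction p with
  | nil => simp [Near]
  | cons h p ih =>
    have := h.2
    unfold Near at *
    rw [SimpleGraph.Walk.length_cons]
    push_cast
    omega

/-- Any walk in `S` between points at distance at least `l` has at least `l` steps. Removing its
loops and keeping the first `l` steps leaves `l + 1` distinct points. -/
theorem ConnectedOn.exists_starWalks {S : Set (ℤ × ℤ)} (hS : ConnectedOn (Near 1) S)
    {z y : ℤ × ℤ} (hz : z ∈ S) (hy : y ∈ S) {l : ℕ} (hl : ¬ Near (l - 1) z y) :
    ∃ W ∈ starWalks l z, W.card = l + 1 ∧ ∀ w ∈ W, w ∈ S := by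
  classical
  obtain ⟨p, hp⟩ : ∃ p : starGraph.Walk z y, ∀ w ∈ p.support, w ∈ S := by
    refine hS (fun y => ∃ p : starGraph.Walk z y, ∀ w ∈ p.support, w ∈ S) ?_ z hz y hy
      ⟨SimpleGraph.Walk.nil, by simpa using hz⟩
    rintro a ha b hb hab ⟨p, hp⟩
    by_cases h : a = b
    · exact h ▸ ⟨p, hp⟩
    · refine ⟨p.concat (show starGraph.Adj a b from ⟨h, hab⟩), fun w hw => ?_⟩
      rw [SimpleGraph.Walk.support_concat, List.mem_append, List.mem_singleton] at hw
      rcases hw with hw | rfl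
      · exact hp w hw
      · exact hb
  have hlen : l ≤ p.bypass.length := by
    by_contra h
    have := near_length p.bypass
    unfold Near at hl this
    omega
  obtain ⟨W, hW, hcard, hsub⟩ := exists_starWalks_of_isPath p.bypass p.bypass_isPath hlen
  exact ⟨W, hW, hcard, fun w hw => hp w (p.support_bypass_subset_support (hsub w hw))⟩

/-! ### Trees of cells at successive scales -/

/-- The corner of the cell of the lattice `r ℤ²` that contains `w`, in units of `r`. -/
def coarse (r : ℤ) (w : ℤ × ℤ) : ℤ × ℤ := (w.1 / r, w.2 / r)

instance (r : ℤ) (z w : ℤ × ℤ) : Decidable (Near r z w) := by unfold Near; infer_instance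

theorem Near.coarse {r d : ℤ} (hr : 1 ≤ r) (hd : 0 ≤ d) {z w : ℤ × ℤ} (h : Near d z w) :
    Near d (coarse r z) (coarse r w) := by
  have key : ∀ x y : ℤ, x ≤ y + d → x / r ≤ y / r + d := by
    intro x y hxy
    rw [← Int.add_mul_ediv_right y d (by omega)]
    exact Int.ediv_le_ediv (by omega) (by nlinarith)
  exact ⟨key _ _ h.1, key _ _ h.2.1, key _ _ h.2.2.1, key _ _ h.2.2.2⟩

theorem near_of_near_coarse {r d : ℤ} (hr : 1 ≤ r) {z w : ℤ × ℤ}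
    (h : Near d (coarse r z) (coarse r w)) : Near (r * (d + 1) - 1) z w := by
  have key : ∀ x y : ℤ, x / r ≤ y / r + d → x ≤ y + (r * (d + 1) - 1) := by
    intro x y hxy
    have h1 := Int.lt_ediv_add_one_mul_self x (show 0 < r by omega)
    have h2 := Int.ediv_mul_le y (show r ≠ 0 by omega)
    nlinarith
  exact ⟨key _ _ h.1, key _ _ h.2.1, key _ _ h.2.2.1, key _ _ h.2.2.2⟩

theorem ConnectedOn.coarse_image {r : ℤ} (hr : 1 ≤ r) {S : Set (ℤ × ℤ)}
    (hS : ConnectedOn (Near 1) S) : ConnectedOn (Near 1) (coarse r '' S) := by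
  rintro g hg _ ⟨z, hz, rfl⟩ _ ⟨w, hw, rfl⟩
  exact hS (fun z => g (coarse r z)) (fun a ha b hb hab =>
    hg _ ⟨a, ha, rfl⟩ _ ⟨b, hb, rfl⟩ (hab.coarse hr zero_le_one)) z hz w hw

/-- The admissible families of `M` descendants, one scale below, of the cell `c`; the ratio of the
two scales is `64 M`. The descendants are well separated and lie on a common short walk. -/
def children (M : ℕ) (c : ℤ × ℤ) : Finset (Finset (ℤ × ℤ)) :=
  (Finset.Ico 0 (64 * M : ℤ) ×ˢ Finset.Ico 0 (64 * M : ℤ)).biUnion fun o =>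
    (starWalks (36 * M) (64 * M * c.1 + o.1, 64 * M * c.2 + o.2)).biUnion fun W =>
      {C ∈ W.powerset | C.card = M ∧ ∀ a ∈ C, ∀ b ∈ C, a ≠ b → ¬ Near 5 a b}

theorem mem_children {M : ℕ} {c : ℤ × ℤ} {C : Finset (ℤ × ℤ)} :
    C ∈ children M c ↔ ∃ x : ℤ × ℤ, coarse (64 * M) x = c ∧ 0 < M ∧
      ∃ W ∈ starWalks (36 * M) x, C ⊆ W ∧ C.card = M ∧
        ∀ a ∈ C, ∀ b ∈ C, a ≠ b → ¬ Near 5 a b := by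
  simp only [children, Finset.mem_biUnion, Finset.mem_product, Finset.mem_Ico, Finset.mem_filter,
    Finset.mem_powerset]
  constructor
  · rintro ⟨o, ho, W, hW, hC⟩
    have hM : 0 < (64 * M : ℤ) := by omega
    refine ⟨_, ?_, by omega, W, hW, hC⟩
    simp only [coarse]
    rw [Int.mul_add_ediv_left _ _ hM.ne', Int.mul_add_ediv_left _ _ hM.ne',
      Int.ediv_eq_zero_of_lt ho.1.1 ho.1.2, Int.ediv_eq_zero_of_lt ho.2.1 ho.2.2]
    simp
  · rintro ⟨x, rfl, hM, W, hW, hC⟩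
    have hM' : 0 < (64 * M : ℤ) := by omega
    refine ⟨(x.1 % (64 * M), x.2 % (64 * M)),
      ⟨⟨Int.emod_nonneg _ hM'.ne', Int.emod_lt_of_pos _ hM'⟩,
        Int.emod_nonneg _ hM'.ne', Int.emod_lt_of_pos _ hM'⟩, W, ?_, hC⟩
    simpa only [coarse, Int.mul_ediv_add_emod] using hW

/-- There are `(64 M) ^ 2` starting points, `9 ^ (36 M)` walks and `2 ^ (36 M + 1)` subsets of a
walk. The polynomial prefactor is absorbed in a further `2 ^ (36 M)`, and `2 * 9 * 2 = 36`. -/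
theorem card_children_le {M : ℕ} (hM : 1 ≤ M) (c : ℤ × ℤ) :
    (children M c).card ≤ 36 ^ (36 * M) := by
  have h : (children M c).card ≤ (64 * M) * (64 * M) * (9 ^ (36 * M) * 2 ^ (36 * M + 1)) := by
    refine (Finset.card_biUnion_le_card_mul _ _ (9 ^ (36 * M) * 2 ^ (36 * M + 1))
      fun o _ => ?_).trans ?_
    · refine (Finset.card_biUnion_le_card_mul _ _ (2 ^ (36 * M + 1)) fun W hW => ?_).trans
        (Nat.mul_le_mul_right _ (card_starWalks_le _ _))
      refine (Finset.card_filter_le _ _).trans ?_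
      rw [Finset.card_powerset]
      exact Nat.pow_le_pow_right (by norm_num) (near_of_mem_starWalks hW).1
    · rw [Finset.card_product, Int.card_Ico]
      have : (64 * (M : ℤ) - 0).toNat = 64 * M := by omega
      rw [this]
  refine h.trans ?_
  have h1 : M ≤ 2 ^ M := Nat.lt_two_pow_self.le
  have h2 : 2 ^ 13 * (2 ^ M * 2 ^ M) ≤ 2 ^ (36 * M) := by
    rw [← pow_add, ← pow_add]
    exact Nat.pow_le_pow_right (by norm_num) (by omega)
  calc 64 * M * (64 * M) * (9 ^ (36 * M) * 2 ^ (36 * M + 1))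
      = 2 ^ 13 * (M * M) * (9 ^ (36 * M) * 2 ^ (36 * M)) := by ring
    _ ≤ 2 ^ 13 * (2 ^ M * 2 ^ M) * (9 ^ (36 * M) * 2 ^ (36 * M)) := by gcongr
    _ ≤ 2 ^ (36 * M) * (9 ^ (36 * M) * 2 ^ (36 * M)) := by gcongr
    _ = 36 ^ (36 * M) := by rw [← mul_pow, ← mul_pow]; norm_num

/-- The sets of leaves of the trees of depth `d` that are rooted at the cell `c` and in which the
children of each vertex are an admissible family. -/
def trees (M : ℕ) : ℕ → ℤ × ℤ → Finset (Finset (ℤ × ℤ))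
  | 0, c => {{c}}
  | d + 1, c => (children M c).biUnion fun C =>
      (C.pi fun c' => trees M d c').image fun f => C.attach.biUnion fun c' => f c'.1 c'.2

theorem mem_trees_succ {M d : ℕ} {c : ℤ × ℤ} {T : Finset (ℤ × ℤ)} :
    T ∈ trees M (d + 1) c ↔ ∃ C ∈ children M c, ∃ f : ℤ × ℤ → Finset (ℤ × ℤ),
      (∀ c' ∈ C, f c' ∈ trees M d c') ∧ T = C.biUnion f := by
  simp only [trees, Finset.mem_biUnion, Finset.mem_image, Finset.mem_pi]
  constructor
  · rintro ⟨C, hC, f, hf, rfl⟩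
    refine ⟨C, hC, fun c' => if h : c' ∈ C then f c' h else ∅, fun c' h => ?_, ?_⟩
    · simpa [h] using hf c' h
    · ext w
      simp only [Finset.mem_biUnion, Finset.mem_attach, true_and, Subtype.exists]
      constructor
      · rintro ⟨a, ha, h⟩
        exact ⟨a, ha, by simpa [ha] using h⟩
      · rintro ⟨a, ha, h⟩
        exact ⟨a, ha, by simpa [ha] using h⟩
  · rintro ⟨C, hC, f, hf, rfl⟩
    refine ⟨C, hC, fun c' _ => f c', hf, ?_⟩
    ext w
    simp

/-- The factor `36 ^ 72` makes the induction close: the new generation costs `36 M` in the exponent,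
and `36 M + 72 ≤ 72 M` because `M ≥ 2`. -/
theorem card_trees_mul_le {M : ℕ} (hM : 2 ≤ M) (d : ℕ) (c : ℤ × ℤ) :
    (trees M d c).card * 36 ^ 72 ≤ 36 ^ (72 * M ^ d) := by
  induction d generalizing c with
  | zero => simp [trees]
  | succ d ih =>
    have hB : ∀ c', (trees M d c').card ≤ 36 ^ (72 * M ^ d) / 36 ^ 72 := fun c' =>
      (Nat.le_div_iff_mul_le (by positivity)).2 (ih c')
    set B := 36 ^ (72 * M ^ d) / 36 ^ 72 with hBdef
    have hB' : B * 36 ^ 72 ≤ 36 ^ (72 * M ^ d) := Nat.div_mul_le_self _ _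
    have h1 : (trees M (d + 1) c).card ≤ 36 ^ (36 * M) * B ^ M := by
      refine (Finset.card_biUnion_le_card_mul _ _ (B ^ M) fun C hC => ?_).trans
        (Nat.mul_le_mul_right _ (card_children_le (by omega) c))
      refine Finset.card_image_le.trans ?_
      obtain ⟨x, _, _, W, _, _, hcard, _⟩ := mem_children.1 hC
      rw [Finset.card_pi]
      exact (Finset.prod_le_pow_card _ _ _ fun c' _ => hB c').trans_eq (by rw [hcard])
    calc (trees M (d + 1) c).card * 36 ^ 72 ≤ 36 ^ (36 * M) * B ^ M * 36 ^ 72 :=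
          Nat.mul_le_mul_right _ h1
      _ = B ^ M * 36 ^ (36 * M + 72) := by ring
      _ ≤ B ^ M * 36 ^ (72 * M) := by
          gcongr
          · norm_num
          · omega
      _ = (B * 36 ^ 72) ^ M := by rw [mul_pow, ← pow_mul]
      _ ≤ (36 ^ (72 * M ^ d)) ^ M := Nat.pow_le_pow_left hB' M
      _ = 36 ^ (72 * M ^ (d + 1)) := by rw [← pow_mul]; ring_nf

theorem card_trees_le {M : ℕ} (hM : 2 ≤ M) (d : ℕ) (c : ℤ × ℤ) :
    (trees M d c).card ≤ 36 ^ (72 * M ^ d) :=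
  (Nat.le_mul_of_pos_right _ (by positivity)).trans (card_trees_mul_le hM d c)

theorem coarse_mul {r s : ℤ} (hr : 0 ≤ r) (w : ℤ × ℤ) :
    coarse (r * s) w = coarse s (coarse r w) := by
  simp only [coarse, Int.ediv_ediv_of_nonneg hr]

/-- Errors do not accumulate over the generations: a descendant drifts by `36 M` steps of the walk
and one inherited cell, which together is less than one cell, `64 M`, of the next scale. -/
theorem near_of_mem_trees {M d : ℕ} {c : ℤ × ℤ} {T : Finset (ℤ × ℤ)} (hT : T ∈ trees M d c) :
    ∀ w ∈ T, Near 1 (coarse ((64 * M) ^ d) w) c := by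
  induction d generalizing c T with
  | zero =>
    rw [trees, Finset.mem_singleton] at hT
    subst hT
    simp [Near, coarse]
  | succ d ih =>
    obtain ⟨C, hC, f, hf, rfl⟩ := mem_trees_succ.1 hT
    intro w hw
    obtain ⟨c', hc', hw⟩ := Finset.mem_biUnion.1 hw
    obtain ⟨x, rfl, hM, W, hW, hCW, -⟩ := mem_children.1 hC
    have h1 := ih (hf c' hc') w hw
    have h2 := (near_of_mem_starWalks hW).2 c' (hCW hc')
    rw [pow_succ, coarse_mul (by positivity)]
    set y := coarse ((64 * M) ^ d) w
    have h3 : Near (36 * M + 1) y x := by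
      unfold Near at *
      push_cast at h2
      omega
    have key : ∀ a b : ℤ, a ≤ b + (36 * M + 1) → a / (64 * M) ≤ b / (64 * M) + 1 := by
      intro a b hab
      rw [← Int.add_mul_ediv_right b 1 (by omega)]
      exact Int.ediv_le_ediv (by omega) (by omega)
    exact ⟨key _ _ h3.1, key _ _ h3.2.1, key _ _ h3.2.2.1, key _ _ h3.2.2.2⟩

theorem one_le_scale {M : ℕ} (hM : 1 ≤ M) (d : ℕ) : (1 : ℤ) ≤ (64 * M) ^ d :=
  one_le_pow₀ (by omega)

/-- Each leaf is within one cell of its ancestor, so leaves within `3` of each other would have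
ancestors within `1 + 3 + 1 = 5`, the distance excluded in `children`. -/
theorem not_near_of_mem_trees {M d : ℕ} (hM : 1 ≤ M) {c : ℤ × ℤ} {C : Finset (ℤ × ℤ)}
    (hC : C ∈ children M c) {f : ℤ × ℤ → Finset (ℤ × ℤ)} (hf : ∀ c' ∈ C, f c' ∈ trees M d c')
    {a b : ℤ × ℤ} (ha : a ∈ C) (hb : b ∈ C) (hab : a ≠ b) {z w : ℤ × ℤ} (hz : z ∈ f a)
    (hw : w ∈ f b) : ¬ Near 3 z w := by
  intro h
  have h1 := h.coarse (one_le_scale hM d) (by norm_num)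
  have h2 := near_of_mem_trees (hf a ha) z hz
  have h3 := near_of_mem_trees (hf b hb) w hw
  obtain ⟨x, _, _, W, _, _, _, hsep⟩ := mem_children.1 hC
  apply hsep a ha b hb hab
  unfold Near at *
  omega

theorem pairwiseDisjoint_trees {M d : ℕ} (hM : 1 ≤ M) {c : ℤ × ℤ} {C : Finset (ℤ × ℤ)}
    (hC : C ∈ children M c) {f : ℤ × ℤ → Finset (ℤ × ℤ)} (hf : ∀ c' ∈ C, f c' ∈ trees M d c') :
    (C : Set (ℤ × ℤ)).PairwiseDisjoint f := by
  intro a ha b hb hab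
  rw [Function.onFun, Finset.disjoint_left]
  intro z hz hz'
  exact not_near_of_mem_trees hM hC hf ha hb hab hz hz' (by simp [Near])

theorem not_near_of_ne_of_mem_trees {M d : ℕ} (hM : 1 ≤ M) {c : ℤ × ℤ} {T : Finset (ℤ × ℤ)}
    (hT : T ∈ trees M d c) : ∀ z ∈ T, ∀ w ∈ T, z ≠ w → ¬ Near 3 z w := by
  induction d generalizing c T with
  | zero =>
    rw [trees, Finset.mem_singleton] at hT
    subst hT
    simp
  | succ d ih =>
    obtain ⟨C, hC, f, hf, rfl⟩ := mem_trees_succ.1 hT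
    intro z hz w hw hzw
    obtain ⟨a, ha, hz⟩ := Finset.mem_biUnion.1 hz
    obtain ⟨b, hb, hw⟩ := Finset.mem_biUnion.1 hw
    by_cases hab : a = b
    · subst hab
      exact ih (hf a ha) z hz w hw hzw
    · exact not_near_of_mem_trees hM hC hf ha hb hab hz hw

theorem card_of_mem_trees {M d : ℕ} (hM : 1 ≤ M) {c : ℤ × ℤ} {T : Finset (ℤ × ℤ)}
    (hT : T ∈ trees M d c) : T.card = M ^ d := by
  induction d generalizing c T with
  | zero =>
    rw [trees, Finset.mem_singleton] at hT
    subst hT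
    simp
  | succ d ih =>
    obtain ⟨C, hC, f, hf, rfl⟩ := mem_trees_succ.1 hT
    obtain ⟨x, _, _, W, _, _, hcard, _⟩ := mem_children.1 hC
    rw [Finset.card_biUnion fun a ha b hb hab => pairwiseDisjoint_trees hM hC hf ha hb hab,
      Finset.sum_congr rfl fun c' hc' => ih (hf c' hc'), Finset.sum_const, hcard, smul_eq_mul,
      pow_succ, mul_comm]

/-- The vertices at height `j` of a tree are the leaves of a shorter tree. -/
theorem exists_truncated_tree {M j a : ℕ} (hM : 1 ≤ M) {c : ℤ × ℤ} {T : Finset (ℤ × ℤ)}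
    (hT : T ∈ trees M (j + a) c) : ∃ T' ∈ trees M a c, ∀ g G : ℤ × ℤ → ℝ,
      (∀ w c', Near 1 (coarse ((64 * M) ^ j) w) c' → g w ≤ G c') →
      ∑ w ∈ T, g w ≤ M ^ j * ∑ c' ∈ T', G c' := by
  induction a generalizing c T with
  | zero =>
    refine ⟨{c}, by simp [trees], fun g G h => ?_⟩
    rw [Finset.sum_singleton]
    refine (Finset.sum_le_card_nsmul T g (G c)
      fun w hw => h w c (near_of_mem_trees hT w hw)).trans ?_
    rw [card_of_mem_trees hM hT, nsmul_eq_mul]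
    push_cast
    rfl
  | succ a ih =>
    obtain ⟨C, hC, f, hf, rfl⟩ := mem_trees_succ.1 hT
    choose! f' hf' hsum using fun c' (hc' : c' ∈ C) => ih (hf c' hc')
    refine ⟨C.biUnion f', mem_trees_succ.2 ⟨C, hC, f', hf', rfl⟩, fun g G h => ?_⟩
    rw [Finset.sum_biUnion (pairwiseDisjoint_trees hM hC hf),
      Finset.sum_biUnion (pairwiseDisjoint_trees hM hC hf'), Finset.mul_sum]
    exact Finset.sum_le_sum fun c' hc' => hsum c' hc' g G h

/-- One of the `36` residue classes modulo `6` contains at least `M` of the points, and distinct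
points of one class differ by at least `6` in some coordinate. -/
theorem exists_separated_subset {M : ℕ} {W : Finset (ℤ × ℤ)} (hW : 36 * M ≤ W.card) :
    ∃ C ⊆ W, C.card = M ∧ ∀ a ∈ C, ∀ b ∈ C, a ≠ b → ¬ Near 5 a b := by
  obtain ⟨y, _, hy⟩ := Finset.exists_le_card_fiber_of_mul_le_card_of_maps_to
    (s := W) (t := Finset.Ico (0 : ℤ) 6 ×ˢ Finset.Ico (0 : ℤ) 6)
    (f := fun z : ℤ × ℤ => (z.1 % 6, z.2 % 6)) (n := M)
    (fun a _ => by
      simp only [Finset.mem_product, Finset.mem_Ico]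
      omega)
    ⟨(0, 0), by simp⟩ (by simpa using hW)
  obtain ⟨C, hC, hcard⟩ := Finset.exists_subset_card_eq hy
  refine ⟨C, hC.trans (Finset.filter_subset _ _), hcard, fun a ha b hb hab h => hab ?_⟩
  have h1 := (Finset.mem_filter.1 (hC ha)).2
  have h2 := (Finset.mem_filter.1 (hC hb)).2
  rw [← h2, Prod.mk.injEq] at h1
  unfold Near at h
  ext <;> omega

/-- A connected set of large diameter contains the leaves of a tree. -/
theorem ConnectedOn.exists_tree {M : ℕ} (hM : 1 ≤ M) {S : Set (ℤ × ℤ)}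
    (hS : ConnectedOn (Near 1) S) {d : ℕ} {x y : ℤ × ℤ} (hx : x ∈ S) (hy : y ∈ S)
    (hxy : ¬ Near ((64 * M) ^ d - 1) x y) :
    ∃ T ∈ trees M d (coarse ((64 * M) ^ d) x), ∀ w ∈ T, w ∈ S := by
  induction d generalizing x y with
  | zero => exact ⟨{x}, by simp [trees, coarse], by simpa using hx⟩
  | succ d ih =>
    set r : ℤ := (64 * M) ^ d with hr
    have hr1 : 1 ≤ r := one_le_scale hM d
    have hM' : (1 : ℤ) ≤ M := by exact_mod_cast hM
    obtain ⟨W, hW, hcard, hWS⟩ := (hS.coarse_image hr1).exists_starWalks (l := 36 * M)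
      ⟨x, hx, rfl⟩ ⟨y, hy, rfl⟩ (by
        intro h
        apply hxy
        have := near_of_near_coarse hr1 h
        have h3 : r * (((36 * M : ℕ) : ℤ) - 1 + 1) - 1 ≤ (64 * M) ^ (d + 1) - 1 := by
          rw [pow_succ, ← hr]
          push_cast
          nlinarith
        unfold Near at *
        omega)
    obtain ⟨C, hCW, hC, hsep⟩ := exists_separated_subset (M := M) (W := W) (by omega)
    have hex : ∀ c' ∈ C, ∃ T ∈ trees M d c', ∀ w ∈ T, w ∈ S := by
      intro c' hc'
      obtain ⟨z, hz, rfl⟩ := hWS c' (hCW hc')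
      -- Since `x` and `y` are far apart on the larger scale, `z` is at distance at least `r` from
      -- one of them. This supplies the two distant points that the induction hypothesis needs in
      -- the cell of `z`.
      by_cases hzx : Near (r - 1) z x
      · by_cases hzy : Near (r - 1) z y
        · exfalso
          apply hxy
          have h3 : 2 * r - 2 ≤ (64 * M) ^ (d + 1) - 1 := by
            rw [pow_succ, ← hr]
            nlinarith
          unfold Near at *
          omega
        · exact ih hz hy hzy
      · exact ih hz hx hzx
    choose! f hf hfS using hex
    refine ⟨C.biUnion f, mem_trees_succ.2 ⟨C, mem_children.2
      ⟨coarse r x, ?_, hM, W, hW, hCW, hC, hsep⟩, f, hf, rfl⟩, fun w hw => ?_⟩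
    · rw [pow_succ, ← coarse_mul (by omega)]
    · obtain ⟨c', hc', hw⟩ := Finset.mem_biUnion.1 hw
      exact hfS c' hc' w hw

/-! ### Independence of disjoint blocks of variables -/

section Independence

variable {Ω ι κ : Type*} [MeasurableSpace Ω] {μ : Measure Ω}

/-- A function that depends only on the coordinates in `A` factors through the restriction to `A`
followed by extension by zero, so independence of finite blocks applies. -/
theorem lintegral_mul_of_dependsOn {X : ι → Ω → ℝ} (hX : iIndepFun X μ)
    (hm : ∀ i, Measurable (X i)) {A B : Finset ι} (hAB : Disjoint A B)
    {f g : (ι → ℝ) → ENNReal} (hf : Measurable f) (hg : Measurable g)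
    (hfA : DependsOn f A) (hgB : DependsOn g B) :
    ∫⁻ ω, f (fun i => X i ω) * g (fun i => X i ω) ∂μ =
      (∫⁻ ω, f (fun i => X i ω) ∂μ) * ∫⁻ ω, g (fun i => X i ω) ∂μ := by
  classical
  let ext (A : Finset ι) (x : A → ℝ) : ι → ℝ := fun i => if h : i ∈ A then x ⟨i, h⟩ else 0
  have hext : ∀ A, Measurable (ext A) := fun A => measurable_pi_iff.2 fun i => by
    by_cases h : i ∈ A
    · simpa only [ext, h, dif_pos] using measurable_pi_apply _
    · simp only [ext, h, dif_neg, not_false_iff, measurable_const]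
  have key : ∀ (A : Finset ι) (f : (ι → ℝ) → ENNReal), DependsOn f A → ∀ ω,
      f (fun i => X i ω) = (f ∘ ext A) (fun i : A => X i ω) := by
    intro A f hfA ω
    refine hfA fun i hi => ?_
    have hi' : i ∈ A := hi
    simp [ext, hi']
  simp_rw [key A f hfA, key B g hgB]
  have h1 := (hX.indepFun_finset A B hAB hm).comp (hf.comp (hext A)) (hg.comp (hext B))
  refine lintegral_mul_eq_lintegral_mul_lintegral_of_indepFun ?_ ?_ h1
  · exact (hf.comp (hext A)).comp (measurable_pi_iff.2 fun i => hm _)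
  · exact (hg.comp (hext B)).comp (measurable_pi_iff.2 fun i => hm _)

/-- Functions of disjoint blocks of independent variables: the expectation of the product is the
product of the expectations. -/
theorem lintegral_prod_of_dependsOn [IsProbabilityMeasure μ] {X : ι → Ω → ℝ} (hX : iIndepFun X μ)
    (hm : ∀ i, Measurable (X i)) (T : Finset κ) {S : κ → Finset ι}
    (hS : (T : Set κ).PairwiseDisjoint S) {F : κ → (ι → ℝ) → ENNReal}
    (hF : ∀ c, Measurable (F c)) (hdep : ∀ c, DependsOn (F c) (S c)) :
    ∫⁻ ω, ∏ c ∈ T, F c (fun i => X i ω) ∂μ = ∏ c ∈ T, ∫⁻ ω, F c (fun i => X i ω) ∂μ := by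
  classical
  induction T using Finset.induction_on with
  | empty => simp
  | insert c T hc ih =>
    simp_rw [Finset.prod_insert hc]
    rw [← ih (hS.subset (by simp))]
    refine lintegral_mul_of_dependsOn hX hm (A := S c) (B := T.biUnion S)
      (f := F c) (g := fun x => ∏ c ∈ T, F c x) ?_ (hF c)
      (Finset.measurable_fun_prod _ fun c _ => hF c) (hdep c) ?_
    · rw [Finset.disjoint_biUnion_right]
      intro c' hc'
      exact hS (by simp) (by simp [hc']) (fun h => hc (h ▸ hc'))
    · intro x y hxy
      refine Finset.prod_congr rfl fun c' hc' => hdep c' fun i hi => hxy i ?_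
      exact Finset.mem_coe.2 (Finset.mem_biUnion.2 ⟨c', hc', hi⟩)

end Independence

/-! ### Exponential moments of the Gaussian field and of its increments -/

/-- The contribution of the levels `J ≤ j < J'` to the field, as a function of the box
variables. -/
def partialField (k J J' : ℕ) (β : ℕ × (ℤ × ℤ) → ℝ) (z : ℤ × ℤ) : ℝ :=
  ∑ j ∈ Finset.Ico J J', ∑ a ∈ boxesAt (j * k) z, √(k : ℝ) * β (j * k, a)

theorem card_boxesAt (j : ℕ) (z : ℤ × ℤ) : (boxesAt j z).card = 2 ^ (2 * j) := by
  have h : ∀ x : ℤ, (Finset.Ioc (x - 2 ^ j) x).card = 2 ^ j := fun x => by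
    rw [Int.card_Ioc, sub_sub_cancel]
    exact_mod_cast Int.toNat_natCast (2 ^ j)
  rw [boxesAt, Finset.card_product, h, h, ← pow_add, two_mul]

/-- Moving the point by at most `r` changes each coordinate interval in at most `r` positions, so
the boxes that are lost lie in two strips of at most `r * 2 ^ j` positions each. -/
theorem card_boxesAt_sdiff_le {r : ℕ} (j : ℕ) {z w : ℤ × ℤ} (h : Near r z w) :
    (boxesAt j z \ boxesAt j w).card ≤ 2 * (r * 2 ^ j) := by
  have h1 : ∀ x y : ℤ, x ≤ y + r → y ≤ x + r →
      (Finset.Ioc (x - 2 ^ j) x \ Finset.Ioc (y - 2 ^ j) y).card ≤ r := by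
    intro x y hxy hyx
    rcases le_total x y with hle | hle
    · have : Finset.Ioc (x - 2 ^ j) x \ Finset.Ioc (y - 2 ^ j) y ⊆
          Finset.Ioc (x - 2 ^ j) (x - 2 ^ j + r) := by
        intro a
        simp only [Finset.mem_sdiff, Finset.mem_Ioc]
        omega
      refine (Finset.card_le_card this).trans ?_
      rw [Int.card_Ioc]
      omega
    · have : Finset.Ioc (x - 2 ^ j) x \ Finset.Ioc (y - 2 ^ j) y ⊆ Finset.Ioc (x - r) x := by
        intro a
        simp only [Finset.mem_sdiff, Finset.mem_Ioc]
        omega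
      refine (Finset.card_le_card this).trans ?_
      rw [Int.card_Ioc]
      omega
  have h2 : ∀ x : ℤ, (Finset.Ioc (x - 2 ^ j) x).card = 2 ^ j := fun x => by
    rw [Int.card_Ioc, sub_sub_cancel]
    exact_mod_cast Int.toNat_natCast (2 ^ j)
  have hsub : boxesAt j z \ boxesAt j w ⊆
      ((Finset.Ioc (z.1 - 2 ^ j) z.1 \ Finset.Ioc (w.1 - 2 ^ j) w.1) ×ˢ
        Finset.Ioc (z.2 - 2 ^ j) z.2) ∪
      (Finset.Ioc (z.1 - 2 ^ j) z.1 ×ˢ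
        (Finset.Ioc (z.2 - 2 ^ j) z.2 \ Finset.Ioc (w.2 - 2 ^ j) w.2)) := by
    intro a
    simp only [boxesAt, Finset.mem_sdiff, Finset.mem_product, Finset.mem_union]
    tauto
  refine (Finset.card_le_card hsub).trans ((Finset.card_union_le _ _).trans ?_)
  rw [Finset.card_product, Finset.card_product, h2, h2]
  have h3 := Nat.mul_le_mul_right (2 ^ j) (h1 _ _ h.1 h.2.1)
  have h4 := Nat.mul_le_mul_left (2 ^ j) (h1 _ _ h.2.2.1 h.2.2.2)
  linarith

section Gaussian

variable {Ω : Type*} [MeasurableSpace Ω] {μ : Measure Ω}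
  {b : ℕ → ℤ × ℤ → Ω → ℝ} {k : ℕ}

theorem lintegral_exp_sum (hb : IsBoxFamily μ b) (hk : 1 ≤ k) (J J' : ℕ) (A : Finset (ℤ × ℤ))
    (c : ℕ → ℤ × ℤ → ℝ) :
    ∫⁻ ω, ENNReal.ofReal (Real.exp (∑ j ∈ Finset.Ico J J', ∑ a ∈ A, c j a * b (j * k) a ω)) ∂μ =
      ENNReal.ofReal (Real.exp (∑ j ∈ Finset.Ico J J', ∑ a ∈ A,
        c j a ^ 2 * ((2 ^ (2 * (j * k)))⁻¹ / 2))) := by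
  have hinj : Function.Injective (fun i : ℕ × (ℤ × ℤ) => (i.1 * k, i.2)) := by
    rintro ⟨j, a⟩ ⟨j', a'⟩ h
    simp only [Prod.mk.injEq] at h
    exact Prod.ext (Nat.eq_of_mul_eq_mul_right (by omega) h.1) h.2
  have hind := (hb.indep.precomp hinj).comp
    (fun i x => ENNReal.ofReal (Real.exp (c i.1 i.2 * x))) (fun i => by fun_prop)
  have h := lintegral_prod_eq_prod_lintegral_of_indepFun (Finset.Ico J J' ×ˢ A) _ hind
    (fun i => by
      have := hb.measurable (i.1 * k) i.2
      simp only [Function.comp_def]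
      fun_prop)
  simp only [Function.comp_def] at h
  have hone : ∀ (j : ℕ) (a : ℤ × ℤ) (t : ℝ),
      ∫⁻ ω, ENNReal.ofReal (Real.exp (t * b j a ω)) ∂μ =
        ENNReal.ofReal (Real.exp (t ^ 2 * ((2 ^ (2 * j))⁻¹ / 2))) := by
    intro j a t
    have h1 : ∫⁻ ω, ENNReal.ofReal (Real.exp (t * b j a ω)) ∂μ =
        ∫⁻ x, ENNReal.ofReal (Real.exp (t * x)) ∂(gaussianReal 0 ((2 ^ (2 * j))⁻¹)) := by
      rw [← hb.law j a, lintegral_map (by fun_prop) (hb.measurable j a)]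
    rw [h1, ← ofReal_integral_eq_lintegral_ofReal (integrable_exp_mul_gaussianReal t)
      (Filter.Eventually.of_forall fun x => (Real.exp_pos _).le)]
    have h2 := congrFun (mgf_id_gaussianReal (μ := 0) (v := (2 ^ (2 * j))⁻¹)) t
    simp only [mgf, id] at h2
    rw [h2]
    congr 2
    push_cast
    ring
  simp_rw [hone] at h
  simp_rw [← Finset.sum_product', Real.exp_sum]
  rw [ENNReal.ofReal_prod_of_nonneg (fun i _ => (Real.exp_pos _).le), ← h]
  simp_rw [ENNReal.ofReal_prod_of_nonneg (fun i _ => (Real.exp_pos _).le)]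

/-- A common index set `A` for several points turns differences of field values into linear
combinations of the same independent variables. -/
theorem mul_partialField_eq (θ : ℝ) (J J' : ℕ) (A : Finset (ℤ × ℤ)) (z : ℤ × ℤ)
    (hA : ∀ j ∈ Finset.Ico J J', boxesAt (j * k) z ⊆ A) (β : ℕ × (ℤ × ℤ) → ℝ) :
    θ * partialField k J J' β z = ∑ j ∈ Finset.Ico J J', ∑ a ∈ A,
      θ * √(k : ℝ) * (if a ∈ boxesAt (j * k) z then 1 else 0) * β (j * k, a) := by
  rw [partialField, Finset.mul_sum]
  refine Finset.sum_congr rfl fun j hj => ?_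
  rw [Finset.mul_sum, ← Finset.sum_subset (hA j hj)]
  · exact Finset.sum_congr rfl fun a ha => by rw [if_pos ha]; ring
  · intro a _ ha
    rw [if_neg ha]
    ring

/-- Each level has variance exactly `k`: there are `2 ^ (2 j k)` boxes, each contributing `k * 2 ^
(-2 j k)`. -/
theorem lintegral_exp_partialField_le (hb : IsBoxFamily μ b) (hk : 1 ≤ k) (J J' : ℕ) (θ : ℝ)
    (z : ℤ × ℤ) :
    ∫⁻ ω, ENNReal.ofReal (Real.exp (θ * partialField k J J' (fun i => b i.1 i.2 ω) z)) ∂μ ≤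
      ENNReal.ofReal (Real.exp (θ ^ 2 * (((J' - J : ℕ) : ℝ) * k) / 2)) := by
  set A := (Finset.Ico J J').biUnion fun j => boxesAt (j * k) z with hA
  have hA' : ∀ j ∈ Finset.Ico J J', boxesAt (j * k) z ⊆ A := fun j hj =>
    Finset.subset_biUnion_of_mem (fun j => boxesAt (j * k) z) hj
  simp_rw [mul_partialField_eq θ J J' A z hA']
  rw [lintegral_exp_sum hb hk]
  refine ENNReal.ofReal_le_ofReal (Real.exp_le_exp.2 ?_)
  have hj : ∀ j ∈ Finset.Ico J J', ∑ a ∈ A,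
      (θ * √(k : ℝ) * (if a ∈ boxesAt (j * k) z then 1 else 0)) ^ 2 *
        ((2 ^ (2 * (j * k)))⁻¹ / 2) = θ ^ 2 * k / 2 := by
    intro j hj
    rw [← Finset.sum_subset (hA' j hj)]
    · rw [Finset.sum_congr rfl fun a ha => by rw [if_pos ha], Finset.sum_const, card_boxesAt,
        nsmul_eq_mul, mul_pow, mul_pow, Real.sq_sqrt (Nat.cast_nonneg k)]
      push_cast
      field_simp
    · intro a _ ha
      rw [if_neg ha]
      ring
  rw [Finset.sum_congr rfl hj, Finset.sum_const, Nat.card_Ico, nsmul_eq_mul]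
  exact le_of_eq (by ring)

/-- Only boxes containing exactly one of the two points survive, at most `4 r 2 ^ (j k)` on level
`j`. Level `j` thus has variance at most `4 k r / 2 ^ (j k)`, and the geometric sum over `j ≥ J`
costs a factor `2`. -/
theorem lintegral_exp_sub_partialField_le (hb : IsBoxFamily μ b) (hk : 1 ≤ k) (J J' : ℕ) (θ : ℝ)
    {r : ℕ} {z w : ℤ × ℤ} (hzw : Near r z w) :
    ∫⁻ ω, ENNReal.ofReal (Real.exp (θ * (partialField k J J' (fun i => b i.1 i.2 ω) z -
      partialField k J J' (fun i => b i.1 i.2 ω) w))) ∂μ ≤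
      ENNReal.ofReal (Real.exp (θ ^ 2 * (8 * k * (r / 2 ^ (J * k))) / 2)) := by
  set A := (Finset.Ico J J').biUnion fun j => boxesAt (j * k) z ∪ boxesAt (j * k) w with hA
  have hA' : ∀ j ∈ Finset.Ico J J', boxesAt (j * k) z ∪ boxesAt (j * k) w ⊆ A := fun j hj =>
    Finset.subset_biUnion_of_mem (fun j => boxesAt (j * k) z ∪ boxesAt (j * k) w) hj
  have hAz : ∀ j ∈ Finset.Ico J J', boxesAt (j * k) z ⊆ A := fun j hj =>
    Finset.subset_union_left.trans (hA' j hj)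
  have hAw : ∀ j ∈ Finset.Ico J J', boxesAt (j * k) w ⊆ A := fun j hj =>
    Finset.subset_union_right.trans (hA' j hj)
  simp_rw [mul_sub, mul_partialField_eq θ J J' A z hAz, mul_partialField_eq θ J J' A w hAw,
    ← Finset.sum_sub_distrib, ← sub_mul, ← mul_sub]
  rw [lintegral_exp_sum hb hk]
  refine ENNReal.ofReal_le_ofReal (Real.exp_le_exp.2 ?_)
  have hj : ∀ j ∈ Finset.Ico J J', ∑ a ∈ A,
      (θ * √(k : ℝ) * ((if a ∈ boxesAt (j * k) z then 1 else 0) -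
        (if a ∈ boxesAt (j * k) w then 1 else 0))) ^ 2 *
        ((2 ^ (2 * (j * k)))⁻¹ / 2) ≤ 2 * θ ^ 2 * k * r * ((2 ^ k)⁻¹) ^ j := by
    intro j hj
    have h1 : ∀ a ∈ A, (θ * √(k : ℝ) * ((if a ∈ boxesAt (j * k) z then 1 else 0) -
        (if a ∈ boxesAt (j * k) w then 1 else 0))) ^ 2 * ((2 ^ (2 * (j * k)))⁻¹ / 2) =
        θ ^ 2 * k * ((2 ^ (2 * (j * k)))⁻¹ / 2) *
          ((if a ∈ boxesAt (j * k) z \ boxesAt (j * k) w then 1 else 0) +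
          (if a ∈ boxesAt (j * k) w \ boxesAt (j * k) z then 1 else 0)) := by
      intro a _
      rw [mul_pow, mul_pow, Real.sq_sqrt (Nat.cast_nonneg k)]
      by_cases h1 : a ∈ boxesAt (j * k) z <;> by_cases h2 : a ∈ boxesAt (j * k) w <;>
        simp [h1, h2]
    have hcard : ∀ B : Finset (ℤ × ℤ), ∑ a ∈ A, (if a ∈ B then (1 : ℝ) else 0) ≤ B.card := by
      intro B
      rw [Finset.sum_boole]
      exact_mod_cast Finset.card_le_card fun a ha => (Finset.mem_filter.1 ha).2
    rw [Finset.sum_congr rfl h1, ← Finset.mul_sum, Finset.sum_add_distrib]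
    have h2 := (hcard _).trans (Nat.cast_le.2 (card_boxesAt_sdiff_le (j * k) hzw))
    have h3 := (hcard _).trans (Nat.cast_le.2 (card_boxesAt_sdiff_le (j * k) hzw.symm))
    push_cast at h2 h3
    calc _ ≤ θ ^ 2 * k * ((2 ^ (2 * (j * k)))⁻¹ / 2) * (4 * (r * 2 ^ (j * k))) := by
          gcongr
          linarith
      _ = 2 * θ ^ 2 * k * r * ((2 ^ k)⁻¹) ^ j := by
          rw [two_mul, pow_add, inv_pow, ← pow_mul, mul_comm k j]
          field_simp
          ring
  have hgeom : ∑ j ∈ Finset.Ico J J', (((2 : ℝ) ^ k)⁻¹) ^ j ≤ 2 / 2 ^ (J * k) := by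
    have hr : ((2 : ℝ) ^ k)⁻¹ ≤ 1 / 2 := by
      rw [one_div]
      refine inv_anti₀ (by norm_num) ?_
      calc (2 : ℝ) = 2 ^ 1 := by norm_num
        _ ≤ 2 ^ k := pow_le_pow_right₀ (by norm_num) hk
    have hr0 : 0 ≤ ((2 : ℝ) ^ k)⁻¹ := by positivity
    refine (geom_sum_Ico_le_of_lt_one hr0 (by linarith)).trans ?_
    rw [inv_pow, ← pow_mul, mul_comm k J, div_le_div_iff₀ (by linarith) (by positivity)]
    rw [inv_mul_cancel₀ (by positivity)]
    linarith
  calc _ ≤ ∑ j ∈ Finset.Ico J J', 2 * θ ^ 2 * k * r * (((2 : ℝ) ^ k)⁻¹) ^ j :=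
        Finset.sum_le_sum hj
    _ ≤ 2 * θ ^ 2 * k * r * (2 / 2 ^ (J * k)) := by
        rw [← Finset.mul_sum]
        gcongr
    _ = _ := by ring

end Gaussian

/-! ### Chaining: exponential moments of block maxima -/

/-- The point of the lattice `2 ^ i ℤ²` with index `p`. -/
def gridPoint (i : ℕ) (p : ℤ × ℤ) : ℤ × ℤ := (2 ^ i * p.1, 2 ^ i * p.2)

/-- The indices, `l` dyadic scales below, of the cells in the `3 × 3` block around `c`. -/
def cells (l : ℕ) (c : ℤ × ℤ) : Finset (ℤ × ℤ) :=
  Finset.Ico (2 ^ l * (c.1 - 1)) (2 ^ l * (c.1 + 2)) ×ˢ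
    Finset.Ico (2 ^ l * (c.2 - 1)) (2 ^ l * (c.2 + 2))

theorem card_cells (l : ℕ) (c : ℤ × ℤ) : (cells l c).card = 9 * 4 ^ l := by
  have h : ∀ x : ℤ, (Finset.Ico (2 ^ l * (x - 1)) (2 ^ l * (x + 2))).card = 3 * 2 ^ l := fun x => by
    rw [Int.card_Ico, show (2 : ℤ) ^ l * (x + 2) - 2 ^ l * (x - 1) = 3 * 2 ^ l by ring]
    exact_mod_cast Int.toNat_natCast (3 * 2 ^ l)
  rw [cells, Finset.card_product, h, h, show 4 = 2 * 2 by norm_num, mul_pow]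
  ring

theorem coarse_mem_cells {I i : ℕ} (hi : i ≤ I) {w c : ℤ × ℤ} (h : Near 1 (coarse (2 ^ I) w) c) :
    coarse (2 ^ i) w ∈ cells (I - i) c := by
  rw [← Nat.add_sub_cancel' hi, pow_add, coarse_mul (by positivity)] at h
  have hpos : (0 : ℤ) < 2 ^ (I - i) := by positivity
  obtain ⟨h1, h2, h3, h4⟩ := h
  simp only [cells, Finset.mem_product, Finset.mem_Ico]
  generalize coarse (2 ^ i) w = q at *
  simp only [coarse] at h1 h2 h3 h4
  have lo : ∀ x y : ℤ, y ≤ x / 2 ^ (I - i) + 1 → 2 ^ (I - i) * (y - 1) ≤ x := by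
    intro x y hxy
    rw [mul_comm]
    exact (Int.le_ediv_iff_mul_le hpos).1 (by omega)
  have hi : ∀ x y : ℤ, x / 2 ^ (I - i) ≤ y + 1 → x < 2 ^ (I - i) * (y + 2) := by
    intro x y hxy
    rw [mul_comm]
    exact (Int.ediv_lt_iff_lt_mul hpos).1 (by omega)
  exact ⟨⟨lo _ _ h2, hi _ _ h1⟩, lo _ _ h4, hi _ _ h3⟩

theorem near_gridPoint (i : ℕ) (p : ℤ × ℤ) :
    Near ((2 ^ i : ℕ) : ℤ) (gridPoint i p) (gridPoint (i + 1) (coarse 2 p)) := by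
  have hpos : (0 : ℤ) < 2 ^ i := by positivity
  have key : ∀ x : ℤ, 2 ^ i * x ≤ 2 ^ (i + 1) * (x / 2) + 2 ^ i ∧ 2 ^ (i + 1) * (x / 2) ≤ 2 ^ i * x := by
    intro x
    have h1 : x ≤ 2 * (x / 2) + 1 := by omega
    have h2 : 2 * (x / 2) ≤ x := by omega
    rw [pow_succ]
    constructor <;> nlinarith
  push_cast
  have := key p.1
  have := key p.2
  simp only [Near, gridPoint, coarse]
  omega

/-- The weights used to average over the scales of a chain. -/
def chainWeight (l : ℕ) : ℝ := (3 / 4) ^ l / 6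

theorem chainWeight_pos (l : ℕ) : 0 < chainWeight l := by unfold chainWeight; positivity

/-- The weight left for the coarsest point of a chain, so that all weights sum to one. -/
def baseWeight (I : ℕ) : ℝ := 1 - ∑ i ∈ Finset.range I, chainWeight (I - i)

/-- The logarithm of the number of cells plus a bound on the log-moment of one increment.
Subtracting it brings the expected sum over the cells down to at most one; `baseShift` plays the
same role for the coarsest scale. -/
def chainShift (k : ℕ) (θ : ℝ) (l : ℕ) : ℝ :=
  Real.log (9 * 4 ^ l) + (θ / chainWeight l) ^ 2 * (8 * k * (1 / 2 ^ l)) / 2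

def baseShift (k J J' : ℕ) (θ : ℝ) : ℝ :=
  Real.log 9 + (θ / baseWeight (J * k)) ^ 2 * (((J' - J : ℕ) : ℝ) * k) / 2

def totalShift (k J J' : ℕ) (θ : ℝ) : ℝ :=
  baseWeight (J * k) * baseShift k J J' θ +
    ∑ i ∈ Finset.range (J * k), chainWeight (J * k - i) * chainShift k θ (J * k - i)

/-- A bound for `exp (θ φ)` that is uniform over the `3 × 3` block of cells of side `2 ^ (J k)`
around the cell `c`, where `φ` is the contribution of the levels `J ≤ j < J'` to the field. -/
def blockBound (k J J' : ℕ) (θ : ℝ) (c : ℤ × ℤ) (β : ℕ × (ℤ × ℤ) → ℝ) : ENNReal :=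
  1 + ENNReal.ofReal (Real.exp (totalShift k J J' θ)) *
    (ENNReal.ofReal (baseWeight (J * k)) * ∑ p ∈ cells 0 c, ENNReal.ofReal (Real.exp
        (θ / baseWeight (J * k) * partialField k J J' β (gridPoint (J * k) p) -
          baseShift k J J' θ)) +
      ∑ i ∈ Finset.range (J * k), ENNReal.ofReal (chainWeight (J * k - i)) *
        ∑ p ∈ cells (J * k - i) c, ENNReal.ofReal (Real.exp
          (θ / chainWeight (J * k - i) * (partialField k J J' β (gridPoint i p) -
            partialField k J J' β (gridPoint (i + 1) (coarse 2 p))) -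
              chainShift k θ (J * k - i))))

theorem sum_range_sub_eq (I : ℕ) (g : ℕ → ℝ) :
    ∑ i ∈ Finset.range I, g (I - i) = ∑ l ∈ Finset.range I, g (l + 1) := by
  rw [← Finset.sum_range_reflect (fun l => g (l + 1))]
  refine Finset.sum_congr rfl fun i hi => ?_
  rw [Finset.mem_range] at hi
  congr 1
  omega

/-- The series of `(3 / 4) ^ l / 6` over `l ≥ 1` has sum `1 / 2`. -/
theorem half_le_baseWeight (I : ℕ) : 1 / 2 ≤ baseWeight I := by
  have h : ∀ I : ℕ, ∑ l ∈ Finset.range I, chainWeight (l + 1) = 1 / 2 - (3 / 4) ^ I / 2 := by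
    intro I
    induction I with
    | zero => simp
    | succ I ih =>
      rw [Finset.sum_range_succ, ih, chainWeight]
      ring
  rw [baseWeight, sum_range_sub_eq I chainWeight, h I]
  have : (0 : ℝ) < (3 / 4) ^ I := by positivity
  linarith

/-- The ratio `3 / 4` balances two costs: the entropy, of order `l (3 / 4) ^ l`, and the variance `2
^ (-l)` divided by the weight, of order `(2 / 3) ^ l`, are both summable. The constants come from
`log 9 + 2 log 4 < 7` and `24 * 2 = 48`. -/
theorem totalShift_le (k J J' : ℕ) (θ : ℝ) :
    totalShift k J J' θ ≤ 7 + θ ^ 2 * (((J' - J : ℕ) : ℝ) * k + 48 * k) := by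
  have hbw := half_le_baseWeight (J * k)
  have hlog2 := Real.log_two_lt_d9
  have hlog4 : Real.log 4 = 2 * Real.log 2 := by
    rw [show (4 : ℝ) = 2 ^ 2 by norm_num, Real.log_pow]
    norm_num
  have hlog9 : Real.log 9 ≤ 4 * Real.log 2 := by
    have h : Real.log 16 = 4 * Real.log 2 := by
      rw [show (16 : ℝ) = 2 ^ 4 by norm_num, Real.log_pow]
      norm_num
    rw [← h]
    exact Real.log_le_log (by norm_num) (by norm_num)
  have hlog9' : 0 ≤ Real.log 9 := Real.log_nonneg (by norm_num)
  have hterm : ∀ l : ℕ, chainWeight l * chainShift k θ l =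
      chainWeight l * Real.log 9 + l * (3 / 4) ^ l * (Real.log 4 / 6) +
        (2 / 3) ^ l * (24 * θ ^ 2 * k) := by
    intro l
    rw [chainShift, Real.log_mul (by norm_num) (by positivity), Real.log_pow]
    have h1 : chainWeight l * ((θ / chainWeight l) ^ 2 * (8 * k * (1 / 2 ^ l)) / 2) =
        (2 / 3) ^ l * (24 * θ ^ 2 * k) := by
      have h23 : ((2 : ℝ) / 3) ^ l * ((3 / 4) ^ l * 2 ^ l) = 1 := by
        rw [← mul_pow, ← mul_pow]
        norm_num
      have hw := chainWeight_pos l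
      have h2 : chainWeight l * ((θ / chainWeight l) ^ 2 * (8 * k * (1 / 2 ^ l)) / 2) =
          4 * θ ^ 2 * k / (chainWeight l * 2 ^ l) := by
        field_simp
        ring
      rw [h2, div_eq_iff (by positivity), chainWeight]
      linear_combination (-4 * θ ^ 2 * k) * h23
    rw [mul_add, h1, chainWeight]
    ring
  have hs1 : ∀ I : ℕ, ∑ l ∈ Finset.range I, ((l + 1 : ℕ) : ℝ) * (3 / 4) ^ (l + 1) =
      12 - (12 + 3 * I) * (3 / 4) ^ I := by
    intro I
    induction I with
    | zero => norm_num
    | succ I ih =>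
      rw [Finset.sum_range_succ, ih]
      push_cast
      ring
  have hs2 : ∀ I : ℕ, ∑ l ∈ Finset.range I, ((2 : ℝ) / 3) ^ (l + 1) = 2 - 2 * (2 / 3) ^ I := by
    intro I
    induction I with
    | zero => norm_num
    | succ I ih =>
      rw [Finset.sum_range_succ, ih]
      ring
  have hb : baseWeight (J * k) * baseShift k J J' θ ≤
      baseWeight (J * k) * Real.log 9 + θ ^ 2 * (((J' - J : ℕ) : ℝ) * k) := by
    rw [baseShift, mul_add]
    have h2 : baseWeight (J * k) * ((θ / baseWeight (J * k)) ^ 2 *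
        (((J' - J : ℕ) : ℝ) * k) / 2) =
          θ ^ 2 * (((J' - J : ℕ) : ℝ) * k) / (2 * baseWeight (J * k)) := by
      have : baseWeight (J * k) ≠ 0 := by linarith
      field_simp
    rw [h2]
    have : θ ^ 2 * (((J' - J : ℕ) : ℝ) * k) / (2 * baseWeight (J * k)) ≤
        θ ^ 2 * (((J' - J : ℕ) : ℝ) * k) := div_le_self (by positivity) (by linarith)
    linarith
  have hsum : ∑ i ∈ Finset.range (J * k), chainWeight (J * k - i) * chainShift k θ (J * k - i) =
      (1 - baseWeight (J * k)) * Real.log 9 +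
        (12 - (12 + 3 * ((J * k : ℕ) : ℝ)) * (3 / 4) ^ (J * k)) * (Real.log 4 / 6) +
        (2 - 2 * (2 / 3) ^ (J * k)) * (24 * θ ^ 2 * k) := by
    rw [← hs1, ← hs2, baseWeight, sub_sub_cancel,
      sum_range_sub_eq (J * k) (fun l => chainWeight l * chainShift k θ l),
      sum_range_sub_eq (J * k) chainWeight, Finset.sum_congr rfl fun l _ => hterm (l + 1),
      Finset.sum_add_distrib, Finset.sum_add_distrib, Finset.sum_mul, Finset.sum_mul,
      Finset.sum_mul]
  rw [totalShift, hsum]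
  have e1 : 0 ≤ (12 + 3 * ((J * k : ℕ) : ℝ)) * (3 / 4) ^ (J * k) * (Real.log 4 / 6) := by
    have : 0 ≤ Real.log 4 := Real.log_nonneg (by norm_num)
    positivity
  have e2 : 0 ≤ 2 * (2 / 3 : ℝ) ^ (J * k) * (24 * θ ^ 2 * k) := by positivity
  nlinarith

/-- The field at `w` telescopes along the corners of the dyadic cells containing `w`, and Jensen's
inequality for `exp` splits the chain into its links. Each link occurs among the cells summed in
`blockBound`, whatever `w` in the block is. The additional `1` will cover the positive part of the
field. -/
theorem exp_partialField_le {k J J' : ℕ} {θ : ℝ} {c w : ℤ × ℤ}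
    (hw : Near 1 (coarse (2 ^ (J * k)) w) c) (β : ℕ × (ℤ × ℤ) → ℝ) :
    1 + ENNReal.ofReal (Real.exp (θ * partialField k J J' β w)) ≤ blockBound k J J' θ c β := by
  set I := J * k with hI
  set ψ := partialField k J J' β with hψ
  set wt : ℕ → ℤ × ℤ := fun i => gridPoint i (coarse (2 ^ i) w) with hwt
  have hbw := half_le_baseWeight I
  have h0 : wt 0 = w := by simp [hwt, gridPoint, coarse]
  have hcoarse : ∀ i, coarse (2 ^ (i + 1)) w = coarse 2 (coarse (2 ^ i) w) := fun i => by
    rw [pow_succ, coarse_mul (by positivity)]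
  have htel : ψ w = ψ (wt I) + ∑ i ∈ Finset.range I, (ψ (wt i) - ψ (wt (i + 1))) := by
    rw [Finset.sum_range_sub' (fun i => ψ (wt i)), h0]
    ring
  have hexp := convexOn_exp.map_add_sum_le (t := Finset.range I)
    (w := fun i => chainWeight (I - i)) (v := baseWeight I)
    (q := θ / baseWeight I * ψ (wt I) - baseShift k J J' θ)
    (p := fun i => θ / chainWeight (I - i) * (ψ (wt i) - ψ (wt (i + 1))) - chainShift k θ (I - i))
    (fun i _ => (chainWeight_pos _).le) (by rw [baseWeight]; ring) (fun i _ => Set.mem_univ _)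
    (by linarith) (Set.mem_univ _)
  simp only [smul_eq_mul] at hexp
  have harg : baseWeight I * (θ / baseWeight I * ψ (wt I) - baseShift k J J' θ) +
      ∑ i ∈ Finset.range I, chainWeight (I - i) *
        (θ / chainWeight (I - i) * (ψ (wt i) - ψ (wt (i + 1))) - chainShift k θ (I - i)) =
      θ * ψ w - totalShift k J J' θ := by
    have hbw' : baseWeight I ≠ 0 := by linarith
    have h1 : ∀ i, chainWeight (I - i) *
        (θ / chainWeight (I - i) * (ψ (wt i) - ψ (wt (i + 1))) - chainShift k θ (I - i)) =
        θ * (ψ (wt i) - ψ (wt (i + 1))) - chainWeight (I - i) * chainShift k θ (I - i) := by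
      intro i
      have := (chainWeight_pos (I - i)).ne'
      field_simp
    have h2 : baseWeight I * (θ / baseWeight I * ψ (wt I) - baseShift k J J' θ) =
        θ * ψ (wt I) - baseWeight I * baseShift k J J' θ := by
      field_simp
    simp_rw [h1, h2, Finset.sum_sub_distrib, ← Finset.mul_sum]
    rw [htel, totalShift, ← hI, Finset.sum_sub_distrib]
    ring
  rw [harg] at hexp
  have hfin : Real.exp (θ * ψ w) ≤ Real.exp (totalShift k J J' θ) *
      (baseWeight I * Real.exp (θ / baseWeight I * ψ (wt I) - baseShift k J J' θ) +
        ∑ i ∈ Finset.range I, chainWeight (I - i) *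
          Real.exp (θ / chainWeight (I - i) * (ψ (wt i) - ψ (wt (i + 1))) -
            chainShift k θ (I - i))) := by
    refine le_trans (le_of_eq ?_) (mul_le_mul_of_nonneg_left hexp (Real.exp_pos _).le)
    rw [← Real.exp_add]
    congr 1
    ring
  rw [blockBound]
  refine add_le_add le_rfl ((ENNReal.ofReal_le_ofReal hfin).trans ?_)
  have hnn : ∀ i ∈ Finset.range I, 0 ≤ chainWeight (I - i) *
      Real.exp (θ / chainWeight (I - i) * (ψ (wt i) - ψ (wt (i + 1))) -
        chainShift k θ (I - i)) := fun i _ =>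
    mul_nonneg (chainWeight_pos _).le (Real.exp_pos _).le
  rw [ENNReal.ofReal_mul (Real.exp_pos _).le, ENNReal.ofReal_add
    (mul_nonneg (by linarith) (Real.exp_pos _).le) (Finset.sum_nonneg hnn),
    ENNReal.ofReal_mul (by linarith), ENNReal.ofReal_sum_of_nonneg hnn]
  gcongr with i hi
  · refine Finset.single_le_sum (f := fun p => ENNReal.ofReal (Real.exp
        (θ / baseWeight I * ψ (gridPoint I p) - baseShift k J J' θ))) (fun _ _ => zero_le)
      (a := coarse (2 ^ I) w) ?_
    have := coarse_mem_cells le_rfl hw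
    rwa [Nat.sub_self] at this
  · rw [ENNReal.ofReal_mul (chainWeight_pos _).le]
    gcongr
    have hi' : i ≤ I := (Finset.mem_range.1 hi).le
    simp only [hwt]
    rw [hcoarse i]
    exact Finset.single_le_sum (f := fun p => ENNReal.ofReal (Real.exp
        (θ / chainWeight (I - i) * (ψ (gridPoint i p) - ψ (gridPoint (i + 1) (coarse 2 p))) -
          chainShift k θ (I - i)))) (fun _ _ => zero_le) (coarse_mem_cells hi' hw)

theorem one_le_blockBound {k J J' : ℕ} {θ : ℝ} {c : ℤ × ℤ} (β : ℕ × (ℤ × ℤ) → ℝ) :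
    1 ≤ blockBound k J J' θ c β := by
  rw [blockBound]
  exact le_self_add

theorem blockBound_lt_top {k J J' : ℕ} {θ : ℝ} {c : ℤ × ℤ} (β : ℕ × (ℤ × ℤ) → ℝ) :
    blockBound k J J' θ c β < ⊤ := by
  rw [blockBound]
  refine ENNReal.add_lt_top.2 ⟨ENNReal.one_lt_top, ENNReal.mul_lt_top ENNReal.ofReal_lt_top
    (ENNReal.add_lt_top.2 ⟨ENNReal.mul_lt_top ENNReal.ofReal_lt_top
      (ENNReal.sum_lt_top.2 fun _ _ => ENNReal.ofReal_lt_top),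
      ENNReal.sum_lt_top.2 fun _ _ => ENNReal.mul_lt_top ENNReal.ofReal_lt_top
        (ENNReal.sum_lt_top.2 fun _ _ => ENNReal.ofReal_lt_top)⟩)⟩

theorem measurable_partialField (k J J' : ℕ) (z : ℤ × ℤ) :
    Measurable fun β => partialField k J J' β z := by
  unfold partialField
  fun_prop

theorem measurable_blockBound (k J J' : ℕ) (θ : ℝ) (c : ℤ × ℤ) :
    Measurable (blockBound k J J' θ c) := by
  have := measurable_partialField k J J'
  unfold blockBound
  fun_prop

/-- The shift `s` contains `log N`, so each of the `N` summands has expectation at most `1 / N`. -/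
theorem lintegral_sum_exp_sub_le {Ω α : Type*} [MeasurableSpace Ω] {μ : Measure Ω} {N : ℕ}
    {S : Finset α} (hS : S.card = N) (hN : 0 < N) {Y : α → Ω → ℝ} (hY : ∀ p, Measurable (Y p))
    {σ s : ℝ} (hs : s = Real.log N + σ)
    (hYσ : ∀ p ∈ S, ∫⁻ ω, ENNReal.ofReal (Real.exp (Y p ω)) ∂μ ≤ ENNReal.ofReal (Real.exp σ)) :
    ∫⁻ ω, ∑ p ∈ S, ENNReal.ofReal (Real.exp (Y p ω - s)) ∂μ ≤ 1 := by
  have hN' : (0 : ℝ) < N := by exact_mod_cast hN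
  rw [lintegral_finsetSum _ fun p _ => by have := hY p; fun_prop]
  have h1 : ∀ p ∈ S, ∫⁻ ω, ENNReal.ofReal (Real.exp (Y p ω - s)) ∂μ ≤
      ENNReal.ofReal (1 / N) := by
    intro p hp
    simp_rw [sub_eq_add_neg, Real.exp_add, ENNReal.ofReal_mul (Real.exp_pos _).le]
    rw [lintegral_mul_const _ (by have := hY p; fun_prop)]
    refine (mul_le_mul_left (hYσ p hp) _).trans ?_
    rw [← ENNReal.ofReal_mul (Real.exp_pos _).le, ← Real.exp_add, hs,
      show σ + -(Real.log N + σ) = -Real.log N by ring, Real.exp_neg, Real.exp_log hN', one_div]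
  refine (Finset.sum_le_card_nsmul _ _ _ h1).trans ?_
  rw [hS, nsmul_eq_mul, ← ENNReal.ofReal_natCast, ← ENNReal.ofReal_mul hN'.le,
    mul_one_div_cancel hN'.ne', ENNReal.ofReal_one]

theorem lintegral_one_add_mul_le {Ω ι : Type*} [MeasurableSpace Ω] {μ : Measure Ω}
    [IsProbabilityMeasure μ] {A B : ENNReal} {s : Finset ι} {W : ι → ENNReal} {f : Ω → ENNReal}
    {g : ι → Ω → ENNReal} (hf : Measurable f) (hg : ∀ i, Measurable (g i))
    (hf1 : ∫⁻ ω, f ω ∂μ ≤ 1) (hg1 : ∀ i ∈ s, ∫⁻ ω, g i ω ∂μ ≤ 1) :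
    ∫⁻ ω, (1 + A * (B * f ω + ∑ i ∈ s, W i * g i ω)) ∂μ ≤ 1 + A * (B + ∑ i ∈ s, W i) := by
  rw [lintegral_add_left measurable_const, lintegral_one, measure_univ,
    lintegral_const_mul _ (by fun_prop), lintegral_add_left (hf.const_mul _),
    lintegral_const_mul _ hf, lintegral_finsetSum _ fun i _ => (hg i).const_mul _]
  gcongr with i hi
  · exact (mul_le_mul_right hf1 _).trans_eq (mul_one _)
  · rw [lintegral_const_mul _ (hg i)]
    exact (mul_le_mul_right (hg1 i hi) _).trans_eq (mul_one _)

section Expectation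

variable {Ω : Type*} [MeasurableSpace Ω] {μ : Measure Ω} {b : ℕ → ℤ × ℤ → Ω → ℝ} {k : ℕ}

theorem measurable_partialField_comp (hb : IsBoxFamily μ b) (J J' : ℕ) (z : ℤ × ℤ) :
    Measurable fun ω => partialField k J J' (fun i => b i.1 i.2 ω) z := by
  unfold partialField
  exact Finset.measurable_fun_sum _ fun _ _ => Finset.measurable_fun_sum _ fun _ _ =>
    (hb.measurable _ _).const_mul _

theorem lintegral_base_le (hb : IsBoxFamily μ b) (hk : 1 ≤ k) (J J' : ℕ) (θ : ℝ) (c : ℤ × ℤ) :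
    ∫⁻ ω, ∑ p ∈ cells 0 c, ENNReal.ofReal (Real.exp (θ / baseWeight (J * k) *
      partialField k J J' (fun i => b i.1 i.2 ω) (gridPoint (J * k) p) -
        baseShift k J J' θ)) ∂μ ≤ 1 := by
  refine lintegral_sum_exp_sub_le (N := 9) (by rw [card_cells]; norm_num) (by norm_num)
    (Y := fun p ω => θ / baseWeight (J * k) *
      partialField k J J' (fun i => b i.1 i.2 ω) (gridPoint (J * k) p))
    (fun p => (measurable_partialField_comp hb J J' _).const_mul _) ?_
    (fun p _ => lintegral_exp_partialField_le hb hk J J' _ _)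
  rw [baseShift]
  norm_num

theorem lintegral_chain_le (hb : IsBoxFamily μ b) (hk : 1 ≤ k) (J J' : ℕ) (θ : ℝ) (c : ℤ × ℤ)
    {i : ℕ} (hi : i ≤ J * k) :
    ∫⁻ ω, ∑ p ∈ cells (J * k - i) c, ENNReal.ofReal (Real.exp (θ / chainWeight (J * k - i) *
      (partialField k J J' (fun i => b i.1 i.2 ω) (gridPoint i p) -
        partialField k J J' (fun i => b i.1 i.2 ω) (gridPoint (i + 1) (coarse 2 p))) -
          chainShift k θ (J * k - i))) ∂μ ≤ 1 := by
  refine lintegral_sum_exp_sub_le (card_cells _ _) (by positivity)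
    (Y := fun p ω => θ / chainWeight (J * k - i) *
      (partialField k J J' (fun i => b i.1 i.2 ω) (gridPoint i p) -
        partialField k J J' (fun i => b i.1 i.2 ω) (gridPoint (i + 1) (coarse 2 p))))
    (fun p => ((measurable_partialField_comp hb J J' _).sub
      (measurable_partialField_comp hb J J' _)).const_mul _) ?_
    (fun p _ => lintegral_exp_sub_partialField_le hb hk J J' _ (near_gridPoint i p))
  rw [chainShift]
  push_cast
  rw [show (1 : ℝ) / 2 ^ (J * k - i) = 2 ^ i / 2 ^ (J * k) by
    rw [div_eq_div_iff (by positivity) (by positivity), one_mul, ← pow_add,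
      Nat.add_sub_cancel' hi]]

/-- The normalised sums have expectation at most one and the weights sum to one, so what remains is
`1 + exp (totalShift k J J' θ)`; the added `1` raises the constant from `7` to `8`. -/
theorem lintegral_blockBound_le [IsProbabilityMeasure μ] (hb : IsBoxFamily μ b) (hk : 1 ≤ k)
    (J J' : ℕ) (θ : ℝ) (c : ℤ × ℤ) :
    ∫⁻ ω, blockBound k J J' θ c (fun i => b i.1 i.2 ω) ∂μ ≤
      ENNReal.ofReal (Real.exp (8 + θ ^ 2 * (((J' - J : ℕ) : ℝ) * k + 48 * k))) := by
  have hψ := measurable_partialField_comp (k := k) hb J J'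
  have hbw := half_le_baseWeight (J * k)
  have htot := totalShift_le k J J' θ
  unfold blockBound
  refine (lintegral_one_add_mul_le (by fun_prop) (fun i => by fun_prop)
    (lintegral_base_le hb hk J J' θ c)
    (fun i hi => lintegral_chain_le hb hk J J' θ c (Finset.mem_range.1 hi).le)).trans ?_
  rw [← ENNReal.ofReal_sum_of_nonneg fun i _ => (chainWeight_pos _).le,
    ← ENNReal.ofReal_add (by linarith) (Finset.sum_nonneg fun i _ => (chainWeight_pos _).le),
    baseWeight, sub_add_cancel, ENNReal.ofReal_one, mul_one, ← ENNReal.ofReal_one,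
    ← ENNReal.ofReal_add zero_le_one (Real.exp_pos _).le]
  refine ENNReal.ofReal_le_ofReal ?_
  set R := θ ^ 2 * (((J' - J : ℕ) : ℝ) * k + 48 * k) with hR
  have hR0 : 0 ≤ R := by positivity
  have h1 : Real.exp (totalShift k J J' θ) ≤ Real.exp (7 + R) := Real.exp_le_exp.2 htot
  have h2 : 1 ≤ Real.exp (7 + R) := Real.one_le_exp (by linarith)
  have h3 : Real.exp (8 + R) = Real.exp 1 * Real.exp (7 + R) := by
    rw [← Real.exp_add]
    congr 1
    ring
  have h4 : 2 ≤ Real.exp 1 := by linarith [Real.add_one_le_exp 1]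
  nlinarith

end Expectation

/-! ### Factorisation over separated blocks -/

/-- The positions of the boxes of side `2 ^ I` that meet the `3 × 3` block of cells of side `2 ^ I`
around the cell `c`. -/
def blockBoxes (I : ℕ) (c : ℤ × ℤ) : Finset (ℤ × ℤ) :=
  Finset.Ico (2 ^ I * (c.1 - 2)) (2 ^ I * (c.1 + 2)) ×ˢ
    Finset.Ico (2 ^ I * (c.2 - 2)) (2 ^ I * (c.2 + 2))

theorem disjoint_blockBoxes {I : ℕ} {c c' : ℤ × ℤ} (h : ¬ Near 3 c c') :
    Disjoint (blockBoxes I c) (blockBoxes I c') := by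
  rw [Finset.disjoint_left]
  intro a ha ha'
  apply h
  simp only [blockBoxes, Finset.mem_product, Finset.mem_Ico] at ha ha'
  have hpos : (0 : ℤ) < 2 ^ I := by positivity
  have key : ∀ x y : ℤ, 2 ^ I * (x - 2) < 2 ^ I * (y + 2) → x ≤ y + 3 := by
    intro x y hxy
    have := lt_of_mul_lt_mul_left hxy hpos.le
    omega
  exact ⟨key _ _ (by omega), key _ _ (by omega), key _ _ (by omega), key _ _ (by omega)⟩

theorem gridPoint_boxesAt_subset {I i : ℕ} (hi : i ≤ I) {c p : ℤ × ℤ} (hp : p ∈ cells (I - i) c) :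
    boxesAt I (gridPoint i p) ⊆ blockBoxes I c := by
  intro a ha
  simp only [cells, Finset.mem_product, Finset.mem_Ico] at hp
  simp only [boxesAt, gridPoint, Finset.mem_product, Finset.mem_Ioc] at ha
  simp only [blockBoxes, Finset.mem_product, Finset.mem_Ico]
  have hpow : (2 : ℤ) ^ I = 2 ^ i * 2 ^ (I - i) := by rw [← pow_add, Nat.add_sub_cancel' hi]
  have hpos : (0 : ℤ) < 2 ^ i := by positivity
  have key : ∀ x y : ℤ, 2 ^ (I - i) * (y - 1) ≤ x → x < 2 ^ (I - i) * (y + 2) →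
      2 ^ I * (y - 2) + 2 ^ I ≤ 2 ^ i * x ∧ 2 ^ i * x < 2 ^ I * (y + 2) := by
    intro x y h1 h2
    rw [hpow]
    constructor <;> nlinarith
  have := key _ _ hp.1.1 hp.1.2
  have := key _ _ hp.2.1 hp.2.2
  omega

theorem partialField_congr {k J : ℕ} {β β' : ℕ × (ℤ × ℤ) → ℝ} {z : ℤ × ℤ}
    (h : ∀ a ∈ boxesAt (J * k) z, β (J * k, a) = β' (J * k, a)) :
    partialField k J (J + 1) β z = partialField k J (J + 1) β' z := by
  simp only [partialField, Nat.Ico_succ_singleton, Finset.sum_singleton]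
  exact Finset.sum_congr rfl fun a ha => by rw [h a ha]

theorem half_mem_cells {l : ℕ} {c p : ℤ × ℤ} (hp : p ∈ cells (l + 1) c) :
    coarse 2 p ∈ cells l c := by
  simp only [cells, coarse, Finset.mem_product, Finset.mem_Ico] at *
  have h1 : ∀ y : ℤ, 2 ^ (l + 1) * y = 2 * (2 ^ l * y) := fun y => by ring
  simp only [h1] at hp
  omega

/-- With a single level `J`, only boxes of the same side `2 ^ (J k)` as the cells are involved, and
those containing a grid point of the block are among `blockBoxes`. -/
theorem dependsOn_blockBound (k J : ℕ) (θ : ℝ) (c : ℤ × ℤ) :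
    DependsOn (blockBound k J (J + 1) θ c)
      (((blockBoxes (J * k) c).map ⟨Prod.mk (J * k), Prod.mk_right_injective _⟩ :
        Finset (ℕ × (ℤ × ℤ))) : Set (ℕ × (ℤ × ℤ))) := by
  intro β β' h
  have key : ∀ i ≤ J * k, ∀ p ∈ cells (J * k - i) c,
      partialField k J (J + 1) β (gridPoint i p) = partialField k J (J + 1) β' (gridPoint i p) := by
    intro i hi p hp
    refine partialField_congr fun a ha => h _ ?_
    simpa using gridPoint_boxesAt_subset hi hp ha
  unfold blockBound
  congr 2
  congr 1
  · congr 1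
    exact Finset.sum_congr rfl fun p hp => by
      rw [key (J * k) le_rfl p (by rwa [Nat.sub_self])]
  · refine Finset.sum_congr rfl fun i hi => ?_
    rw [Finset.mem_range] at hi
    congr 1
    refine Finset.sum_congr rfl fun p hp => ?_
    rw [key i hi.le p hp, key (i + 1) hi (coarse 2 p) (half_mem_cells (by
      rwa [show J * k - (i + 1) + 1 = J * k - i by omega]))]

/-- Cells that are not within distance `3` use disjoint families of boxes, so the expectation
factorises and the exponent is linear in the number of cells. This linearity is what competes with
the number of trees. -/
theorem lintegral_prod_blockBound_le {Ω : Type*} [MeasurableSpace Ω] {μ : Measure Ω}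
    [IsProbabilityMeasure μ] {b : ℕ → ℤ × ℤ → Ω → ℝ} (hb : IsBoxFamily μ b) {k : ℕ} (hk : 1 ≤ k)
    (J : ℕ) (θ : ℝ) {T : Finset (ℤ × ℤ)} (hT : ∀ z ∈ T, ∀ w ∈ T, z ≠ w → ¬ Near 3 z w) :
    ∫⁻ ω, ∏ c ∈ T, blockBound k J (J + 1) θ c (fun i => b i.1 i.2 ω) ∂μ ≤
      ENNReal.ofReal (Real.exp (T.card * (8 + θ ^ 2 * (49 * k)))) := by
  rw [lintegral_prod_of_dependsOn hb.indep (fun i => hb.measurable _ _) T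
    (S := fun c => (blockBoxes (J * k) c).map ⟨Prod.mk (J * k), Prod.mk_right_injective _⟩) ?_
    (fun c => measurable_blockBound k J (J + 1) θ c) (fun c => dependsOn_blockBound k J θ c)]
  · refine (Finset.prod_le_prod' fun c _ => lintegral_blockBound_le hb hk J (J + 1) θ c).trans ?_
    rw [Finset.prod_const, ← ENNReal.ofReal_pow (Real.exp_pos _).le, ← Real.exp_nat_mul]
    refine ENNReal.ofReal_le_ofReal (Real.exp_le_exp.2 (le_of_eq ?_))
    rw [Nat.add_sub_cancel_left]
    push_cast
    ring
  · intro c hc c' hc' hcc'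
    rw [Function.onFun, Finset.disjoint_map]
    exact disjoint_blockBoxes (hT c hc c' hc' hcc')

/-! ### Closed sites -/

/-- The `ℓ_∞`-ball of radius `r` around `x`. -/
def nearBox (r : ℕ) (x : ℤ × ℤ) : Finset (ℤ × ℤ) :=
  Finset.Icc (x.1 - r) (x.1 + r) ×ˢ Finset.Icc (x.2 - r) (x.2 + r)

theorem mem_nearBox {r : ℕ} {x z : ℤ × ℤ} : z ∈ nearBox r x ↔ Near r z x := by
  simp only [nearBox, Finset.mem_product, Finset.mem_Icc, Near]
  omega

theorem card_nearBox (r : ℕ) (x : ℤ × ℤ) : (nearBox r x).card = (2 * r + 1) ^ 2 := by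
  have h : ∀ y : ℤ, (Finset.Icc (y - r) (y + r)).card = 2 * r + 1 := fun y => by
    rw [Int.card_Icc]
    omega
  rw [nearBox, Finset.card_product, h, h, sq]

section Sites

variable {Ω : Type*} [MeasurableSpace Ω] {μ : Measure Ω} [IsProbabilityMeasure μ] {n q : ℕ} {p : ℝ}
  {φ : ℤ × ℤ → Ω → ℝ} {ξ : ℤ × ℤ → Ω → Bool}

theorem IsSiteProcess.prob_closed_le (h : IsSiteProcess μ n q p φ ξ) {w : ℤ × ℤ} (hw : w ∈ V n) :
    μ.real {ω | ξ w ω = false} ≤ 1 - p := by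
  have hmeas : MeasurableSet {ω | ξ w ω = true} := h.measurable w hw (measurableSet_singleton true)
  have hc : {ω | ξ w ω = false} = {ω | ξ w ω = true}ᶜ := by
    ext ω
    simp
  rw [hc, probReal_compl_eq_one_sub hmeas]
  linarith [h.prob_open w hw]

theorem IsSiteProcess.prob_separated_closed_le (h : IsSiteProcess μ n q p φ ξ)
    (A : Finset (ℤ × ℤ)) (hA : A ⊆ V n) (hsep : ∀ z ∈ A, ∀ w ∈ A, z ≠ w → (q : ℝ) < dist z w) :
    μ.real {ω | ∀ w ∈ A, ξ w ω = false} ≤ (1 - p) ^ A.card := by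
  induction A using Finset.induction_on with
  | empty => simp
  | insert a A ha ih =>
    have haV : a ∈ V n := hA (by simp)
    have hAV : A ⊆ V n := (Finset.subset_insert a A).trans hA
    have hind := h.q_dependent {a} (by simpa using haV) A hAV (by
      intro z hz w hw
      rw [Finset.mem_singleton] at hz
      subst hz
      exact hsep z (by simp) w (by simp [hw]) (fun hzw => ha (hzw ▸ hw)))
    have hmul := hind.measure_inter_preimage_eq_mul {fun _ => false} {fun _ => false}
      (measurableSet_singleton _) (measurableSet_singleton _)
    have h1 : (fun ω (w : ({a} : Finset (ℤ × ℤ))) => ξ w ω) ⁻¹' {fun _ => false} =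
        {ω | ξ a ω = false} := by
      ext ω
      simp [funext_iff]
    have h2 : (fun ω (w : A) => ξ w ω) ⁻¹' {fun _ => false} =
        {ω | ∀ w ∈ A, ξ w ω = false} := by
      ext ω
      simp [funext_iff]
    have h3 : {ω | ∀ w ∈ insert a A, ξ w ω = false} =
        {ω | ξ a ω = false} ∩ {ω | ∀ w ∈ A, ξ w ω = false} := by
      ext ω
      simp
    rw [h1, h2] at hmul
    rw [h3, Measure.real, hmul, ENNReal.toReal_mul, Finset.card_insert_of_notMem ha, pow_succ']
    exact mul_le_mul (h.prob_closed_le haV)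
      (ih hAV fun z hz w hw => hsep z (by simp [hz]) w (by simp [hw]))
      ENNReal.toReal_nonneg (measureReal_nonneg.trans (h.prob_closed_le haV))

/-- The effective probability that a site is closed, in a union bound. -/
def closedRate (q : ℕ) (p : ℝ) : ℝ := (1 - p) ^ (1 / (2 * (q : ℝ) + 1) ^ 2)

/-- Take the most frequent residue class modulo `2 q + 1`: distinct points of one class differ by at
least `2 q + 1 > q` in some coordinate. -/
theorem exists_card_separated (q : ℕ) (A : Finset (ℤ × ℤ)) :
    ∃ C ⊆ A, A.card ≤ C.card * (2 * q + 1) ^ 2 ∧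
      ∀ z ∈ C, ∀ w ∈ C, z ≠ w → (q : ℝ) < dist z w := by
  have hs : (0 : ℚ) < (2 * q + 1) ^ 2 := by positivity
  obtain ⟨y, _, hy⟩ := Finset.exists_le_card_fiber_of_nsmul_le_card_of_maps_to
    (s := A) (t := Finset.Ico (0 : ℤ) (2 * q + 1) ×ˢ Finset.Ico (0 : ℤ) (2 * q + 1))
    (f := fun z : ℤ × ℤ => (z.1 % (2 * q + 1), z.2 % (2 * q + 1)))
    (b := (A.card : ℚ) / (2 * q + 1) ^ 2)
    (fun a _ => by
      simp only [Finset.mem_product, Finset.mem_Ico]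
      exact ⟨⟨Int.emod_nonneg _ (by omega), Int.emod_lt_of_pos _ (by omega)⟩,
        Int.emod_nonneg _ (by omega), Int.emod_lt_of_pos _ (by omega)⟩)
    ⟨(0, 0), by simp⟩ (by
      have h : (Finset.Ico (0 : ℤ) (2 * q + 1) ×ˢ Finset.Ico (0 : ℤ) (2 * q + 1)).card =
          (2 * q + 1) ^ 2 := by
        rw [Finset.card_product, Int.card_Ico, sq]
        congr 1
      rw [h, nsmul_eq_mul]
      push_cast
      rw [mul_div_cancel₀ _ hs.ne'])
  refine ⟨{z ∈ A | (z.1 % (2 * q + 1), z.2 % (2 * q + 1)) = y}, Finset.filter_subset _ _, ?_, ?_⟩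
  · rw [div_le_iff₀ hs] at hy
    exact_mod_cast hy
  · intro z hz w hw hzw
    have hz2 := (Finset.mem_filter.1 hz).2
    rw [← (Finset.mem_filter.1 hw).2, Prod.mk.injEq] at hz2
    have key : ∀ x y : ℤ, x % (2 * q + 1) = y % (2 * q + 1) → x ≠ y → (q : ℝ) < dist x y := by
      intro x y hxy hne
      have hdvd : (2 * q + 1 : ℤ) ∣ x - y := Int.ModEq.dvd (Int.ModEq.symm hxy)
      have h1 := Int.le_of_dvd (abs_pos.2 (sub_ne_zero.2 hne)) ((dvd_abs _ _).2 hdvd)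
      rw [Int.dist_eq]
      have h2 : ((2 * q + 1 : ℤ) : ℝ) ≤ ((|x - y| : ℤ) : ℝ) := by exact_mod_cast h1
      push_cast at h2
      have : (0 : ℝ) ≤ q := Nat.cast_nonneg q
      linarith
    rw [Prod.dist_eq, lt_max_iff]
    by_cases h : z.1 = w.1
    · exact Or.inr (key _ _ hz2.2 fun h' => hzw (Prod.ext h h'))
    · exact Or.inl (key _ _ hz2.1 h)

/-- Independence is used only on a separated subset, which has at least `A.card / (2 q + 1) ^ 2`
points; hence the exponent in `closedRate`. -/
theorem IsSiteProcess.prob_closed_set_le (h : IsSiteProcess μ n q p φ ξ) (hp : p ≤ 1)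
    (hp0 : 0 ≤ p) {A : Finset (ℤ × ℤ)} (hA : A ⊆ V n) :
    μ.real {ω | ∀ w ∈ A, ξ w ω = false} ≤ closedRate q p ^ A.card := by
  obtain ⟨C, hCA, hcard, hsep⟩ := exists_card_separated q A
  have h1 : μ.real {ω | ∀ w ∈ A, ξ w ω = false} ≤ μ.real {ω | ∀ w ∈ C, ξ w ω = false} :=
    measureReal_mono (fun ω hω w hw => hω w (hCA hw)) (measure_ne_top _ _)
  refine h1.trans ((h.prob_separated_closed_le C (hCA.trans hA) hsep).trans ?_)
  rw [closedRate, ← Real.rpow_natCast, ← Real.rpow_natCast, ← Real.rpow_mul (by linarith)]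
  refine Real.rpow_le_rpow_of_exponent_ge' (by linarith) (by linarith) (by positivity) ?_
  rw [div_mul_eq_mul_div, one_mul, div_le_iff₀ (by positivity)]
  exact_mod_cast hcard

theorem closedRate_nonneg (hp : p ≤ 1) : 0 ≤ closedRate q p :=
  Real.rpow_nonneg (by linarith) _

/-- Around a given point, a closed `ℓ_∞`-connected set whose diameter exceeds its distance to the
point is unlikely. -/
theorem IsSiteProcess.prob_closed_walk_le (h : IsSiteProcess μ n q p φ ξ) (hp : p ≤ 1)
    (hp0 : 0 ≤ p) (hε : closedRate q p ≤ 1 / 162) (x : ℤ × ℤ) :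
    μ.real {ω | ∃ l : ℕ, ∃ z, Near l z x ∧ ∃ W ∈ starWalks l z, W.card = l + 1 ∧ W ⊆ V n ∧
      ∀ w ∈ W, ξ w ω = false} ≤ 2 * closedRate q p := by
  set ε := closedRate q p with hεdef
  have hε0 : 0 ≤ ε := closedRate_nonneg hp
  -- A walk with `l + 1` distinct points in `V n` has `l < L`, which makes the union finite.
  set L := (V n).card with hL
  have hsub : {ω | ∃ l : ℕ, ∃ z, Near l z x ∧ ∃ W ∈ starWalks l z, W.card = l + 1 ∧ W ⊆ V n ∧
      ∀ w ∈ W, ξ w ω = false} ⊆ ⋃ l ∈ Finset.range L, ⋃ z ∈ nearBox l x,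
        ⋃ W ∈ {W ∈ starWalks l z | W.card = l + 1 ∧ W ⊆ V n}, {ω | ∀ w ∈ W, ξ w ω = false} := by
    rintro ω ⟨l, z, hz, W, hW, hcard, hWV, hω⟩
    simp only [Set.mem_iUnion, exists_prop, Finset.mem_range, Finset.mem_filter]
    refine ⟨l, ?_, z, mem_nearBox.2 hz, W, ⟨hW, hcard, hWV⟩, hω⟩
    have := Finset.card_le_card hWV
    omega
  have hone : ∀ l z, μ.real (⋃ W ∈ {W ∈ starWalks l z | W.card = l + 1 ∧ W ⊆ V n},
      {ω | ∀ w ∈ W, ξ w ω = false}) ≤ 9 ^ l * ε ^ (l + 1) := by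
    intro l z
    refine (measureReal_biUnion_finset_le _ _).trans ?_
    refine (Finset.sum_le_card_nsmul _ _ (ε ^ (l + 1)) fun W hW => ?_).trans ?_
    · obtain ⟨_, hcard, hWV⟩ := Finset.mem_filter.1 hW
      rw [← hcard]
      exact h.prob_closed_set_le hp hp0 hWV
    · rw [nsmul_eq_mul]
      refine mul_le_mul_of_nonneg_right ?_ (by positivity)
      exact_mod_cast (Finset.card_filter_le _ _).trans (card_starWalks_le l z)
  have htwo : ∀ l, μ.real (⋃ z ∈ nearBox l x, ⋃ W ∈ {W ∈ starWalks l z | W.card = l + 1 ∧ W ⊆ V n},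
      {ω | ∀ w ∈ W, ξ w ω = false}) ≤ ε * (1 / 2) ^ l := by
    intro l
    refine (measureReal_biUnion_finset_le _ _).trans ?_
    refine (Finset.sum_le_card_nsmul _ _ _ fun z _ => hone l z).trans ?_
    rw [card_nearBox, nsmul_eq_mul]
    -- The number of starting points, `(2 l + 1) ^ 2`, is at most `9 ^ l`; with `9 ^ l` walks the
    -- sum over `l` becomes geometric with ratio `81 ε ≤ 1 / 2`.
    have h3 : (1 : ℝ) + l * 2 ≤ (1 + 2) ^ l := one_add_mul_le_pow (by norm_num) l
    push_cast
    calc (2 * (l : ℝ) + 1) ^ 2 * (9 ^ l * ε ^ (l + 1))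
        ≤ ((1 + 2) ^ l) ^ 2 * (9 ^ l * ε ^ (l + 1)) := by
          gcongr
          linarith
      _ = ε * (81 * ε) ^ l := by
          rw [← pow_mul, mul_comm l 2, pow_mul, mul_pow, show (81 : ℝ) = (1 + 2) ^ 2 * 9 by norm_num,
            mul_pow]
          ring
      _ ≤ ε * (1 / 2) ^ l := by
          gcongr
          linarith
  refine (measureReal_mono hsub (measure_ne_top _ _)).trans ((measureReal_biUnion_finset_le _ _).trans ?_)
  refine (Finset.sum_le_sum fun l _ => htwo l).trans ?_
  rw [← Finset.mul_sum, mul_comm]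
  refine mul_le_mul_of_nonneg_right ?_ hε0
  have := geom_sum_Ico_le_of_lt_one (m := 0) (n := L) (show (0 : ℝ) ≤ 1 / 2 by norm_num) (by norm_num)
  rw [Nat.Ico_zero_eq_range] at this
  exact this.trans (by norm_num)

/-- It is unlikely that a quarter of the leaves of some tree is closed. -/
theorem IsSiteProcess.prob_closed_tree_le (h : IsSiteProcess μ n q p φ ξ) (hp : p ≤ 1)
    (hp0 : 0 ≤ p) {M : ℕ} (hM : 2 ≤ M) (hε : closedRate q p ≤ ((6 * 36 ^ 72 : ℝ)⁻¹) ^ 4)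
    (d : ℕ) (c : ℤ × ℤ) :
    μ.real {ω | ∃ T ∈ trees M d c, T ⊆ V n ∧ M ^ d ≤ 4 * {w ∈ T | ξ w ω = false}.card} ≤
      Real.exp (-(M ^ d : ℝ)) := by
  set ε := closedRate q p with hεdef
  have hε0 : 0 ≤ ε := closedRate_nonneg hp
  -- With `36 ^ 72` per leaf for the choice of the tree and `2` for the choice of the closed leaves,
  -- each leaf contributes `36 ^ 72 * 2 * η = 1 / 3 < exp (-1)`. Only a quarter of the leaves is
  -- closed, hence the fourth power in the hypothesis.
  set η : ℝ := (6 * 36 ^ 72 : ℝ)⁻¹ with hη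
  have hη0 : 0 < η := by positivity
  have hη1 : η ≤ 1 := by
    rw [hη]
    exact inv_le_one_of_one_le₀ (by norm_num)
  have hsub : {ω | ∃ T ∈ trees M d c, T ⊆ V n ∧ M ^ d ≤ 4 * {w ∈ T | ξ w ω = false}.card} ⊆
      ⋃ T ∈ {T ∈ trees M d c | T ⊆ V n}, ⋃ A ∈ {A ∈ T.powerset | M ^ d ≤ 4 * A.card},
        {ω | ∀ w ∈ A, ξ w ω = false} := by
    rintro ω ⟨T, hT, hTV, hcard⟩
    simp only [Set.mem_iUnion, exists_prop, Finset.mem_filter, Finset.mem_powerset]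
    exact ⟨T, ⟨hT, hTV⟩, _, ⟨Finset.filter_subset _ _, hcard⟩, fun w hw => (Finset.mem_filter.1 hw).2⟩
  have hone : ∀ T ∈ {T ∈ trees M d c | T ⊆ V n},
      μ.real (⋃ A ∈ {A ∈ T.powerset | M ^ d ≤ 4 * A.card}, {ω | ∀ w ∈ A, ξ w ω = false}) ≤
        2 ^ M ^ d * η ^ M ^ d := by
    intro T hT
    obtain ⟨hT, hTV⟩ := Finset.mem_filter.1 hT
    refine (measureReal_biUnion_finset_le _ _).trans ?_
    refine (Finset.sum_le_card_nsmul _ _ (η ^ M ^ d) fun A hA => ?_).trans ?_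
    · obtain ⟨hAT, hcard⟩ := Finset.mem_filter.1 hA
      refine (h.prob_closed_set_le hp hp0 ((Finset.mem_powerset.1 hAT).trans hTV)).trans ?_
      refine (pow_le_pow_left₀ hε0 hε _).trans ?_
      rw [← pow_mul]
      exact pow_le_pow_of_le_one hη0.le hη1 hcard
    · rw [nsmul_eq_mul]
      refine mul_le_mul_of_nonneg_right ?_ (by positivity)
      have h1 := Finset.card_filter_le T.powerset fun A => M ^ d ≤ 4 * A.card
      rw [Finset.card_powerset, card_of_mem_trees (by omega) hT] at h1
      exact_mod_cast h1
  refine (measureReal_mono hsub (measure_ne_top _ _)).trans ((measureReal_biUnion_finset_le _ _).trans ?_)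
  refine (Finset.sum_le_card_nsmul _ _ _ hone).trans ?_
  rw [nsmul_eq_mul]
  have hcard : (({T ∈ trees M d c | T ⊆ V n}.card : ℕ) : ℝ) ≤ (36 ^ 72) ^ M ^ d := by
    rw [← pow_mul]
    exact_mod_cast (Finset.card_filter_le _ _).trans (card_trees_le hM d c)
  calc _ ≤ (36 ^ 72) ^ M ^ d * (2 ^ M ^ d * η ^ M ^ d) := by gcongr
    _ = (1 / 3) ^ M ^ d := by
        rw [← mul_pow, ← mul_pow, hη]
        congr 1
        norm_num
    _ ≤ (Real.exp (-1)) ^ M ^ d := by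
        refine pow_le_pow_left₀ (by norm_num) ?_ _
        rw [Real.exp_neg, one_div]
        exact inv_anti₀ (Real.exp_pos _) (by linarith [Real.exp_one_lt_d9])
    _ = Real.exp (-(M ^ d : ℝ)) := by
        rw [← Real.exp_nat_mul]
        push_cast
        ring_nf

end Sites

/-! ### Tail bounds for the field over blocks and trees -/

section Field

variable {Ω : Type*} [MeasurableSpace Ω] {μ : Measure Ω} {b : ℕ → ℤ × ℤ → Ω → ℝ} {k : ℕ}

theorem measureReal_le_of_lintegral {f : Ω → ENNReal} (hf : Measurable f) {A B : ℝ}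
    (h : ∫⁻ ω, f ω ∂μ ≤ ENNReal.ofReal (Real.exp A)) :
    μ.real {ω | ENNReal.ofReal (Real.exp B) ≤ f ω} ≤ Real.exp (A - B) := by
  refine ENNReal.toReal_le_of_le_ofReal (Real.exp_pos _).le ?_
  have hB : ENNReal.ofReal (Real.exp B) ≠ 0 := by simp [Real.exp_pos]
  refine (meas_ge_le_lintegral_div hf.aemeasurable hB ENNReal.ofReal_ne_top).trans ?_
  rw [Real.exp_sub, ENNReal.ofReal_div_of_pos (Real.exp_pos _)]
  gcongr

theorem measurable_blockBound_comp (hb : IsBoxFamily μ b) (J J' : ℕ) (θ : ℝ) (c : ℤ × ℤ) :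
    Measurable fun ω => blockBound k J J' θ c (fun i => b i.1 i.2 ω) := by
  have hψ := measurable_partialField_comp (k := k) hb J J'
  unfold blockBound
  fun_prop

/-- The upper tail of the maximum over a block of the contribution of several levels. -/
theorem prob_partialField_gt_le [IsProbabilityMeasure μ] (hb : IsBoxFamily μ b) (hk : 1 ≤ k) (J J' : ℕ) {θ : ℝ}
    (hθ : 0 ≤ θ) (c : ℤ × ℤ) (y : ℝ) :
    μ.real {ω | ∃ w, Near 1 (coarse (2 ^ (J * k)) w) c ∧
      y < partialField k J J' (fun i => b i.1 i.2 ω) w} ≤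
      Real.exp (8 + θ ^ 2 * (((J' - J : ℕ) : ℝ) * k + 48 * k) - θ * y) := by
  refine le_trans (measureReal_mono ?_ (measure_ne_top _ _)) (measureReal_le_of_lintegral
    (measurable_blockBound_comp hb J J' θ c) (lintegral_blockBound_le hb hk J J' θ c))
  rintro ω ⟨w, hw, hy⟩
  refine le_trans ?_ (exp_partialField_le hw _)
  refine le_add_left (ENNReal.ofReal_le_ofReal (Real.exp_le_exp.2 ?_))
  gcongr

/-- It is unlikely that the maxima of one level of the field over the blocks of some tree are large
on average. -/
theorem prob_blockBound_tree_le [IsProbabilityMeasure μ] (hb : IsBoxFamily μ b) (hk : 1 ≤ k) {M : ℕ} (hM : 2 ≤ M) {δ : ℝ}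
    (hkδ : 240000 ≤ δ ^ 2 * k) (j d : ℕ) (c : ℤ × ℤ) :
    μ.real {ω | ∃ T ∈ trees M d c, ENNReal.ofReal (Real.exp (δ / 196 * (δ * k / 2 * M ^ d))) ≤
      ∏ c' ∈ T, blockBound k j (j + 1) (δ / 196) c' (fun i => b i.1 i.2 ω)} ≤
      Real.exp (-(M ^ d : ℝ)) := by
  set B := δ / 196 * (δ * k / 2 * M ^ d) with hB
  have hsub : {ω | ∃ T ∈ trees M d c, ENNReal.ofReal (Real.exp B) ≤
      ∏ c' ∈ T, blockBound k j (j + 1) (δ / 196) c' (fun i => b i.1 i.2 ω)} ⊆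
      ⋃ T ∈ trees M d c, {ω | ENNReal.ofReal (Real.exp B) ≤
        ∏ c' ∈ T, blockBound k j (j + 1) (δ / 196) c' (fun i => b i.1 i.2 ω)} := by
    rintro ω ⟨T, hT, h⟩
    simp only [Set.mem_iUnion, exists_prop]
    exact ⟨T, hT, h⟩
  have hone : ∀ T ∈ trees M d c, μ.real {ω | ENNReal.ofReal (Real.exp B) ≤
      ∏ c' ∈ T, blockBound k j (j + 1) (δ / 196) c' (fun i => b i.1 i.2 ω)} ≤
        Real.exp (M ^ d * (8 + (δ / 196) ^ 2 * (49 * k)) - B) := by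
    intro T hT
    have h1 := lintegral_prod_blockBound_le hb hk j (δ / 196)
      (not_near_of_ne_of_mem_trees (by omega) hT)
    rw [card_of_mem_trees (by omega) hT] at h1
    push_cast at h1
    exact measureReal_le_of_lintegral
      (Finset.measurable_fun_prod _ fun c' _ => measurable_blockBound_comp hb _ _ _ _) h1
  refine (measureReal_mono hsub (measure_ne_top _ _)).trans ((measureReal_biUnion_finset_le _ _).trans ?_)
  refine (Finset.sum_le_card_nsmul _ _ _ hone).trans ?_
  rw [nsmul_eq_mul]
  have h36 : (36 : ℝ) ≤ Real.exp 4 := by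
    have h1 : (2.7 : ℝ) ≤ Real.exp 1 := by linarith [Real.exp_one_gt_d9]
    have h2 : Real.exp 4 = Real.exp 1 ^ 4 := by
      rw [← Real.exp_nat_mul]
      norm_num
    rw [h2]
    calc (36 : ℝ) ≤ 2.7 ^ 4 := by norm_num
      _ ≤ _ := by gcongr
  have hcard : ((trees M d c).card : ℝ) ≤ Real.exp (288 * M ^ d) := by
    calc ((trees M d c).card : ℝ) ≤ 36 ^ (72 * M ^ d) := by exact_mod_cast card_trees_le hM d c
      _ ≤ Real.exp 4 ^ (72 * M ^ d) := by gcongr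
      _ = Real.exp (288 * M ^ d) := by
          rw [← Real.exp_nat_mul]
          push_cast
          ring_nf
  refine (mul_le_mul_of_nonneg_right hcard (Real.exp_pos _).le).trans ?_
  rw [← Real.exp_add]
  refine Real.exp_le_exp.2 ?_
  have hMd : (0 : ℝ) < M ^ d := by
    have : (0 : ℝ) < M := by exact_mod_cast (by omega : 0 < M)
    positivity
  -- Per leaf, choosing the tree costs `288 = 72 * 4` and the moment costs `8 + δ ^ 2 k / 784`,
  -- against a gain of `δ ^ 2 k / 392`; the choice `θ = δ / 196` maximises the net gain. Since
  -- `240000 / 784 > 297`, a factor `exp (-1)` per leaf is left.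
  have h3 : 288 * (M : ℝ) ^ d + (M ^ d * (8 + (δ / 196) ^ 2 * (49 * k)) - B) =
      M ^ d * (296 - δ ^ 2 * k / 784) := by
    rw [hB]
    ring
  rw [h3]
  nlinarith

end Field

/-! ### Breadth-first search and the size of its layers -/

/-- The points that can be reached from `u` by at most `r` steps within `V n` to sites of `O`. -/
def reach (n : ℕ) (O : Set (ℤ × ℤ)) (u : ℤ × ℤ) : ℕ → Set (ℤ × ℤ)
  | 0 => {u}
  | r + 1 => reach n O u r ∪ {w | w ∈ V n ∧ w ∈ O ∧ ∃ c ∈ reach n O u r, gridGraph.Adj c w}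

section reach

variable {n : ℕ} {O : Set (ℤ × ℤ)} {u v : ℤ × ℤ}

theorem reach_mono : Monotone (reach n O u) :=
  monotone_nat_of_le_succ fun _ => Set.subset_union_left

theorem self_mem_reach (r : ℕ) : u ∈ reach n O u r :=
  reach_mono (Nat.zero_le r) (Set.mem_singleton u)

theorem exists_walk_of_mem_reach (hu : u ∈ V n) (huO : u ∈ O) {r : ℕ} {w : ℤ × ℤ}
    (hw : w ∈ reach n O u r) :
    ∃ P : gridGraph.Walk u w, P.length ≤ r ∧ ∀ z ∈ P.support, z ∈ V n ∧ z ∈ O := by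
  induction r generalizing w with
  | zero =>
    obtain rfl : w = u := hw
    exact ⟨SimpleGraph.Walk.nil, le_rfl, by simp [hu, huO]⟩
  | succ r ih =>
    rcases hw with hw | ⟨hwV, hwO, c, hc, hcw⟩
    · obtain ⟨P, hP, h⟩ := ih hw
      exact ⟨P, by omega, h⟩
    · obtain ⟨P, hP, h⟩ := ih hc
      refine ⟨P.concat hcw, by rw [SimpleGraph.Walk.length_concat]; omega, fun z hz => ?_⟩
      rw [SimpleGraph.Walk.support_concat, List.mem_append, List.mem_singleton] at hz
      rcases hz with hz | rfl
      · exact h z hz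
      · exact ⟨hwV, hwO⟩

theorem exists_isPath_of_mem_reach (hu : u ∈ V n) (huO : u ∈ O) {r : ℕ} (hv : v ∈ reach n O u r) :
    ∃ P : gridGraph.Walk u v, P.IsPath ∧ P.support.length ≤ r + 1 ∧
      ∀ z ∈ P.support, z ∈ V n ∧ z ∈ O := by
  classical
  obtain ⟨P, hP, h⟩ := exists_walk_of_mem_reach hu huO hv
  refine ⟨P.bypass, P.bypass_isPath, ?_, fun z hz => h z (P.support_bypass_subset_support hz)⟩
  rw [SimpleGraph.Walk.length_support]
  have := P.length_bypass_le_length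
  omega

theorem reach_subset (hu : u ∈ V n) (r : ℕ) : ∀ w ∈ reach n O u r, w ∈ V n := by
  induction r with
  | zero =>
    intro w hw
    obtain rfl : w = u := hw
    exact hu
  | succ r ih =>
    rintro w (hw | hw)
    · exact ih w hw
    · exact hw.1

theorem connectedOn_reach (r : ℕ) : ConnectedOn gridGraph.Adj (reach n O u r) := by
  intro g hg
  have key : ∀ s ≤ r, ∀ w ∈ reach n O u s, g u ↔ g w := by
    intro s
    induction s with
    | zero =>
      intro _ w hw
      obtain rfl : w = u := hw
      rfl
    | succ s ih =>
      rintro hs w (hw | ⟨hwV, hwO, c, hc, hcw⟩)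
      · exact ih (by omega) w hw
      · have hc' := reach_mono (by omega : s ≤ r) hc
        have hw' : w ∈ reach n O u r := reach_mono hs (Or.inr ⟨hwV, hwO, c, hc, hcw⟩)
        exact (ih (by omega) c hc).trans ⟨hg c hc' w hw' hcw, hg w hw' c hc' hcw.symm⟩
  intro z hz w hw h
  exact (key r le_rfl w hw).1 ((key r le_rfl z hz).2 h)

/-- The points at distance exactly `r + 1` from `u`. -/
def layer (n : ℕ) (O : Set (ℤ × ℤ)) (u : ℤ × ℤ) (r : ℕ) : Set (ℤ × ℤ) :=
  reach n O u (r + 1) \ reach n O u r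

/-- A boundary site that lies in `O` is adjacent to the explored set without belonging to it, so the
search takes it in at the next step. -/
theorem mem_layer_of_mem_outerBoundary (hv : v ∈ V n) {r : ℕ} (hvr : v ∉ reach n O u r)
    {w : ℤ × ℤ} (hw : w ∈ outerBoundary n (reach n O u r) v) (hwO : w ∈ O) : w ∈ layer n O u r := by
  obtain ⟨h1, h2⟩ := outer_subset hv hvr hw.1
  exact ⟨Or.inr ⟨h1, hwO, hw.2⟩, h2⟩

open Classical in
theorem sum_card_layer_le (B : Finset (ℤ × ℤ)) (R : ℕ) :
    ∑ r ∈ Finset.range R, {w ∈ B | w ∈ layer n O u r}.card ≤ B.card := by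
  rw [← Finset.card_biUnion]
  · refine Finset.card_le_card fun w hw => ?_
    obtain ⟨r, _, hw⟩ := Finset.mem_biUnion.1 hw
    exact (Finset.mem_filter.1 hw).1
  · intro r _ r' _ hrr'
    rw [Function.onFun, Finset.disjoint_left]
    intro w hw hw'
    have h1 := (Finset.mem_filter.1 hw).2
    have h2 := (Finset.mem_filter.1 hw').2
    rcases lt_or_gt_of_ne hrr' with h | h
    · exact h2.2 (reach_mono (by omega : r + 1 ≤ r') h1.1)
    · exact h1.2 (reach_mono (by omega : r' + 1 ≤ r) h2.1)

end reach

theorem exists_diam {n : ℕ} {S : Set (ℤ × ℤ)} (hSV : ∀ z ∈ S, z ∈ V n) (hS : S.Nonempty) :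
    ∃ D : ℕ, D < 2 ^ n ∧ (∀ z ∈ S, ∀ w ∈ S, Near D z w) ∧
      ∃ z ∈ S, ∃ w ∈ S, ¬ Near ((D : ℤ) - 1) z w := by
  classical
  have hpos : 0 < 2 ^ n := by positivity
  have hex : ∃ D : ℕ, ∀ z ∈ S, ∀ w ∈ S, Near D z w := by
    refine ⟨2 ^ n - 1, fun z hz w hw => ?_⟩
    have h1 := mem_V.1 (hSV z hz)
    have h2 := mem_V.1 (hSV w hw)
    have h3 : ((2 ^ n - 1 : ℕ) : ℤ) = 2 ^ n - 1 := by
      rw [Nat.cast_sub (by omega)]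
      push_cast
      rfl
    unfold Near
    rw [h3]
    omega
  refine ⟨Nat.find hex, ?_, Nat.find_spec hex, ?_⟩
  · refine (Nat.find_le (n := 2 ^ n - 1) fun z hz w hw => ?_).trans_lt (by omega)
    have h1 := mem_V.1 (hSV z hz)
    have h2 := mem_V.1 (hSV w hw)
    have h3 : ((2 ^ n - 1 : ℕ) : ℤ) = 2 ^ n - 1 := by
      rw [Nat.cast_sub (by omega)]
      push_cast
      rfl
    unfold Near
    rw [h3]
    omega
  -- For diameter `0` the radius is `-1`, and no point is within distance `-1` even of itself.
  · rcases Nat.eq_zero_or_pos (Nat.find hex) with h | h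
    · obtain ⟨z, hz⟩ := hS
      refine ⟨z, hz, z, hz, ?_⟩
      rw [h]
      unfold Near
      omega
    · have h1 := Nat.find_min hex (Nat.sub_lt h one_pos)
      push Not at h1
      obtain ⟨z, hz, w, hw, hzw⟩ := h1
      refine ⟨z, hz, w, hw, ?_⟩
      rwa [Nat.cast_sub (by omega), Nat.cast_one] at hzw

theorem exists_mem_V_ne {n : ℕ} (hn : 1 ≤ n) (u v : ℤ × ℤ) : ∃ s ∈ V n, s ≠ u ∧ s ≠ v := by
  have h2 : (2 : ℤ) ≤ 2 ^ n := by
    calc (2 : ℤ) = 2 ^ 1 := by norm_num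
      _ ≤ 2 ^ n := pow_le_pow_right₀ (by norm_num) hn
  have m0 : ((0, 0) : ℤ × ℤ) ∈ V n := mem_V.2 (by simp)
  have m1 : ((1, 0) : ℤ × ℤ) ∈ V n := mem_V.2 (by simp; omega)
  have m2 : ((0, 1) : ℤ × ℤ) ∈ V n := mem_V.2 (by simp; omega)
  by_contra hno
  push Not at hno
  have e0 := hno _ m0
  have e1 := hno _ m1
  have e2 := hno _ m2
  simp only [ne_eq, Prod.ext_iff] at e0 e1 e2
  omega

open Classical in
/-- If `v` cannot be reached within `r` steps, then layer `r` has many points near `u` or near `v`,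
provided that no connected set of closed sites is near these points and that the trees near them have
many open leaves. -/
theorem layer_large {n M t m : ℕ} (hn : 1 ≤ n) (hM : 1 ≤ M) (hm : 2 ^ n ≤ (64 * M) ^ (m + 1))
    {O Cl : Set (ℤ × ℤ)} {u v : ℤ × ℤ} (hu : u ∈ V n) (hv : v ∈ V n)
    (hE : ∀ x, x = u ∨ x = v → ¬ ∃ l : ℕ, ∃ z, Near l z x ∧ ∃ W ∈ starWalks l z,
      W.card = l + 1 ∧ W ⊆ V n ∧ ∀ w ∈ W, w ∈ Cl)
    (hS : ∀ x, x = u ∨ x = v → ∀ w, Near ((64 * M) ^ t : ℕ) w x → w ∈ V n → w ∉ O → w ∈ Cl)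
    (hT : ∀ x, x = u ∨ x = v → ∀ s, t ≤ s → s ≤ m →
      ∀ c, Near (64 * M : ℕ) c (coarse ((64 * M) ^ s) x) → ∀ T ∈ trees M s c, T ⊆ V n →
        (∀ w ∈ T, Near ((64 * M) ^ (s + 1) : ℕ) w x) → M ^ s ≤ 2 * {w ∈ T | w ∈ O}.card)
    {r : ℕ} (hvr : v ∉ reach n O u r) :
    ∃ x, (x = u ∨ x = v) ∧ (1 ≤ {w ∈ nearBox ((64 * M) ^ t) x | w ∈ layer n O u r}.card ∨
      ∃ s ≤ m, M ^ s ≤ 2 * {w ∈ nearBox ((64 * M) ^ (s + 1)) x | w ∈ layer n O u r}.card) := by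
  set C := reach n O u r with hC
  set S := outerBoundary n C v with hSdef
  have hSV : ∀ z ∈ S, z ∈ V n := fun z hz => (outer_subset hv hvr hz.1).1
  have huD : u ∉ outer n C v := fun h => (outer_subset hv hvr h).2 (self_mem_reach r)
  have hsep : ∀ S' : Set (ℤ × ℤ), (∀ z ∈ S', z ∈ V n) → S ⊆ S' → ∀ D : ℤ,
      (∀ z ∈ S', ∀ w ∈ S', Near D z w) →
      (∀ s ∈ S', Near D u s) ∨ (∀ s ∈ S', Near D v s) := by
    intro S' hS'V hSS' D hD
    refine near_of_separates hS'V (f := fun z => z ∈ outer n C v) ?_ hu hv huD mem_outer_self hD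
    intro z hz w hw hzw hzS hwS
    exact outer_iff_of_adj hz hw hzw (fun h => hzS (hSS' h)) (fun h => hwS (hSS' h))
  -- If `S` were empty, any single point `s` would count as a separating set of diameter `0`,
  -- forcing `s = u` or `s = v`.
  have hSne : S.Nonempty := by
    by_contra hempty
    rw [Set.not_nonempty_iff_eq_empty] at hempty
    obtain ⟨s, hs, hsu, hsv⟩ := exists_mem_V_ne hn u v
    rcases hsep {s} (by simpa using hs) (by simp [hempty]) 0 (by simp [Near]) with h | h
    · have h1 := h s rfl
      unfold Near at h1
      exact hsu (Prod.ext (by omega) (by omega))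
    · have h1 := h s rfl
      unfold Near at h1
      exact hsv (Prod.ext (by omega) (by omega))
  have hconn : ConnectedOn (Near 1) S :=
    starConnected_outerBoundary (reach_subset hu r) (connectedOn_reach r) hv hvr
  have hlayer : ∀ w ∈ S, w ∈ O → w ∈ layer n O u r := fun w hw hwO =>
    mem_layer_of_mem_outerBoundary hv hvr hw hwO
  obtain ⟨D, hDn, hD, z, hz, y, hy, hzy⟩ := exists_diam hSV hSne
  obtain ⟨x, hx, hxS⟩ : ∃ x, (x = u ∨ x = v) ∧ ∀ s ∈ S, Near D x s := by
    rcases hsep S hSV subset_rfl D hD with h | h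
    · exact ⟨u, Or.inl rfl, h⟩
    · exact ⟨v, Or.inr rfl, h⟩
  have hnear : ∀ l : ℕ, D ≤ l → ∀ s ∈ S, Near l s x := by
    intro l hl s hs
    have := hxS s hs
    unfold Near at *
    omega
  refine ⟨x, hx, ?_⟩
  -- At small diameter one site of `O` in `S` is enough; without it `S` would be closed and would
  -- contain a walk forbidden by `hE`. At large diameter `S` contains the leaves of a tree.
  rcases lt_or_ge D ((64 * M) ^ t) with hDt | hDt
  · left
    by_contra hno
    have hcl : ∀ w ∈ S, w ∈ Cl := by
      intro w hw
      by_contra hwCl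
      have hwO : w ∈ O := by
        by_contra hwO
        exact hwCl (hS x hx w (hnear _ hDt.le w hw) (hSV w hw) hwO)
      exact hno (Finset.card_pos.2 ⟨w, Finset.mem_filter.2
        ⟨mem_nearBox.2 (hnear _ hDt.le w hw), hlayer w hw hwO⟩⟩)
    obtain ⟨W, hW, hcard, hWS⟩ := hconn.exists_starWalks hz hy hzy
    exact hE x hx ⟨D, z, hnear D le_rfl z hz, W, hW, hcard, fun w hw => hSV w (hWS w hw),
      fun w hw => hcl w (hWS w hw)⟩
  · right
    have hbase : 1 < 64 * M := by omega
    obtain ⟨s, hs1, hs2⟩ := exists_nat_pow_near ((Nat.one_le_pow _ _ (by omega)).trans hDt) hbase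
    have hts : t ≤ s := by
      have := (Nat.pow_lt_pow_iff_right hbase).1 (hDt.trans_lt hs2)
      omega
    have hsm : s ≤ m := by
      have := (Nat.pow_lt_pow_iff_right hbase).1 (hs1.trans_lt (hDn.trans_le hm))
      omega
    have hs1' : ((64 * M) ^ s : ℤ) ≤ D := by exact_mod_cast hs1
    have hpow : (64 * M : ℤ) ^ (s + 1) = (64 * M) ^ s * (64 * M) := pow_succ _ _
    have hs2' : (D : ℤ) ≤ (64 * M) ^ s * (64 * M) := by
      rw [← hpow]
      exact_mod_cast hs2.le
    obtain ⟨T, hT', hTS⟩ := hconn.exists_tree hM (d := s) hz hy (by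
      intro h
      apply hzy
      unfold Near at *
      omega)
    have hroot : Near (64 * M : ℕ) (coarse ((64 * M) ^ s) z) (coarse ((64 * M) ^ s) x) := by
      have hpos : (0 : ℤ) < (64 * M) ^ s := by have := one_le_scale hM s; omega
      have key : ∀ a b : ℤ, a ≤ b + D → a / (64 * M) ^ s ≤ b / (64 * M) ^ s + (64 * M : ℕ) := by
        intro a b hab
        rw [← Int.add_mul_ediv_left b _ hpos.ne']
        refine Int.ediv_le_ediv hpos ?_
        push_cast
        omega
      have := hnear D le_rfl z hz
      exact ⟨key _ _ this.1, key _ _ this.2.1, key _ _ this.2.2.1, key _ _ this.2.2.2⟩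
    have hTnear : ∀ w ∈ T, Near ((64 * M) ^ (s + 1) : ℕ) w x :=
      fun w hw => hnear _ hs2.le w (hTS w hw)
    refine ⟨s, hsm, (hT x hx s hts hsm _ hroot T hT' (fun w hw => hSV w (hTS w hw)) hTnear).trans ?_⟩
    refine Nat.mul_le_mul_left 2 (Finset.card_le_card fun w hw => ?_)
    obtain ⟨hw, hwO⟩ := Finset.mem_filter.1 hw
    exact Finset.mem_filter.2 ⟨mem_nearBox.2 (hTnear w hw), hlayer w (hTS w hw) hwO⟩

/-- The bound on the length of the path: the number of layers that fit into the balls around the two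
end points, weighted by the least number of points of a layer. -/
def lengthBound (M t m : ℕ) : ℝ :=
  2 * ((2 * (64 * M : ℝ) ^ t + 1) ^ 2 +
    ∑ s ∈ Finset.range (m + 1), 2 * (2 * (64 * M : ℝ) ^ (s + 1) + 1) ^ 2 / M ^ s)

open Classical in
-- Double counting: `F x r` weights the points of layer `r` around `x` so that each radius at which
-- the search has not found `v` gives `F u r + F v r ≥ 1`. As layers are disjoint, the sum over `r`
-- is at most the weighted volumes of the balls.
theorem card_layers_le {n M t m : ℕ} (hn : 1 ≤ n) (hM : 1 ≤ M) (hm : 2 ^ n ≤ (64 * M) ^ (m + 1))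
    {O Cl : Set (ℤ × ℤ)} {u v : ℤ × ℤ} (hu : u ∈ V n) (hv : v ∈ V n)
    (hE : ∀ x, x = u ∨ x = v → ¬ ∃ l : ℕ, ∃ z, Near l z x ∧ ∃ W ∈ starWalks l z,
      W.card = l + 1 ∧ W ⊆ V n ∧ ∀ w ∈ W, w ∈ Cl)
    (hS : ∀ x, x = u ∨ x = v → ∀ w, Near ((64 * M) ^ t : ℕ) w x → w ∈ V n → w ∉ O → w ∈ Cl)
    (hT : ∀ x, x = u ∨ x = v → ∀ s, t ≤ s → s ≤ m →
      ∀ c, Near (64 * M : ℕ) c (coarse ((64 * M) ^ s) x) → ∀ T ∈ trees M s c, T ⊆ V n →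
        (∀ w ∈ T, Near ((64 * M) ^ (s + 1) : ℕ) w x) → M ^ s ≤ 2 * {w ∈ T | w ∈ O}.card)
    {R : ℕ} (hvR : ∀ r < R, v ∉ reach n O u r) : (R : ℝ) ≤ lengthBound M t m := by
  have hM' : (0 : ℝ) < M := by exact_mod_cast hM
  let N : ℕ → ℤ × ℤ → ℕ → ℝ := fun l x r => {w ∈ nearBox l x | w ∈ layer n O u r}.card
  let F : ℤ × ℤ → ℕ → ℝ := fun x r => N ((64 * M) ^ t) x r +
    ∑ s ∈ Finset.range (m + 1), 2 / (M : ℝ) ^ s * N ((64 * M) ^ (s + 1)) x r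
  have hF0 : ∀ x r, 0 ≤ F x r := fun x r => by
    have : ∀ l, 0 ≤ N l x r := fun l => Nat.cast_nonneg _
    refine add_nonneg (this _) (Finset.sum_nonneg fun s _ => mul_nonneg (by positivity) (this _))
  have hone : ∀ r ∈ Finset.range R, (1 : ℝ) ≤ F u r + F v r := by
    intro r hr
    have hx : ∃ x, (x = u ∨ x = v) ∧ 1 ≤ F x r := by
      obtain ⟨x, hx, h⟩ := layer_large hn hM hm hu hv hE hS hT (hvR r (Finset.mem_range.1 hr))
      refine ⟨x, hx, ?_⟩
      have hnn : ∀ s, 0 ≤ 2 / (M : ℝ) ^ s * N ((64 * M) ^ (s + 1)) x r := fun s =>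
        mul_nonneg (by positivity) (Nat.cast_nonneg _)
      rcases h with h | ⟨s, hs, h⟩
      · have h1 : (1 : ℝ) ≤ N ((64 * M) ^ t) x r := by
          simp only [N]
          exact_mod_cast h
        exact h1.trans (le_add_of_nonneg_right (Finset.sum_nonneg fun s _ => hnn s))
      · have h1 : (M : ℝ) ^ s ≤ 2 * N ((64 * M) ^ (s + 1)) x r := by
          simp only [N]
          exact_mod_cast h
        have h2 : 1 ≤ 2 / (M : ℝ) ^ s * N ((64 * M) ^ (s + 1)) x r := by
          rw [div_mul_eq_mul_div, le_div_iff₀ (by positivity), one_mul]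
          exact h1
        have h3 := Finset.single_le_sum (f := fun s => 2 / (M : ℝ) ^ s *
          N ((64 * M) ^ (s + 1)) x r) (fun s _ => hnn s) (Finset.mem_range.2 (Nat.lt_succ_of_le hs))
        exact (h2.trans h3).trans (le_add_of_nonneg_left (Nat.cast_nonneg _))
    obtain ⟨x, rfl | rfl, h⟩ := hx
    · linarith [hF0 v r]
    · linarith [hF0 u r]
  have hsumN : ∀ (l : ℕ) (x : ℤ × ℤ),
      ∑ r ∈ Finset.range R, N l x r ≤ (2 * (l : ℝ) + 1) ^ 2 := by
    intro l x
    have := sum_card_layer_le (n := n) (O := O) (u := u) (nearBox l x) R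
    rw [card_nearBox] at this
    simp only [N]
    exact_mod_cast this
  have hsumF : ∀ x, ∑ r ∈ Finset.range R, F x r ≤ (2 * (64 * M : ℝ) ^ t + 1) ^ 2 +
      ∑ s ∈ Finset.range (m + 1), 2 * (2 * (64 * M : ℝ) ^ (s + 1) + 1) ^ 2 / M ^ s := by
    intro x
    simp only [F]
    rw [Finset.sum_add_distrib, Finset.sum_comm]
    refine add_le_add ?_ (Finset.sum_le_sum fun s _ => ?_)
    · have := hsumN ((64 * M) ^ t) x
      push_cast at this
      exact this
    · rw [← Finset.mul_sum]
      have := hsumN ((64 * M) ^ (s + 1)) x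
      push_cast at this
      calc _ ≤ 2 / (M : ℝ) ^ s * (2 * (64 * M : ℝ) ^ (s + 1) + 1) ^ 2 := by gcongr
        _ = _ := by ring
  calc (R : ℝ) = ∑ r ∈ Finset.range R, (1 : ℝ) := by simp
    _ ≤ ∑ r ∈ Finset.range R, (F u r + F v r) := Finset.sum_le_sum hone
    _ ≤ lengthBound M t m := by
        rw [Finset.sum_add_distrib, lengthBound]
        linarith [hsumF u, hsumF v]

/-! ### From the bounds on single levels to good leaves -/

/-- If the field is not too large on average at the fine levels, nowhere too large at the coarse
levels, and few leaves are closed, then half of the leaves of a tree are open and low. -/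
theorem tree_half_good {k M : ℕ} (hM : 1 ≤ M) (hk : 64 * M = 2 ^ k) {δ h θ : ℝ} (hθ : 0 < θ)
    (hpos : 0 < h) {β : ℕ × (ℤ × ℤ) → ℝ} {cl : ℤ × ℤ → Bool} {i s m : ℕ} (his : i ≤ s) (him : i ≤ m)
    (hh : 4 * (i * (δ * k)) ≤ h) {c : ℤ × ℤ} {T : Finset (ℤ × ℤ)} (hT : T ∈ trees M s c)
    (hcoarse : ∀ w ∈ T, partialField k i m β w ≤ h / 2)
    (hfine : ∀ j < i, ∀ T' ∈ trees M (s - j) c, ∏ c' ∈ T', blockBound k j (j + 1) θ c' β <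
      ENNReal.ofReal (Real.exp (θ * (δ * k / 2 * M ^ (s - j)))))
    (hclosed : 4 * {w ∈ T | cl w = false}.card < M ^ s) :
    M ^ s ≤ 2 * {w ∈ T | cl w = true ∧ partialField k 0 m β w ≤ h}.card := by
  by_contra hcon
  have hM' : (0 : ℝ) < M := by exact_mod_cast hM
  set H := {w ∈ T | h < partialField k 0 m β w} with hH
  have hcard : T.card ≤ {w ∈ T | cl w = true ∧ partialField k 0 m β w ≤ h}.card +
      ({w ∈ T | cl w = false}.card + H.card) := by
    refine (Finset.card_le_card ?_).trans ((Finset.card_union_le _ _).trans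
      (Nat.add_le_add_left (Finset.card_union_le _ _) _))
    intro w hw
    simp only [hH, Finset.mem_union, Finset.mem_filter, hw, true_and]
    cases cl w
    · simp
    · simpa using le_or_gt (partialField k 0 m β w) h
  rw [card_of_mem_trees hM hT] at hcard
  have hHcard : M ^ s < 4 * H.card := by omega
  -- With positive parts, discarding the leaves outside `H` can only decrease the sum.
  let g : ℕ → ℤ × ℤ → ℝ := fun j w => max (partialField k j (j + 1) β w) 0
  have hg : ∀ j < i, ∑ w ∈ T, g j w ≤ M ^ s * (δ * k / 2) := by
    intro j hj
    obtain ⟨T', hT', hsum⟩ := exists_truncated_tree (j := j) (a := s - j) hM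
      (by rwa [Nat.add_sub_cancel' (by omega)])
    -- By `exp_partialField_le`, `blockBound` dominates both `1` and `exp (θ φ)` on its block, so
    -- `G` dominates the positive part of the level. The sum of `G` is the logarithm of the product
    -- controlled by `hfine`.
    let G : ℤ × ℤ → ℝ := fun c' => Real.log (blockBound k j (j + 1) θ c' β).toReal / θ
    have hbb : ∀ c', 0 < (blockBound k j (j + 1) θ c' β).toReal := fun c' =>
      ENNReal.toReal_pos (zero_lt_one.trans_le (one_le_blockBound β)).ne' (blockBound_lt_top β).ne
    have hgG : ∀ w c', Near 1 (coarse ((64 * M) ^ j) w) c' → g j w ≤ G c' := by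
      intro w c' hw
      have hscale : (64 * M : ℤ) ^ j = 2 ^ (j * k) := by
        rw [mul_comm j k, pow_mul]
        congr 1
        exact_mod_cast hk
      rw [hscale] at hw
      have h1 := exp_partialField_le (J' := j + 1) (θ := θ) hw β
      rw [le_div_iff₀ hθ, mul_comm, Real.le_log_iff_exp_le (hbb c')]
      refine (ENNReal.ofReal_le_iff_le_toReal (blockBound_lt_top β).ne).1 (le_trans ?_ h1)
      rcases le_total (partialField k j (j + 1) β w) 0 with h0 | h0
      · simp only [g, max_eq_right h0, mul_zero, Real.exp_zero, ENNReal.ofReal_one]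
        exact le_self_add
      · simp only [g, max_eq_left h0]
        exact le_add_self
    refine (hsum _ _ hgG).trans ?_
    have h2 : ∑ c' ∈ T', G c' ≤ δ * k / 2 * M ^ (s - j) := by
      simp only [G]
      rw [← Finset.sum_div, div_le_iff₀ hθ, mul_comm, ← Real.log_prod fun c' _ => (hbb c').ne',
        Real.log_le_iff_le_exp (Finset.prod_pos fun c' _ => hbb c'), ← ENNReal.toReal_prod]
      exact ENNReal.toReal_le_of_le_ofReal (Real.exp_pos _).le (hfine j hj T' hT').le
    calc (M : ℝ) ^ j * ∑ c' ∈ T', G c' ≤ M ^ j * (δ * k / 2 * M ^ (s - j)) := by gcongr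
      _ = M ^ s * (δ * k / 2) := by
          have : (M : ℝ) ^ s = M ^ j * M ^ (s - j) := by
            rw [← pow_add, Nat.add_sub_cancel' (by omega)]
          rw [this]
          ring
  have hupper : ∑ w ∈ T, ∑ j ∈ Finset.range i, g j w ≤ M ^ s * (i * (δ * k) / 2) := by
    rw [Finset.sum_comm]
    refine (Finset.sum_le_card_nsmul _ _ _ fun j hj => hg j (Finset.mem_range.1 hj)).trans ?_
    rw [Finset.card_range, nsmul_eq_mul]
    exact le_of_eq (by ring)
  have hlower : H.card * (h / 2) ≤ ∑ w ∈ T, ∑ j ∈ Finset.range i, g j w := by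
    have h1 : ∀ w ∈ H, h / 2 ≤ ∑ j ∈ Finset.range i, g j w := by
      intro w hw
      obtain ⟨hwT, hwh⟩ := Finset.mem_filter.1 hw
      have h2 : partialField k 0 m β w = ∑ j ∈ Finset.range i, partialField k j (j + 1) β w +
          partialField k i m β w := by
        simp only [partialField, Nat.Ico_succ_singleton, Finset.sum_singleton]
        rw [← Finset.sum_Ico_consecutive _ (Nat.zero_le i) him, Nat.Ico_zero_eq_range]
      have h3 : ∑ j ∈ Finset.range i, partialField k j (j + 1) β w ≤
          ∑ j ∈ Finset.range i, g j w := Finset.sum_le_sum fun j _ => le_max_left _ _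
      linarith [hcoarse w hwT]
    calc (H.card : ℝ) * (h / 2) = H.card • (h / 2) := by rw [nsmul_eq_mul]
      _ ≤ ∑ w ∈ H, ∑ j ∈ Finset.range i, g j w := Finset.card_nsmul_le_sum _ _ _ h1
      _ ≤ _ := Finset.sum_le_sum_of_subset_of_nonneg (Finset.filter_subset _ _)
          fun w _ _ => Finset.sum_nonneg fun j _ => le_max_right _ _
  have hHcard' : (M : ℝ) ^ s < 4 * H.card := by exact_mod_cast hHcard
  have hMs : (0 : ℝ) < M ^ s := by positivity
  have hcmp := hlower.trans hupper
  -- Markov's inequality: the fine levels average at most `h / 8`, whereas every leaf of `H` needs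
  -- at least `h / 2` from them, so `H` has at most a quarter of the leaves.
  have h4 : (M : ℝ) ^ s * (i * (δ * k) / 2) ≤ M ^ s * (h / 8) :=
    mul_le_mul_of_nonneg_left (by linarith) hMs.le
  nlinarith

/-! ### The good event and its probability -/

section Union

variable {Ω : Type*} [MeasurableSpace Ω] {μ : Measure Ω}

theorem measureReal_biUnion_le_card_mul {ι : Type*} (s : Finset ι) (f : ι → Set Ω) {x : ℝ}
    (h : ∀ i ∈ s, μ.real (f i) ≤ x) : μ.real (⋃ i ∈ s, f i) ≤ s.card * x := by
  refine (measureReal_biUnion_finset_le s f).trans ?_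
  rw [← nsmul_eq_mul]
  exact Finset.sum_le_card_nsmul _ _ _ h

end Union

theorem field_eq_partialField {Ω : Type*} (k n : ℕ) (b : ℕ → ℤ × ℤ → Ω → ℝ)
    (z : ℤ × ℤ) (ω : Ω) :
    field k n b z ω = partialField k 0 (n / k) (fun i => b i.1 i.2 ω) z := by
  simp only [field, partialField, Nat.Ico_zero_eq_range]

/-- The bound on the probability that the field spoils the construction of the path. -/
def fieldError (k t m : ℕ) (δ A h : ℝ) : ℝ :=
  (m + 1) * ((2 * (2 ^ k : ℝ) ^ (t + 1) + 1) ^ 2 * Real.exp (8 + δ ^ 2 * (A + 48 * k) - δ * (h / 2))) +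
    (m + 1) ^ 2 * ((2 * (2 : ℝ) ^ k + 1) ^ 2 * Real.exp (-2 ^ t))

/-- Four kinds of failure near each end point are excluded: closed walks (`E`), large coarse levels
(`H`), large averages of a fine level over a tree (`X`), and trees with too many closed leaves
(`Z`). Outside them `card_layers_le` forces the search to reach `v`. The factor `4` counts two end
points with the bound `2 * closedRate q p` each. -/
theorem prob_goodPathEvent_ge {Ω : Type*} [MeasurableSpace Ω] {μ : Measure Ω}
    [IsProbabilityMeasure μ] {b : ℕ → ℤ × ℤ → Ω → ℝ} {ξ : ℤ × ℤ → Ω → Bool} {k n q M t : ℕ}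
    {p δ h L : ℝ} (hb : IsBoxFamily μ b) (hξ : IsSiteProcess μ n q p (field k n b) ξ)
    (hM : 2 ≤ M) (hMk : 64 * M = 2 ^ k) (hn : 1 ≤ n) (hp0 : 0 ≤ p) (hp : p ≤ 1) (hδ : 0 < δ)
    (hkδ : 240000 ≤ δ ^ 2 * k) (hε : closedRate q p ≤ ((6 * 36 ^ 72 : ℝ)⁻¹) ^ 4)
    (hh : 4 * (δ * n) ≤ h) (hL : lengthBound M t (n / k) < ⌊L⌋₊) (hL0 : 0 ≤ L)
    {u v : ℤ × ℤ} (hu : u ∈ V n) (hv : v ∈ V n) :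
    1 - 4 * closedRate q p - 2 * fieldError k t (n / k) δ n h ≤
      μ.real (goodPathEvent n (field k n b) ξ u v L h) := by
  have hk : 1 ≤ k := by
    rcases Nat.eq_zero_or_pos k with rfl | h0
    · omega
    · exact h0
  set m := n / k with hmdef
  have hmk : ((m * k : ℕ) : ℝ) ≤ n := by exact_mod_cast Nat.div_mul_le_self n k
  have hn0 : (0 : ℝ) < n := by exact_mod_cast hn
  have hpos : 0 < h := lt_of_lt_of_le (by positivity) hh
  set β : Ω → ℕ × (ℤ × ℤ) → ℝ := fun ω i => b i.1 i.2 ω with hβ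
  have hscale : ∀ s : ℕ, (64 * M : ℤ) ^ s = 2 ^ (s * k) := by
    intro s
    rw [mul_comm s k, pow_mul]
    congr 1
    exact_mod_cast hMk
  have hscaleR : (64 * M : ℝ) = 2 ^ k := by exact_mod_cast hMk
  let E : ℤ × ℤ → Set Ω := fun x => {ω | ∃ l : ℕ, ∃ z, Near l z x ∧ ∃ W ∈ starWalks l z,
    W.card = l + 1 ∧ W ⊆ V n ∧ ∀ w ∈ W, ξ w ω = false}
  -- These cells of side `K ^ i` cover the ball of radius `K ^ (i + t + 1)` around `x`. The event is
  -- used with `i = s - t` for trees at scale `s`, and with `i = 0` for the whole field near `x`.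
  let H : ℤ × ℤ → Set Ω := fun x => ⋃ i ∈ Finset.range (m + 1),
    ⋃ c ∈ nearBox ((64 * M) ^ (t + 1)) (coarse (2 ^ (i * k)) x),
      {ω | ∃ w, Near 1 (coarse (2 ^ (i * k)) w) c ∧ h / 2 < partialField k i m (β ω) w}
  -- Only levels `j < s - t` occur, so the truncated trees have at least `2 ^ t` leaves and each
  -- event costs at most `exp (-2 ^ t)`.
  let X : ℤ × ℤ → Set Ω := fun x => ⋃ s ∈ Finset.range (m + 1),
    ⋃ c ∈ nearBox (64 * M) (coarse ((64 * M) ^ s) x), ⋃ j ∈ Finset.range (s - t),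
      {ω | ∃ T ∈ trees M (s - j) c,
        ENNReal.ofReal (Real.exp (δ / 196 * (δ * k / 2 * M ^ (s - j)))) ≤
          ∏ c' ∈ T, blockBound k j (j + 1) (δ / 196) c' (β ω)}
  let Z : ℤ × ℤ → Set Ω := fun x => ⋃ s ∈ Finset.Ico t (m + 1),
    ⋃ c ∈ nearBox (64 * M) (coarse ((64 * M) ^ s) x),
      {ω | ∃ T ∈ trees M s c, T ⊆ V n ∧ M ^ s ≤ 4 * {w ∈ T | ξ w ω = false}.card}
  have hEprob : ∀ x, μ.real (E x) ≤ 2 * closedRate q p := fun x =>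
    hξ.prob_closed_walk_le hp hp0 (hε.trans (by norm_num)) x
  have hHprob : ∀ x, μ.real (H x) ≤ (m + 1) * ((2 * (2 ^ k : ℝ) ^ (t + 1) + 1) ^ 2 *
      Real.exp (8 + δ ^ 2 * (n + 48 * k) - δ * (h / 2))) := by
    intro x
    refine (measureReal_biUnion_le_card_mul (x := (2 * (2 ^ k : ℝ) ^ (t + 1) + 1) ^ 2 *
      Real.exp (8 + δ ^ 2 * (n + 48 * k) - δ * (h / 2))) _ _ fun i _ => ?_).trans_eq ?_
    · refine (measureReal_biUnion_le_card_mul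
        (x := Real.exp (8 + δ ^ 2 * (n + 48 * k) - δ * (h / 2))) _ _ fun c _ => ?_).trans_eq ?_
      · refine (prob_partialField_gt_le hb hk i m hδ.le c (h / 2)).trans (Real.exp_le_exp.2 ?_)
        have h1 : ((m - i : ℕ) : ℝ) * k ≤ n := by
          refine le_trans ?_ hmk
          exact_mod_cast Nat.mul_le_mul_right k (Nat.sub_le m i)
        gcongr
      · rw [card_nearBox]
        push_cast
        rw [hscaleR]
    · rw [Finset.card_range]
      push_cast
      rfl
  have hexp : ∀ s, t ≤ s → Real.exp (-(M ^ s : ℝ)) ≤ Real.exp (-2 ^ t) := by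
    intro s hs
    refine Real.exp_le_exp.2 (neg_le_neg ?_)
    calc (2 : ℝ) ^ t ≤ 2 ^ s := pow_le_pow_right₀ (by norm_num) hs
      _ ≤ (M : ℝ) ^ s := pow_le_pow_left₀ (by norm_num) (by exact_mod_cast hM) s
  have hXprob : ∀ x, μ.real (X x) ≤
      (m + 1) * ((2 * (2 : ℝ) ^ k + 1) ^ 2 * (m * Real.exp (-2 ^ t))) := by
    intro x
    refine (measureReal_biUnion_le_card_mul
      (x := (2 * (2 : ℝ) ^ k + 1) ^ 2 * (m * Real.exp (-2 ^ t))) _ _ fun s hs => ?_).trans_eq ?_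
    · refine (measureReal_biUnion_le_card_mul
        (x := m * Real.exp (-2 ^ t)) _ _ fun c _ => ?_).trans_eq ?_
      · refine (measureReal_biUnion_le_card_mul
          (x := Real.exp (-2 ^ t)) _ _ fun j hj => ?_).trans ?_
        · rw [Finset.mem_range] at hj
          exact (prob_blockBound_tree_le hb hk hM hkδ j (s - j) c).trans (hexp _ (by omega))
        · rw [Finset.mem_range] at hs
          rw [Finset.card_range]
          gcongr
          omega
      · rw [card_nearBox]
        push_cast
        rw [hscaleR]
    · rw [Finset.card_range]
      push_cast
      rfl
  have hZprob : ∀ x, μ.real (Z x) ≤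
      (m + 1) * ((2 * (2 : ℝ) ^ k + 1) ^ 2 * Real.exp (-2 ^ t)) := by
    intro x
    refine (measureReal_biUnion_le_card_mul
      (x := (2 * (2 : ℝ) ^ k + 1) ^ 2 * Real.exp (-2 ^ t)) _ _ fun s hs => ?_).trans ?_
    · refine (measureReal_biUnion_le_card_mul
        (x := Real.exp (-2 ^ t)) _ _ fun c _ => ?_).trans_eq ?_
      · exact (hξ.prob_closed_tree_le hp hp0 hM hε s c).trans (hexp _ (Finset.mem_Ico.1 hs).1)
      · rw [card_nearBox]
        push_cast
        rw [hscaleR]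
    · gcongr
      rw [Nat.card_Ico]
      exact_mod_cast Nat.sub_le (m + 1) t
  let Bad : ℤ × ℤ → Set Ω := fun x => (E x ∪ H x) ∪ (X x ∪ Z x)
  have hBad : ∀ x, μ.real (Bad x) ≤ 2 * closedRate q p + fieldError k t m δ n h := by
    intro x
    have h1 := measureReal_union_le (μ := μ) (E x ∪ H x) (X x ∪ Z x)
    have h2 := measureReal_union_le (μ := μ) (E x) (H x)
    have h3 := measureReal_union_le (μ := μ) (X x) (Z x)
    have h4 : (m + 1) * ((2 * (2 : ℝ) ^ k + 1) ^ 2 * (m * Real.exp (-2 ^ t))) +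
        (m + 1) * ((2 * (2 : ℝ) ^ k + 1) ^ 2 * Real.exp (-2 ^ t)) =
        (m + 1) ^ 2 * ((2 * (2 : ℝ) ^ k + 1) ^ 2 * Real.exp (-2 ^ t)) := by ring
    simp only [Bad, fieldError]
    linarith [hEprob x, hHprob x, hXprob x, hZprob x]
  have hgood : (Bad u ∪ Bad v)ᶜ ⊆ goodPathEvent n (field k n b) ξ u v L h := by
    intro ω hω
    have hωx : ∀ x, x = u ∨ x = v → ω ∉ E x ∧ ω ∉ H x ∧ ω ∉ X x ∧ ω ∉ Z x := by
      intro x hx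
      have hx' : ω ∉ Bad x := by
        rcases hx with rfl | rfl
        · exact fun h => hω (Or.inl h)
        · exact fun h => hω (Or.inr h)
      simp only [Bad, Set.mem_union, not_or] at hx'
      tauto
    have hHω : ∀ x, x = u ∨ x = v → ∀ i ≤ m, ∀ w, Near ((64 * M) ^ (i + t + 1) : ℕ) w x →
        partialField k i m (β ω) w ≤ h / 2 := by
      intro x hx i hi w hw
      by_contra hlt
      refine (hωx x hx).2.1 ?_
      simp only [H, Set.mem_iUnion, Finset.mem_range, exists_prop, mem_nearBox]
      refine ⟨i, by omega, coarse (2 ^ (i * k)) w, ?_, w, by simp [Near], not_le.1 hlt⟩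
      have hpos' : (0 : ℤ) < 2 ^ (i * k) := by positivity
      have key : ∀ a b : ℤ, a ≤ b + ((64 * M) ^ (i + t + 1) : ℕ) →
          a / 2 ^ (i * k) ≤ b / 2 ^ (i * k) + ((64 * M) ^ (t + 1) : ℕ) := by
        intro a b hab
        rw [← Int.add_mul_ediv_left b _ hpos'.ne']
        refine Int.ediv_le_ediv hpos' ?_
        push_cast at hab ⊢
        rwa [← hscale i, ← pow_add, ← add_assoc]
      exact ⟨key _ _ hw.1, key _ _ hw.2.1, key _ _ hw.2.2.1, key _ _ hw.2.2.2⟩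
    have hlow : ∀ x, x = u ∨ x = v → ∀ w, Near ((64 * M) ^ t : ℕ) w x →
        field k n b w ω ≤ h := by
      intro x hx w hw
      rw [field_eq_partialField]
      refine (hHω x hx 0 (Nat.zero_le m) w ?_).trans (by linarith)
      have h1 : (64 * M) ^ t ≤ (64 * M) ^ (0 + t + 1) := Nat.pow_le_pow_right (by omega) (by omega)
      unfold Near at *
      omega
    obtain ⟨O, hO⟩ : ∃ O : Set (ℤ × ℤ), ∀ w, w ∈ O ↔ ξ w ω = true ∧ field k n b w ω ≤ h :=
      ⟨{w | ξ w ω = true ∧ field k n b w ω ≤ h}, fun _ => Iff.rfl⟩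
    -- If `u` were closed, the walk with no steps at `u` would realise `E u` with `l = 0`.
    have huO : u ∈ O := by
      refine (hO u).2 ⟨?_, hlow u (Or.inl rfl) u (by unfold Near; omega)⟩
      by_contra hcl
      refine (hωx u (Or.inl rfl)).1 ⟨0, u, by simp [Near], {u}, by simp [starWalks], by simp,
        by simpa using hu, ?_⟩
      intro w hw
      rw [Finset.mem_singleton] at hw
      subst hw
      simpa using hcl
    obtain ⟨r, hr, hvr⟩ : ∃ r < ⌊L⌋₊, v ∈ reach n O u r := by
      by_contra hno
      push Not at hno
      classical
      refine absurd (card_layers_le (M := M) (t := t) (m := m) (Cl := {w | ξ w ω = false}) hn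
        (by omega) ?_ hu hv ?_ ?_ ?_ hno) (not_le.2 hL)
      · rw [hMk, ← pow_mul]
        exact Nat.pow_le_pow_right (by norm_num) (Nat.lt_mul_div_succ n hk).le
      · exact fun x hx => (hωx x hx).1
      · intro x hx w hw hwV hwO
        by_contra hcl
        exact hwO <| (hO w).2 ⟨by simpa using hcl, hlow x hx w hw⟩
      · intro x hx s hts hsm c hc T hT hTV hTx
        have h1 := tree_half_good (k := k) (i := s - t) (s := s) (m := m) (δ := δ) (h := h)
          (θ := δ / 196) (β := β ω) (cl := fun w => ξ w ω) (by omega) hMk (by positivity) hpos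
          (Nat.sub_le s t) (by omega) ?_ hT ?_ ?_ ?_
        · refine h1.trans (Nat.mul_le_mul_left 2 (Finset.card_le_card fun w hw => ?_))
          rw [Finset.mem_filter] at hw ⊢
          refine ⟨hw.1, (hO w).2 ⟨hw.2.1, ?_⟩⟩
          rw [field_eq_partialField]
          exact hw.2.2
        · have h2 : ((s - t : ℕ) : ℝ) * k ≤ n := by
            refine le_trans ?_ hmk
            exact_mod_cast Nat.mul_le_mul_right k (by omega : s - t ≤ m)
          nlinarith
        · intro w hw
          refine hHω x hx (s - t) (by omega) w ?_
          rw [show s - t + t + 1 = s + 1 by omega]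
          exact hTx w hw
        · intro j hj T' hT'
          by_contra hge
          refine (hωx x hx).2.2.1 ?_
          simp only [X, Set.mem_iUnion, Finset.mem_range, exists_prop, mem_nearBox]
          exact ⟨s, by omega, c, hc, j, hj, T', hT', not_lt.1 hge⟩
        · by_contra hge
          refine (hωx x hx).2.2.2 ?_
          simp only [Z, Set.mem_iUnion, Finset.mem_Ico, exists_prop, mem_nearBox]
          exact ⟨s, ⟨hts, by omega⟩, c, hc, T, hT, hTV, not_lt.1 hge⟩
    obtain ⟨P, hP, hlen, hPO⟩ := exists_isPath_of_mem_reach hu huO hvr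
    refine ⟨P, hP, fun w hw => (hPO w hw).1, fun w hw => ((hO w).1 (hPO w hw).2).1, ?_,
      fun w hw => ((hO w).1 (hPO w hw).2).2⟩
    exact (Nat.cast_le.2 (hlen.trans hr)).trans (Nat.floor_le hL0)
  have h1 : (1 : ℝ) ≤ μ.real (Bad u ∪ Bad v) + μ.real (Bad u ∪ Bad v)ᶜ := by
    have := measureReal_union_le (μ := μ) (Bad u ∪ Bad v) (Bad u ∪ Bad v)ᶜ
    rwa [Set.union_compl_self, probReal_univ] at this
  have h2 := measureReal_union_le (μ := μ) (Bad u) (Bad v)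
  have h3 := measureReal_mono hgood (measure_ne_top μ _)
  linarith [hBad u, hBad v]

/-! ### Asymptotics in `n` -/

theorem eventually_mul_pow_le_exp (C : ℝ) (a : ℕ) {c : ℝ} (hc : 0 < c) :
    ∀ᶠ n : ℕ in Filter.atTop, C * (n : ℝ) ^ a ≤ Real.exp (c * n) := by
  have h := (isLittleO_pow_exp_pos_mul_atTop (k := a) hc).const_mul_left C
  filter_upwards [tendsto_natCast_atTop_atTop.eventually (h.bound one_pos)] with n hn
  rw [one_mul, Real.norm_eq_abs, Real.norm_eq_abs, abs_of_pos (Real.exp_pos _)] at hn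
  exact (le_abs_self _).trans hn

/-- The number of fine scales that are treated together. -/
def scaleGap (n : ℕ) : ℕ := 2 * (Nat.log 2 n + 1)

theorem sq_le_two_pow_scaleGap (n : ℕ) : n ^ 2 ≤ 2 ^ scaleGap n := by
  rw [scaleGap, mul_comm, pow_mul]
  exact Nat.pow_le_pow_left (Nat.lt_pow_succ_log_self (by norm_num) n).le 2

theorem two_pow_scaleGap_le {n : ℕ} (hn : 1 ≤ n) : 2 ^ scaleGap n ≤ 4 * n ^ 2 := by
  rw [scaleGap, mul_comm, pow_mul, pow_succ]
  have := Nat.pow_log_le_self 2 (by omega : n ≠ 0)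
  calc (2 ^ Nat.log 2 n * 2) ^ 2 ≤ (n * 2) ^ 2 := Nat.pow_le_pow_left (by omega) 2
    _ = 4 * n ^ 2 := by ring

/-- The choice of `scaleGap` makes `2 ^ t` at least `n ^ 2`, so that `exp (-2 ^ t)` is negligible,
while `K ^ t` remains polynomial in `n`. -/
theorem two_pow_pow_scaleGap_le (k : ℕ) {n : ℕ} (hn : 1 ≤ n) :
    (((2 : ℝ) ^ k) ^ scaleGap n) ^ 2 ≤ 16 ^ k * (n : ℝ) ^ (4 * k) := by
  have h : ((2 : ℝ) ^ scaleGap n) ≤ 4 * n ^ 2 := by exact_mod_cast two_pow_scaleGap_le hn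
  calc (((2 : ℝ) ^ k) ^ scaleGap n) ^ 2 = (2 ^ scaleGap n) ^ (2 * k) := by
        rw [← pow_mul, ← pow_mul, ← pow_mul]
        ring_nf
    _ ≤ (4 * (n : ℝ) ^ 2) ^ (2 * k) := by gcongr
    _ = 16 ^ k * (n : ℝ) ^ (4 * k) := by
        rw [mul_pow, pow_mul (4 : ℝ) 2 k, ← pow_mul (n : ℝ), show 2 * (2 * k) = 4 * k by ring]
        norm_num

/-- For the coarse levels the gain `δ h / 2 = (7 / 2) log 2 * δ ^ 2 n` exceeds `2 δ ^ 2 n`, against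
a moment cost of `δ ^ 2 n`. This leaves `exp (-δ ^ 2 n)` times a polynomial, which is beaten by `ζ <
δ ^ 2`. -/
theorem eventually_fieldError_le {k : ℕ} {δ ζ : ℝ} (hδ : 0 < δ) (hζ : ζ < δ ^ 2)
    (hζ1 : ζ < 1) : ∀ᶠ n : ℕ in Filter.atTop,
      2 * fieldError k (scaleGap n) (n / k) δ n (7 * δ * (n * Real.log 2)) ≤ Real.exp (-ζ * n) := by
  have e1 := eventually_mul_pow_le_exp
    (72 * (2 ^ k) ^ 2 * 16 ^ k * Real.exp (8 + δ ^ 2 * (48 * k))) (4 * k + 1) (sub_pos.2 hζ)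
  have e2 := eventually_mul_pow_le_exp (16 * (2 * (2 : ℝ) ^ k + 1) ^ 2) 2 (sub_pos.2 hζ1)
  filter_upwards [e1, e2, Filter.eventually_ge_atTop 1] with n h1 h2 hn
  have hn1 : (1 : ℝ) ≤ n := by exact_mod_cast hn
  have hm : ((n / k : ℕ) : ℝ) + 1 ≤ 2 * n := by
    have : ((n / k : ℕ) : ℝ) ≤ n := by exact_mod_cast Nat.div_le_self n k
    linarith
  have hm0 : (0 : ℝ) ≤ ((n / k : ℕ) : ℝ) + 1 := by positivity
  have hlog := Real.log_two_gt_d9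
  have hpow := two_pow_pow_scaleGap_le k hn
  have hx1 : (1 : ℝ) ≤ (2 ^ k) ^ (scaleGap n + 1) := one_le_pow₀ (one_le_pow₀ (by norm_num))
  have ha : (2 * (2 ^ k : ℝ) ^ (scaleGap n + 1) + 1) ^ 2 ≤
      9 * ((2 ^ k) ^ 2 * (16 ^ k * (n : ℝ) ^ (4 * k))) := by
    calc (2 * (2 ^ k : ℝ) ^ (scaleGap n + 1) + 1) ^ 2
        ≤ (3 * (2 ^ k : ℝ) ^ (scaleGap n + 1)) ^ 2 := by
          gcongr
          linarith
      _ = 9 * ((2 ^ k) ^ 2 * ((2 ^ k : ℝ) ^ scaleGap n) ^ 2) := by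
          rw [pow_succ (2 ^ k : ℝ) (scaleGap n)]
          ring
      _ ≤ _ := by gcongr
  have hexp1 : Real.exp (8 + δ ^ 2 * (n + 48 * k) - δ * (7 * δ * (n * Real.log 2) / 2)) ≤
      Real.exp (8 + δ ^ 2 * (48 * k)) * Real.exp (-δ ^ 2 * n) := by
    rw [← Real.exp_add]
    refine Real.exp_le_exp.2 ?_
    have : 0 ≤ δ ^ 2 * n := by positivity
    nlinarith
  have hexp2 : Real.exp (-2 ^ scaleGap n) ≤ Real.exp (-1 * n) := by
    refine Real.exp_le_exp.2 ?_
    have h3 : ((n : ℝ)) ^ 2 ≤ 2 ^ scaleGap n := by exact_mod_cast sq_le_two_pow_scaleGap n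
    nlinarith
  have hfirst : ((n / k : ℕ) + 1 : ℝ) * ((2 * (2 ^ k : ℝ) ^ (scaleGap n + 1) + 1) ^ 2 *
      Real.exp (8 + δ ^ 2 * (n + 48 * k) - δ * (7 * δ * (n * Real.log 2) / 2))) ≤
      Real.exp (-ζ * n) / 4 := by
    calc _ ≤ 2 * n * (9 * ((2 ^ k) ^ 2 * (16 ^ k * (n : ℝ) ^ (4 * k))) *
          (Real.exp (8 + δ ^ 2 * (48 * k)) * Real.exp (-δ ^ 2 * n))) := by gcongr
      _ = (72 * (2 ^ k) ^ 2 * 16 ^ k * Real.exp (8 + δ ^ 2 * (48 * k)) * (n : ℝ) ^ (4 * k + 1)) *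
          Real.exp (-δ ^ 2 * n) / 4 := by ring
      _ ≤ Real.exp ((δ ^ 2 - ζ) * n) * Real.exp (-δ ^ 2 * n) / 4 := by gcongr
      _ = Real.exp (-ζ * n) / 4 := by
          rw [← Real.exp_add]
          ring_nf
  have hsecond : ((n / k : ℕ) + 1 : ℝ) ^ 2 * ((2 * (2 : ℝ) ^ k + 1) ^ 2 *
      Real.exp (-2 ^ scaleGap n)) ≤ Real.exp (-ζ * n) / 4 := by
    calc _ ≤ (2 * n : ℝ) ^ 2 * ((2 * (2 : ℝ) ^ k + 1) ^ 2 * Real.exp (-1 * n)) := by gcongr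
      _ = (16 * (2 * (2 : ℝ) ^ k + 1) ^ 2 * (n : ℝ) ^ 2) * Real.exp (-1 * n) / 4 := by ring
      _ ≤ Real.exp ((1 - ζ) * n) * Real.exp (-1 * n) / 4 := by gcongr
      _ = Real.exp (-ζ * n) / 4 := by
          rw [← Real.exp_add]
          ring_nf
  rw [fieldError]
  linarith

/-- Since `K ^ 2 / M = 64 K`, the term at scale `s` is of order `(64 K) ^ s`, which is at most `2 ^
((6 + k) m) ≤ N ^ (1 + δ)` because `6 ≤ δ k`. The remaining factor `N ^ δ` absorbs everything
polynomial in `n`. -/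
theorem eventually_lengthBound_lt {k M : ℕ} {δ : ℝ} (hδ : 0 < δ) (hk : 1 ≤ k) (hM : 1 ≤ M)
    (hMk : 64 * M = 2 ^ k) (hkδ : 6 ≤ δ * k) : ∀ᶠ n : ℕ in Filter.atTop,
      lengthBound M (scaleGap n) (n / k) <
        ⌊Real.exp ((1 + 2 * δ) * (n * Real.log 2))⌋₊ := by
  have hlog := Real.log_pos (show (1 : ℝ) < 2 by norm_num)
  filter_upwards [eventually_mul_pow_le_exp (18 * 16 ^ k + 72 * (2 ^ k) ^ 2 + 1) (4 * k)
    (mul_pos hδ hlog), Filter.eventually_ge_atTop 1] with n h1 hn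
  have hn1 : (1 : ℝ) ≤ n := by exact_mod_cast hn
  have hM' : (0 : ℝ) < M := by exact_mod_cast hM
  have hMkR : (64 * M : ℝ) = 2 ^ k := by exact_mod_cast hMk
  have h2k1 : (1 : ℝ) ≤ 2 ^ k := one_le_pow₀ (by norm_num)
  set m := n / k with hm
  have hmk : m * k ≤ n := Nat.div_mul_le_self n k
  set Q := Real.exp ((1 + δ) * (n * Real.log 2)) with hQ
  have hQ1 : 1 ≤ Q := Real.one_le_exp (by positivity)
  have hsq : ∀ s : ℕ, (2 * (64 * M : ℝ) ^ s + 1) ^ 2 ≤ 9 * ((2 ^ k) ^ s) ^ 2 := by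
    intro s
    have : (1 : ℝ) ≤ (2 ^ k) ^ s := one_le_pow₀ h2k1
    rw [hMkR]
    nlinarith
  have hfirst : (2 * (64 * M : ℝ) ^ scaleGap n + 1) ^ 2 ≤ 9 * (16 ^ k * (n : ℝ) ^ (4 * k)) :=
    (hsq _).trans (by linarith [two_pow_pow_scaleGap_le k hn])
  have hpowQ : (64 * 2 ^ k : ℝ) ^ m ≤ Q := by
    have h64 : (64 * 2 ^ k : ℝ) ^ m = Real.exp (((6 + k) * m : ℕ) * Real.log 2) := by
      rw [Real.exp_nat_mul, Real.exp_log (by norm_num), pow_mul, pow_add]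
      norm_num
    rw [h64, hQ, ← mul_assoc]
    refine Real.exp_le_exp.2 (mul_le_mul_of_nonneg_right ?_ hlog.le)
    have h3 : (m : ℝ) * k ≤ n := by exact_mod_cast hmk
    have hm0 : (0 : ℝ) ≤ m := Nat.cast_nonneg m
    push_cast
    nlinarith
  have hterm : ∀ s ∈ Finset.range (m + 1),
      2 * (2 * (64 * M : ℝ) ^ (s + 1) + 1) ^ 2 / M ^ s ≤ 18 * (2 ^ k) ^ 2 * Q := by
    intro s hs
    rw [Finset.mem_range] at hs
    have h3 : ((2 ^ k : ℝ) ^ s) ^ 2 = (64 * 2 ^ k) ^ s * M ^ s := by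
      rw [← mul_pow, ← pow_mul, mul_comm s 2, pow_mul]
      congr 1
      rw [← hMkR]
      ring
    have h4 : (64 * 2 ^ k : ℝ) ^ s ≤ (64 * 2 ^ k) ^ m :=
      pow_le_pow_right₀ (by linarith) (by omega)
    rw [div_le_iff₀ (by positivity)]
    calc 2 * (2 * (64 * M : ℝ) ^ (s + 1) + 1) ^ 2 ≤ 2 * (9 * ((2 ^ k) ^ (s + 1)) ^ 2) := by
          gcongr
          exact hsq (s + 1)
      _ = 18 * (2 ^ k) ^ 2 * ((2 ^ k : ℝ) ^ s) ^ 2 := by ring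
      _ = 18 * (2 ^ k) ^ 2 * (64 * 2 ^ k) ^ s * M ^ s := by
          rw [h3]
          ring
      _ ≤ 18 * (2 ^ k) ^ 2 * Q * M ^ s := by
          gcongr
          exact h4.trans hpowQ
  have hsum := Finset.sum_le_card_nsmul _ _ _ hterm
  rw [Finset.card_range, nsmul_eq_mul] at hsum
  have hm2 : ((m + 1 : ℕ) : ℝ) ≤ 2 * n := by
    have : (m : ℝ) ≤ n := by exact_mod_cast Nat.div_le_self n k
    push_cast
    linarith
  have hnp : (n : ℝ) ≤ (n : ℝ) ^ (4 * k) := le_self_pow₀ hn1 (by omega)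
  have hnp1 : 1 ≤ (n : ℝ) ^ (4 * k) := one_le_pow₀ hn1
  have htotal : lengthBound M (scaleGap n) m + 1 ≤
      (18 * 16 ^ k + 72 * (2 ^ k) ^ 2 + 1) * (n : ℝ) ^ (4 * k) * Q := by
    have a1 : (16 : ℝ) ^ k * (n : ℝ) ^ (4 * k) ≤ 16 ^ k * (n : ℝ) ^ (4 * k) * Q :=
      le_mul_of_one_le_right (by positivity) hQ1
    have a2 : ((m + 1 : ℕ) : ℝ) * (18 * (2 ^ k) ^ 2 * Q) ≤
        2 * (n : ℝ) ^ (4 * k) * (18 * (2 ^ k) ^ 2 * Q) := by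
      gcongr
      linarith
    have a3 : 1 ≤ (n : ℝ) ^ (4 * k) * Q := one_le_mul_of_one_le_of_one_le hnp1 hQ1
    rw [lengthBound]
    linarith
  have hfin : (18 * 16 ^ k + 72 * (2 ^ k) ^ 2 + 1) * (n : ℝ) ^ (4 * k) * Q ≤
      Real.exp ((1 + 2 * δ) * (n * Real.log 2)) := by
    calc _ ≤ Real.exp (δ * Real.log 2 * n) * Q := by gcongr
      _ = _ := by
        rw [hQ, ← Real.exp_add]
        ring_nf
  have hfloor := Nat.sub_one_lt_floor (Real.exp ((1 + 2 * δ) * (n * Real.log 2)))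
  linarith

end CoarseMBRW

end

/-! ### Choice of the constants -/

theorem theorem1p3 (δ : ℝ) (hδ : 0 < δ) (hδ' : δ < 1 / 2) (q : ℕ) (hq : 1 ≤ q) :
    ∃ K₁ p₁ : ℝ, 0 < K₁ ∧ 0 < p₁ ∧ p₁ < 1 ∧
      ∀ κ ζ : ℝ, 0 < κ → κ < δ ^ 2 / 2 → 0 < ζ → ζ < δ ^ 4 * Real.log 2 ^ 2 / 4 →
      ∀ k : ℕ, 1 ≤ k → K₁ ≤ (2 : ℝ) ^ k →
      ∀ p : ℝ, p₁ ≤ p → p ≤ 1 →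
      ∃ n₀ : ℕ, ∀ n N : ℕ, n₀ ≤ n → N = 2 ^ n →
      ∀ (Ω : Type*) [MeasurableSpace Ω] (μ : Measure Ω) [IsProbabilityMeasure μ]
        (b : ℕ → ℤ × ℤ → Ω → ℝ) (ξ : ℤ × ℤ → Ω → Bool),
        CoarseMBRW.IsBoxFamily μ b →
        CoarseMBRW.IsSiteProcess μ n q p (CoarseMBRW.field k n b) ξ →
      ∀ u ∈ CoarseMBRW.V n, ∀ v ∈ CoarseMBRW.V n, (N : ℝ) ^ (1 - κ) < dist u v →
        1 - 128 * (1 - p) ^ (1 / (2 * (q : ℝ) + 1) ^ 2) - Real.exp (-ζ * n) ≤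
          μ.real (CoarseMBRW.goodPathEvent n (CoarseMBRW.field k n b) ξ u v
            ((N : ℝ) ^ (1 + 2 * δ)) (7 * δ * Real.log N)) := by
  obtain ⟨k₀, hk₀⟩ := exists_nat_ge (240000 / δ ^ 2)
  set η : ℝ := ((6 * 36 ^ 72 : ℝ)⁻¹) ^ 4 with hη
  have hη0 : 0 < η := by positivity
  have hη1 : η < 1 := by
    rw [hη]
    exact pow_lt_one₀ (by positivity) (inv_lt_one_of_one_lt₀ (by norm_num)) (by norm_num)
  have hηq : η ^ ((2 * q + 1) ^ 2) < 1 := pow_lt_one₀ hη0.le hη1 (by positivity)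
  -- `K₁` ensures `δ ^ 2 k ≥ 240000`, and `p₁` is the value at which `closedRate q p` equals `η`.
  refine ⟨2 ^ k₀, 1 - η ^ ((2 * q + 1) ^ 2), by positivity, by linarith,
    sub_lt_self _ (by positivity), ?_⟩
  intro κ ζ _ _ _ hζ k hk1 hk p hp hp1
  have hlog0 := Real.log_pos (show (1 : ℝ) < 2 by norm_num)
  have hlog1 := Real.log_two_lt_d9
  have hkk : k₀ ≤ k := (pow_le_pow_iff_right₀ (by norm_num)).1 hk
  have hkδ : 240000 ≤ δ ^ 2 * k := by
    have h1 : 240000 / δ ^ 2 ≤ k := hk₀.trans (by exact_mod_cast hkk)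
    rw [div_le_iff₀ (by positivity)] at h1
    linarith
  have hkδ2 : 6 ≤ δ * k := by
    have : (0 : ℝ) ≤ k := Nat.cast_nonneg k
    nlinarith
  have hk7 : 7 ≤ k := by
    have : (7 : ℝ) ≤ k := by
      have : (0 : ℝ) ≤ k := Nat.cast_nonneg k
      nlinarith
    exact_mod_cast this
  -- The scale ratio is `K = 64 M` with `M ≥ 2`, so `k` must be at least `7`.
  obtain ⟨a, rfl⟩ : ∃ a, k = a + 7 := ⟨k - 7, by omega⟩
  set M := 2 ^ (a + 1) with hMdef
  have hM : 2 ≤ M := by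
    rw [hMdef, pow_succ]
    have : 1 ≤ 2 ^ a := Nat.one_le_two_pow
    omega
  have hMk : 64 * M = 2 ^ (a + 7) := by
    rw [hMdef, show (64 : ℕ) = 2 ^ 6 by norm_num, ← pow_add]
    congr 1
    omega
  have hp0 : 0 ≤ p := by linarith
  have hε : CoarseMBRW.closedRate q p ≤ η := by
    have h1 : 1 - p ≤ η ^ ((2 * (q : ℝ) + 1) ^ 2) := by
      have h2 : η ^ ((2 * (q : ℝ) + 1) ^ 2) = η ^ ((2 * q + 1) ^ 2) := by
        rw [← Real.rpow_natCast η ((2 * q + 1) ^ 2)]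
        push_cast
        norm_num
      rw [h2]
      linarith
    rw [CoarseMBRW.closedRate]
    refine (Real.rpow_le_rpow (by linarith) h1 (by positivity)).trans_eq ?_
    rw [← Real.rpow_mul hη0.le, mul_one_div_cancel (by positivity), Real.rpow_one]
  have hlogsq : Real.log 2 ^ 2 ≤ 1 := pow_le_one₀ hlog0.le (by linarith)
  have hδ2 : δ ^ 2 < 1 := by nlinarith
  have hζ' : ζ < δ ^ 2 := by
    refine hζ.trans_le ?_
    have h4 : δ ^ 4 = δ ^ 2 * δ ^ 2 := by ring
    have : 0 < δ ^ 2 := by positivity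
    nlinarith [mul_nonneg this.le this.le]
  have hev := (CoarseMBRW.eventually_fieldError_le (k := a + 7) hδ hζ' (hζ'.trans hδ2)).and
    ((CoarseMBRW.eventually_lengthBound_lt hδ hk1 (by omega : 1 ≤ M) hMk hkδ2).and
      (Filter.eventually_ge_atTop 1))
  obtain ⟨n₀, hn₀⟩ := Filter.eventually_atTop.1 hev
  refine ⟨n₀, ?_⟩
  intro n N hn hN Ω _ μ _ b ξ hb hξ u hu v hv _
  obtain ⟨herr, hlen, hn1⟩ := hn₀ n hn
  have hlogN : Real.log N = n * Real.log 2 := by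
    rw [hN]
    push_cast
    rw [Real.log_pow]
  have hNpos : (0 : ℝ) < N := by
    rw [hN]
    positivity
  have hL : (N : ℝ) ^ (1 + 2 * δ) = Real.exp ((1 + 2 * δ) * (n * Real.log 2)) := by
    rw [Real.rpow_def_of_pos hNpos, hlogN, mul_comm]
  rw [hL, hlogN]
  -- This holds because `7 log 2 > 4`; it is the room that Markov's inequality on the leaves needs.
  have hh : 4 * (δ * n) ≤ 7 * δ * (n * Real.log 2) := by
    have : 0 ≤ δ * n := by positivity
    have hlog2 := Real.log_two_gt_d9
    nlinarith
  have hmain := CoarseMBRW.prob_goodPathEvent_ge hb hξ hM hMk hn1 hp0 hp1 hδ hkδ hε hh hlen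
    (Real.exp_pos _).le hu hv
  have hε0 : 0 ≤ CoarseMBRW.closedRate q p := CoarseMBRW.closedRate_nonneg hp1
  rw [show (1 - p) ^ (1 / (2 * (q : ℝ) + 1) ^ 2) = CoarseMBRW.closedRate q p from rfl]
  linarith
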